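/- **Conventions.** Let $R$ be a commutative ring and $n\ge 1$. Let $\lambda=\{a\in R^n:\sum_i a_i=0\}$ be the standard representation of $\Sigma_n$ ($\sigma e_i=e_{\sigma(i)}$), of rank $n-1$, with the generators $y_i=e_i-e_{i+1}$ (indices $i\in\mathbb Z/n$, so $\sum_i y_i=0$) placed in degree $-2$. Let $$N=\prod_{i\ne j}(e_i-e_j)\in\operatorname{Sym}(\lambda),$$ the product of all $\Sigma_n$-translates of $y_0$. $\operatorname{Conf}(\mathbb A^1,n)$ is the space over $R$ whose $C$-points are the $x\in C^n$ with $x_i-x_j\in C^\times$ for $i\neq j$; $\mathbb G_a\rtimes\mathbb G_m$ acts on it by $t\mapsto at+b$, and $\Sigma_n$ acts by $\sigma(x)_i=x_{\sigma(i)}$. Quotients $X/\!/G$ are quotient stacks: an object over $\operatorname{Spec}A$ is a $G$-torsor with an equivariant map to $X$. **(1) Global statement.** $\operatorname{Sym}(\lambda)[N^{-1}]$ is a $\mathbb Z$-graded ring with $\lambda$ in degree $-2$, and the action of $\mathbb G_m$ on its spectrum that multiplies the elements of $\lambda$ by $\mu$ multiplies the elements of degree $-2m$ by $\mu^m$. There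 is a $\Sigma_n$-equivariant equivalence (with coherent equivariance isomorphisms) of stacks over affine $R$-schemes $$\operatorname{Conf}(\mathbb A^1,n)/\!/(\mathbb G_a\rtimes\mathbb G_m)\;\simeq\;\operatorname{Spec}\bigl(\operatorname{Sym}(\lambda)[N^{-1}]\bigr)/\!/\mathbb G_m .$$ **(2) Completed statement.** Let $p$ be a prime, $k$ a field of characteristic $p$, $R=W(k)$ and $n=p$. Let $P=(0,1,\dots,p-1)$ be the configuration $\mathbb F_p\subset\mathbb A^1$ over $k$, and $I=(p,\;y_i-y_j : i,j)\subset \operatorname{Sym}(\lambda)[N^{-1}]$. We work over complete local $W(k)$-algebras $A$ with finitely generated maximal ideal and a map to the residue field $k$. For a subgroup $\Gamma\le\Sigma_p$ let $\mathrm{Def}_\Gamma$ be the completion of $\operatorname{Conf}(\mathbb A^1,p)/\!/(\mathbb G_a\rtimes\mathbb G_m)$ at the $\Gamma$-translates of $P$, that is, the objects of the stack over $A$ whose restriction to $k$ is isomorphic to $P\circ\gamma$ for some $\gamma\in\Gamma$, with all morphisms of the stack. In particular $\mathrm{Def}_{\{1\}}=\mathrm{Def}_{(\mathbb A^1;p)}=\operatorname{Conf}(\mathbb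 A^1,p)^\wedge_P$. Let $J_\Gamma=\bigcap_{\gamma\in\Gamma}\gamma^{-1}(I)$. Then for every $\Gamma$ there is a $\Gamma$-equivariant equivalence (with coherent equivariance isomorphisms) $$\mathrm{Def}_\Gamma\;\simeq\;\operatorname{Sym}(\lambda)[N^{-1}]^\wedge_{J_\Gamma}/\!/\mathbb G_m ,$$ where the objects of the right-hand side over $A$ are the continuous $W(k)$-algebra homomorphisms from the completed ring to $A$, and its morphisms are given by maps of the algebras $A$ together with a unit $\mu$ that scales the values on $\lambda$ by $\mu$. If every element of $\Gamma$ is an affine permutation $i\mapsto ai+b$ of $\mathbb F_p$, then $J_\Gamma=I$; thus $\mathrm{Def}_{(\mathbb A^1;p)}$ is represented by $\operatorname{Sym}(\lambda)[N^{-1}]^\wedge_I/\!/\mathbb G_m$, and $\mathrm{Def}_\Gamma\simeq \operatorname{Sym}(\lambda)[N^{-1}]^\wedge_I/\!/\mathbb G_m$ equivariantly for such $\Gamma$. Finally, the canonical map identifies the completion at $I$ of $\operatorname{Sym}(\lambda)[(\prod_{i}y_i)^{-1}]$, where only the cyclic translates $y_i=\sigma^i(y_0)$ ($\sigma$ the rotation)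 are inverted, with $\operatorname{Sym}(\lambda)[N^{-1}]^\wedge_I$, as topological rings. -/

import Mathlib

universe u

open CategoryTheory

noncomputable section

namespace ConfModuli

/-! ### Spaces with a group action, as functors of points on affine schemes

An affine scheme over `R` is given by its coordinate ring, an object of `CommAlgCat R`; a
`C`-point of `Spec E` is a morphism `E ⟶ C`. -/

section QuotientStacks

variable {R : Type u} [CommRing R]

/-- A space over `R` (given by its functor of points) with an action of the group functor `G`. -/
structure GSpace (G : CommAlgCat.{u} R ⥤ GrpCat.{u}) where
  /-- the set of `C`-points -/
  pts : CommAlgCat.{u} R → Type u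
  /-- functoriality in `C` -/
  map : ∀ {C D : CommAlgCat.{u} R}, (C ⟶ D) → pts C → pts D
  map_id : ∀ {C : CommAlgCat.{u} R} (x : pts C), map (𝟙 C) x = x
  map_comp : ∀ {C D E : CommAlgCat.{u} R} (f : C ⟶ D) (g : D ⟶ E) (x : pts C),
    map (f ≫ g) x = map g (map f x)
  /-- the action of `G(C)` on the `C`-points -/
  [act : ∀ C, MulAction (G.obj C) (pts C)]
  map_smul : ∀ {C D : CommAlgCat.{u} R} (f : C ⟶ D) (g : G.obj C) (x : pts C),
    map f (g • x) = G.map f g • map f x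

attribute [instance] GSpace.act

/-- A `G`-equivariant self-map of a `G`-space. -/
structure GSpace.End {G : CommAlgCat.{u} R ⥤ GrpCat.{u}} (X : GSpace G) where
  /-- the map on `C`-points -/
  app : ∀ C, X.pts C → X.pts C
  app_map : ∀ {C D : CommAlgCat.{u} R} (f : C ⟶ D) (x : X.pts C),
    app D (X.map f x) = X.map f (app C x)
  app_smul : ∀ (C : CommAlgCat.{u} R) (g : G.obj C) (x : X.pts C), app C (g • x) = g • app C x

@[ext]
theorem GSpace.End.ext' {G : CommAlgCat.{u} R ⥤ GrpCat.{u}} {X : GSpace G} {φ ψ : X.End}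
    (h : ∀ C x, φ.app C x = ψ.app C x) : φ = ψ := by
  obtain ⟨a, _, _⟩ := φ
  obtain ⟨b, _, _⟩ := ψ
  obtain rfl : a = b := by funext C x; exact h C x
  rfl

/-- The identity of a `G`-space. -/
def GSpace.End.one {G : CommAlgCat.{u} R ⥤ GrpCat.{u}} (X : GSpace G) : X.End where
  app _ x := x
  app_map _ _ := rfl
  app_smul _ _ _ := rfl

/-- First `φ`, then `ψ`. -/
def GSpace.End.comp {G : CommAlgCat.{u} R ⥤ GrpCat.{u}} {X : GSpace G} (φ ψ : X.End) : X.End where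
  app C x := ψ.app C (φ.app C x)
  app_map f x := by rw [φ.app_map, ψ.app_map]
  app_smul C g x := by rw [φ.app_smul, ψ.app_smul]

/-- An object of the quotient stack `X // G` over the affine scheme `Spec A`: a `G`-torsor
`P = Spec E` over `Spec A` together with a `G`-equivariant map `P → X`.

The group acts on the `C`-points of `P`; the torsor condition says that `P → Spec A` is
faithfully flat and invariant, and that `G` acts simply transitively on its fibres.
(For an affine group every torsor over an affine scheme is affine.) -/
structure QuotientStack.Fiber {G : CommAlgCat.{u} R ⥤ GrpCat.{u}} (X : GSpace G)
    (A : CommAlgCat.{u} R) where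
  /-- the coordinate ring of the torsor -/
  E : CommAlgCat.{u} R
  /-- the structure map `Spec E → Spec A` -/
  proj : A ⟶ E
  faithfullyFlat : proj.hom.toRingHom.FaithfullyFlat
  /-- the action of `G(C)` on the `C`-points of the torsor -/
  [act : ∀ C, MulAction (G.obj C) (E ⟶ C)]
  smul_comp : ∀ {C D : CommAlgCat.{u} R} (f : C ⟶ D) (g : G.obj C) (q : E ⟶ C),
    (g • q) ≫ f = G.map f g • (q ≫ f)
  proj_smul : ∀ {C : CommAlgCat.{u} R} (g : G.obj C) (q : E ⟶ C), proj ≫ (g • q) = proj ≫ q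
  simplyTransitive : ∀ {C : CommAlgCat.{u} R} (q q' : E ⟶ C), proj ≫ q = proj ≫ q' →
    ∃! g : G.obj C, g • q = q'
  /-- the equivariant map to `X`, on `C`-points -/
  toX : ∀ {C : CommAlgCat.{u} R}, (E ⟶ C) → X.pts C
  toX_comp : ∀ {C D : CommAlgCat.{u} R} (q : E ⟶ C) (f : C ⟶ D), toX (q ≫ f) = X.map f (toX q)
  toX_smul : ∀ {C : CommAlgCat.{u} R} (g : G.obj C) (q : E ⟶ C), toX (g • q) = g • toX q

attribute [instance] QuotientStack.Fiber.act

/-- A morphism of the quotient stack over `Spec A' → Spec A`: an equivariant map of torsors which is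
compatible with the maps to `X` (such a map exhibits the first torsor as a pullback of the
second one, as every equivariant map between torsors does). -/
structure QuotientStack.FiberHom {G : CommAlgCat.{u} R ⥤ GrpCat.{u}} {X : GSpace G}
    {A A' : CommAlgCat.{u} R} (f : A ⟶ A') (P : Fiber X A) (P' : Fiber X A') where
  /-- the map on coordinate rings -/
  hom : P.E ⟶ P'.E
  proj_hom : P.proj ≫ hom = f ≫ P'.proj
  hom_smul : ∀ {C : CommAlgCat.{u} R} (g : G.obj C) (q : P'.E ⟶ C),
    hom ≫ (g • q) = g • (hom ≫ q)
  toX_hom : ∀ {C : CommAlgCat.{u} R} (q : P'.E ⟶ C), P.toX (hom ≫ q) = P'.toX q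

@[ext]
theorem QuotientStack.FiberHom.ext' {G : CommAlgCat.{u} R ⥤ GrpCat.{u}} {X : GSpace G}
    {A A' : CommAlgCat.{u} R} {f : A ⟶ A'} {P : Fiber X A} {P' : Fiber X A'}
    {a b : FiberHom f P P'} (h : a.hom = b.hom) : a = b := by
  cases a; cases b; cases h; rfl

/-- The identity morphism. -/
def QuotientStack.FiberHom.id {G : CommAlgCat.{u} R ⥤ GrpCat.{u}} {X : GSpace G}
    {A : CommAlgCat.{u} R} (P : Fiber X A) : FiberHom (𝟙 A) P P where
  hom := 𝟙 _
  proj_hom := by simp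
  hom_smul g q := by simp
  toX_hom q := by simp

/-- Composition of morphisms. -/
def QuotientStack.FiberHom.comp {G : CommAlgCat.{u} R ⥤ GrpCat.{u}} {X : GSpace G}
    {A A' A'' : CommAlgCat.{u} R} {f : A ⟶ A'} {f' : A' ⟶ A''}
    {P : Fiber X A} {P' : Fiber X A'} {P'' : Fiber X A''}
    (a : FiberHom f P P') (b : FiberHom f' P' P'') : FiberHom (f ≫ f') P P'' where
  hom := a.hom ≫ b.hom
  proj_hom := by rw [← Category.assoc, a.proj_hom, Category.assoc, b.proj_hom, Category.assoc]
  hom_smul g q := by rw [Category.assoc, b.hom_smul, a.hom_smul, Category.assoc]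
  toX_hom q := by rw [Category.assoc, a.toX_hom, b.toX_hom]

/-- Relabelling: post-compose the map to `X` with an equivariant self-map of `X`. -/
def QuotientStack.Fiber.push {G : CommAlgCat.{u} R ⥤ GrpCat.{u}} {X : GSpace G}
    {A : CommAlgCat.{u} R} (P : Fiber X A) (φ : X.End) : Fiber X A where
  E := P.E
  proj := P.proj
  faithfullyFlat := P.faithfullyFlat
  act := P.act
  smul_comp := P.smul_comp
  proj_smul := P.proj_smul
  simplyTransitive := P.simplyTransitive
  toX q := φ.app _ (P.toX q)
  toX_comp q f := by rw [P.toX_comp, φ.app_map]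
  toX_smul g q := by rw [P.toX_smul, φ.app_smul]

/-- Relabelling of a morphism. -/
def QuotientStack.FiberHom.push {G : CommAlgCat.{u} R ⥤ GrpCat.{u}} {X : GSpace G}
    {A A' : CommAlgCat.{u} R} {f : A ⟶ A'} {P : Fiber X A} {P' : Fiber X A'}
    (a : FiberHom f P P') (φ : X.End) : FiberHom f (P.push φ) (P'.push φ) where
  hom := a.hom
  proj_hom := a.proj_hom
  hom_smul := a.hom_smul
  toX_hom q := congrArg (φ.app _) (a.toX_hom q)

/-- The objects of the quotient stack `X // G`, over all affine schemes. -/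
structure QuotientStack {G : CommAlgCat.{u} R ⥤ GrpCat.{u}} (X : GSpace G) where
  /-- the base is `Spec base` -/
  base : CommAlgCat.{u} R
  /-- the torsor with its equivariant map to `X` -/
  fiber : QuotientStack.Fiber X base

/-- The morphisms of the quotient stack `X // G`. -/
structure QuotientStack.Hom {G : CommAlgCat.{u} R ⥤ GrpCat.{u}} {X : GSpace G}
    (P P' : QuotientStack X) where
  /-- the morphism of the bases -/
  base : P.base ⟶ P'.base
  /-- the morphism of the torsors -/
  fiber : QuotientStack.FiberHom base P.fiber P'.fiber

theorem QuotientStack.Hom.ext' {G : CommAlgCat.{u} R ⥤ GrpCat.{u}} {X : GSpace G}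
    {P P' : QuotientStack X} {a b : Hom P P'} (h : a.base = b.base)
    (h' : a.fiber.hom = b.fiber.hom) : a = b := by
  obtain ⟨f, ⟨x, _, _, _⟩⟩ := a
  obtain ⟨g, ⟨y, _, _, _⟩⟩ := b
  cases h; cases h'; rfl

instance QuotientStack.category {G : CommAlgCat.{u} R ⥤ GrpCat.{u}} (X : GSpace G) :
    Category.{u} (QuotientStack X) where
  Hom := QuotientStack.Hom
  id P := ⟨𝟙 _, FiberHom.id _⟩
  comp a b := ⟨a.base ≫ b.base, a.fiber.comp b.fiber⟩
  id_comp a := Hom.ext' (Category.id_comp _) (Category.id_comp _)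
  comp_id a := Hom.ext' (Category.comp_id _) (Category.comp_id _)
  assoc a b c := Hom.ext' (Category.assoc _ _ _) (Category.assoc _ _ _)

/-- The quotient stack `X // G`, as a category over the (opposite of the) category of affine
schemes over `R`. -/
def quotientStack {G : CommAlgCat.{u} R ⥤ GrpCat.{u}} (X : GSpace G) :
    BasedCategory.{u, u + 1} (CommAlgCat.{u} R) where
  obj := QuotientStack X
  p :=
    { obj := fun P => P.base
      map := fun a => QuotientStack.Hom.base a }

/-- The morphism of quotient stacks induced by an equivariant self-map of `X`. -/
def quotientStackMap {G : CommAlgCat.{u} R ⥤ GrpCat.{u}} {X : GSpace G} (φ : X.End) :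
    BasedFunctor (quotientStack X) (quotientStack X) where
  obj := fun (P : QuotientStack X) => (⟨P.base, P.fiber.push φ⟩ : QuotientStack X)
  map := fun {P P' : QuotientStack X} (a : QuotientStack.Hom P P') =>
    (⟨a.base, a.fiber.push φ⟩ : QuotientStack.Hom ⟨P.base, P.fiber.push φ⟩ ⟨P'.base, P'.fiber.push φ⟩)
  map_id _ := rfl
  map_comp _ _ := rfl
  w := rfl

theorem quotientStackMap_one {G : CommAlgCat.{u} R ⥤ GrpCat.{u}} (X : GSpace G) :
    quotientStackMap (GSpace.End.one X) = BasedFunctor.id _ := rfl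

theorem quotientStackMap_comp {G : CommAlgCat.{u} R ⥤ GrpCat.{u}} {X : GSpace G} (φ ψ : X.End) :
    quotientStackMap (φ.comp ψ) = BasedFunctor.comp (quotientStackMap φ) (quotientStackMap ψ) := rfl

end QuotientStacks

/-! ### Equivariant equivalences of categories over a base -/

section Equivariance

universe v₁ v₂ w₁ w₂

variable {S : Type w₁} [Category.{v₁} S] {Γ : Type} [Group Γ]

/-- A strict right action of the group `Γ` on a category over `S`. -/
structure RightAction (Γ : Type) [Group Γ] (𝒳 : BasedCategory.{v₂, w₂} S) where
  /-- the self-functor attached to a group element -/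
  act : Γ → BasedFunctor 𝒳 𝒳
  act_one : act 1 = BasedFunctor.id 𝒳
  act_mul : ∀ g h, act (g * h) = BasedFunctor.comp (act g) (act h)

/-- A `Γ`-equivariant equivalence of categories over `S`: a functor over `S` which is an equivalence
of categories, with coherent natural isomorphisms over `S` that commute it past the actions. -/
structure EquivariantEquivalence {𝒳 𝒴 : BasedCategory.{v₂, w₂} S}
    (a : RightAction Γ 𝒳) (b : RightAction Γ 𝒴) where
  /-- the functor over `S` -/
  functor : BasedFunctor 𝒳 𝒴
  isEquivalence : functor.toFunctor.IsEquivalence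
  /-- it commutes with the actions up to isomorphisms over `S` -/
  comm : ∀ g : Γ, BasedFunctor.comp (a.act g) functor ≅ BasedFunctor.comp functor (b.act g)
  /-- these isomorphisms are compatible with the multiplication of `Γ` -/
  comm_mul : ∀ (g h : Γ) (X : 𝒳.obj),
    (comm (g * h)).hom.toNatTrans.app X =
      functor.map (eqToHom (by rw [a.act_mul]; rfl) :
          (a.act (g * h)).obj X ⟶ (a.act h).obj ((a.act g).obj X)) ≫
        (comm h).hom.toNatTrans.app ((a.act g).obj X) ≫
        (b.act h).map ((comm g).hom.toNatTrans.app X) ≫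
        (eqToHom (by rw [b.act_mul]; rfl) :
          (b.act h).obj ((b.act g).obj (functor.obj X)) ⟶ (b.act (g * h)).obj (functor.obj X))

end Equivariance

/-! ### Configurations of points on the affine line modulo affine transformations -/

section Configurations

variable (R : Type u) [CommRing R] (n : ℕ)

/-- The multiplicative group `C ↦ Cˣ`. -/
def Gm : CommAlgCat.{u} R ⥤ GrpCat.{u} where
  obj C := GrpCat.of Cˣ
  map f := GrpCat.ofHom (Units.map (f.hom : _ →* _))
  map_id _ := rfl
  map_comp _ _ := rfl

/-- `Cˣ` acts on the additive group of `C` by multiplication. -/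
def scaling (C : Type u) [CommRing C] : Cˣ →* MulAut (Multiplicative C) where
  toFun a := AddEquiv.toMultiplicative (DistribMulAction.toAddEquiv C a)
  map_one' := MulEquiv.ext fun x => congrArg Multiplicative.ofAdd (one_smul Cˣ x.toAdd)
  map_mul' a b := MulEquiv.ext fun x => congrArg Multiplicative.ofAdd (mul_smul a b x.toAdd)

/-- The group `𝔾ₐ ⋊ 𝔾ₘ` of affine transformations of the line, on `C`-points. -/
abbrev AffPts (C : Type u) [CommRing C] : Type u := Multiplicative C ⋊[scaling C] Cˣ

/-- `(b, a)` acts on the line by `t ↦ a t + b`. -/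
instance affAction (C : Type u) [CommRing C] : MulAction (AffPts C) C where
  smul g t := (g.right : C) * t + g.left.toAdd
  one_smul t := by
    change ((1 : Cˣ) : C) * t + (0 : C) = t
    simp
  mul_smul g h t := by
    change ((g.right * h.right : Cˣ) : C) * t + (g.left.toAdd + (g.right : C) * h.left.toAdd) =
      (g.right : C) * ((h.right : C) * t + h.left.toAdd) + g.left.toAdd
    push_cast
    ring

theorem affAction_def {C : Type u} [CommRing C] (g : AffPts C) (t : C) :
    g • t = (g.right : C) * t + g.left.toAdd := rfl

/-- The map on affine transformations induced by a map of rings. -/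
def affMap {C D : Type u} [CommRing C] [CommRing D] (f : C →+* D) : AffPts C →* AffPts D :=
  SemidirectProduct.map (AddMonoidHom.toMultiplicative (f : C →+ D)) (Units.map (f : C →* D))
    (fun a => MonoidHom.ext fun x =>
      congrArg Multiplicative.ofAdd (map_mul f (a : C) (Multiplicative.toAdd x)))

/-- The group `𝔾ₐ ⋊ 𝔾ₘ`. -/
def Aff : CommAlgCat.{u} R ⥤ GrpCat.{u} where
  obj C := GrpCat.of (AffPts C)
  map f := GrpCat.ofHom (affMap f.hom.toRingHom)
  map_id _ := rfl
  map_comp _ _ := rfl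

/-- `C`-points of `Conf(𝔸¹, n)`: `n` sections of the affine line over `C` that are nowhere equal,
that is, whose differences are invertible. -/
abbrev ConfPts (C : Type u) [CommRing C] : Type u :=
  {x : Fin n → C // ∀ i j, i ≠ j → IsUnit (x i - x j)}

/-- An affine transformation moves all points of a configuration. -/
instance confAction (C : Type u) [CommRing C] : MulAction (AffPts C) (ConfPts n C) where
  smul g x := ⟨fun i => g • x.1 i, fun i j h => by
    have := (g.right.isUnit).mul (x.2 i j h)
    have e : g • x.1 i - g • x.1 j = (g.right : C) * (x.1 i - x.1 j) := by
      rw [affAction_def, affAction_def]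
      ring
    change IsUnit (g • x.1 i - g • x.1 j)
    rw [e]
    exact this⟩
  one_smul x := Subtype.ext (funext fun i => one_smul (AffPts C) (x.1 i))
  mul_smul g h x := Subtype.ext (funext fun i => mul_smul g h (x.1 i))

/-- `Conf(𝔸¹, n)` with its action of `𝔾ₐ ⋊ 𝔾ₘ`. -/
def confSpace : GSpace (Aff R) where
  pts C := ConfPts n C
  map f x := ⟨fun i => f (x.1 i), fun i j h => by
    rw [← map_sub]
    exact (x.2 i j h).map f.hom⟩
  map_id _ := rfl
  map_comp _ _ _ := rfl
  act C := confAction n C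
  map_smul {C D} f g x := Subtype.ext (funext fun i => by
    change f.hom ((g.right : C) * x.1 i + g.left.toAdd) =
      f.hom (g.right : C) * f.hom (x.1 i) + f.hom g.left.toAdd
    rw [map_add, map_mul])

/-- `σ` relabels a configuration: `(x₁, …, xₙ) ↦ (x_{σ(1)}, …, x_{σ(n)})`. -/
def confRelabel (σ : Equiv.Perm (Fin n)) : (confSpace R n).End where
  app C x := ⟨fun i => x.1 (σ i), fun i j h => x.2 _ _ (fun e => h (σ.injective e))⟩
  app_map _ _ := rfl
  app_smul _ _ _ := rfl

/-- The action of `Σₙ` on the stack `Conf(𝔸¹, n) // (𝔾ₐ ⋊ 𝔾ₘ)`. -/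
def confAct : RightAction (Equiv.Perm (Fin n)) (quotientStack (confSpace R n)) where
  act σ := quotientStackMap (confRelabel R n σ)
  act_one := rfl
  act_mul _ _ := rfl

/-! ### The ring `Sym(λ)[N⁻¹]` -/

/-- The standard representation `λ`: the vectors of coordinate sum zero in `Rⁿ`. -/
def stdRep : Submodule R (Fin n → R) where
  carrier := {a | ∑ i, a i = 0}
  zero_mem' := by simp
  add_mem' {a b} ha hb := by
    change ∑ i, a i = 0 at ha
    change ∑ i, b i = 0 at hb
    change ∑ i, (a i + b i) = 0
    simp [Finset.sum_add_distrib, ha, hb]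
  smul_mem' c a ha := by
    change ∑ i, a i = 0 at ha
    change ∑ i, c * a i = 0
    simp [← Finset.mul_sum, ha]

/-- The action of `Σₙ` on `λ` by permutation of the basis vectors of `Rⁿ`, `e_i ↦ e_{σ(i)}`. -/
def stdPerm (σ : Equiv.Perm (Fin n)) : stdRep R n →ₗ[R] stdRep R n where
  toFun a := ⟨fun i => a.1 (σ⁻¹ i), by
    change ∑ i, a.1 (σ⁻¹ i) = 0
    rw [Equiv.sum_comp σ⁻¹ a.1]
    exact a.2⟩
  map_add' _ _ := rfl
  map_smul' _ _ := rfl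

theorem stdPerm_one : stdPerm R n 1 = LinearMap.id := rfl

theorem stdPerm_mul (σ τ : Equiv.Perm (Fin n)) :
    stdPerm R n (σ * τ) = (stdPerm R n σ).comp (stdPerm R n τ) := by
  ext a i
  change a.1 ((σ * τ)⁻¹ i) = a.1 (τ⁻¹ (σ⁻¹ i))
  rw [mul_inv_rev, Equiv.Perm.mul_apply]

/-- The vector `e_i - e_j` of `λ`. -/
def diff (i j : Fin n) : stdRep R n :=
  ⟨Pi.single i 1 - Pi.single j 1, by
    change ∑ l, ((Pi.single i (1 : R) - Pi.single j 1 : Fin n → R) l) = 0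
    simp [Finset.sum_sub_distrib]⟩

theorem stdPerm_diff (σ : Equiv.Perm (Fin n)) (i j : Fin n) :
    stdPerm R n σ (diff R n i j) = diff R n (σ i) (σ j) := by
  apply Subtype.ext
  funext l
  change (Pi.single i (1 : R) - Pi.single j 1 : Fin n → R) (σ⁻¹ l) =
    (Pi.single (σ i) (1 : R) - Pi.single (σ j) 1 : Fin n → R) l
  simp [Pi.single_apply, Equiv.symm_apply_eq]

/-- The vector `y_i = e_i - e_{i+1}` of `λ`, with cyclic indices. -/
def y (i : Fin n) : stdRep R n := diff R n i (finRotate n i)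

/-- The symmetric algebra of `λ`. -/
def Sym : Type u := SymmetricAlgebra R (stdRep R n)

instance : CommRing (Sym R n) := inferInstanceAs (CommRing (SymmetricAlgebra R (stdRep R n)))

instance : Algebra R (Sym R n) := inferInstanceAs (Algebra R (SymmetricAlgebra R (stdRep R n)))

/-- The inclusion of `λ` into `Sym(λ)`. -/
def symι : stdRep R n →ₗ[R] Sym R n := SymmetricAlgebra.ι R (stdRep R n)

/-- `N`, the product of all `Σₙ`-translates `e_i - e_j`, `i ≠ j`, of `y_0 = e_0 - e_1`. -/
def N : Sym R n :=
  ∏ q ∈ (Finset.univ : Finset (Fin n × Fin n)) with q.1 ≠ q.2, symι R n (diff R n q.1 q.2)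

/-- The product `∏ σⁱ(y_0)` of the translates of `y_0` under the cyclic group generated by the
rotation `σ`. -/
def cyclicN : Sym R n := ∏ i, symι R n (y R n i)

/-- `Sym(λ)[f⁻¹]`. -/
def SymAway (f : Sym R n) : Type u := Localization.Away f

instance (f : Sym R n) : CommRing (SymAway R n f) :=
  inferInstanceAs (CommRing (Localization.Away f))

instance (f : Sym R n) : Algebra (Sym R n) (SymAway R n f) :=
  inferInstanceAs (Algebra (Sym R n) (Localization.Away f))

instance (f : Sym R n) : Algebra R (SymAway R n f) :=
  inferInstanceAs (Algebra R (Localization.Away f))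

instance (f : Sym R n) : IsScalarTower R (Sym R n) (SymAway R n f) :=
  inferInstanceAs (IsScalarTower R (Sym R n) (Localization.Away f))

instance (f : Sym R n) : IsLocalization.Away f (SymAway R n f) :=
  inferInstanceAs (IsLocalization.Away f (Localization.Away f))

/-- `Sym(λ)[N⁻¹]`. -/
abbrev ConfRing : Type u := SymAway R n (N R n)

/-- The map from `λ` to `Sym(λ)[f⁻¹]`. -/
def gen (f : Sym R n) : stdRep R n →ₗ[R] SymAway R n f :=
  (IsScalarTower.toAlgHom R (Sym R n) (SymAway R n f)).toLinearMap ∘ₗ symι R n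

variable {R n}

/-- The algebra map out of `Sym(λ)` that extends a given linear map. -/
def symLift {C : Type*} [CommRing C] [Algebra R C] (l : stdRep R n →ₗ[R] C) : Sym R n →ₐ[R] C :=
  SymmetricAlgebra.lift l

@[simp]
theorem symLift_ι {C : Type*} [CommRing C] [Algebra R C] (l : stdRep R n →ₗ[R] C)
    (a : stdRep R n) : symLift l (symι R n a) = l a :=
  SymmetricAlgebra.lift_ι_apply l a

theorem sym_ext {C : Type*} [CommRing C] [Algebra R C] {q q' : Sym R n →ₐ[R] C}
    (h : ∀ a, q (symι R n a) = q' (symι R n a)) : q = q' :=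
  SymmetricAlgebra.algHom_ext (LinearMap.ext h)

theorem symAway_ext {f : Sym R n} {C : Type*} [CommRing C] [Algebra R C]
    {q q' : SymAway R n f →ₐ[R] C} (h : ∀ a, q (gen R n f a) = q' (gen R n f a)) : q = q' :=
  IsLocalization.algHom_ext (Submonoid.powers f)
    (sym_ext (q := q.comp (IsScalarTower.toAlgHom R (Sym R n) (SymAway R n f)))
      (q' := q'.comp (IsScalarTower.toAlgHom R (Sym R n) (SymAway R n f))) h)

/-- A linear form on `λ` with invertible values at all `e_i - e_j` extends to `Sym(λ)[N⁻¹]`. -/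
def confRingLift {C : Type*} [CommRing C] [Algebra R C] (l : stdRep R n →ₗ[R] C)
    (hl : ∀ i j, i ≠ j → IsUnit (l (diff R n i j))) : ConfRing R n →ₐ[R] C :=
  IsLocalization.liftAlgHom (M := Submonoid.powers (N R n)) (f := symLift l) (by
    have h : IsUnit (symLift l (N R n)) := by
      rw [N, map_prod, IsUnit.prod_iff]
      intro q hq
      rw [symLift_ι]
      exact hl _ _ (Finset.mem_filter.1 hq).2
    rintro ⟨_, k, rfl⟩
    simpa using h.pow k)

@[simp]
theorem confRingLift_gen {C : Type*} [CommRing C] [Algebra R C] (l : stdRep R n →ₗ[R] C)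
    (hl : ∀ i j, i ≠ j → IsUnit (l (diff R n i j))) (a : stdRep R n) :
    confRingLift l hl (gen R n (N R n) a) = l a :=
  (IsLocalization.lift_eq _ _).trans (symLift_ι l a)

theorem isUnit_gen_diff (i j : Fin n) (h : i ≠ j) :
    IsUnit (gen R n (N R n) (diff R n i j)) := by
  have hN : IsUnit (algebraMap (Sym R n) (ConfRing R n) (N R n)) :=
    IsLocalization.Away.algebraMap_isUnit _
  have e : algebraMap (Sym R n) (ConfRing R n) (N R n) =
      ∏ q ∈ (Finset.univ : Finset (Fin n × Fin n)) with q.1 ≠ q.2,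
        algebraMap (Sym R n) (ConfRing R n) (symι R n (diff R n q.1 q.2)) :=
    map_prod _ _ _
  rw [e, IsUnit.prod_iff] at hN
  exact hN (i, j) (by simp [h])

variable (R n)

/-- The action of `Σₙ` on `Sym(λ)[N⁻¹]`. -/
def confRingPerm (σ : Equiv.Perm (Fin n)) : ConfRing R n →ₐ[R] ConfRing R n :=
  confRingLift (gen R n (N R n) ∘ₗ stdPerm R n σ) (fun i j h => by
    rw [LinearMap.comp_apply, stdPerm_diff]
    exact isUnit_gen_diff _ _ (fun e => h (σ.injective e)))

@[simp]
theorem confRingPerm_gen (σ : Equiv.Perm (Fin n)) (a : stdRep R n) :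
    confRingPerm R n σ (gen R n (N R n) a) = gen R n (N R n) (stdPerm R n σ a) := by
  simp [confRingPerm]

theorem confRingPerm_one : confRingPerm R n 1 = AlgHom.id R _ :=
  symAway_ext fun a => by simp [stdPerm_one]

theorem confRingPerm_mul (σ τ : Equiv.Perm (Fin n)) :
    confRingPerm R n (σ * τ) = (confRingPerm R n σ).comp (confRingPerm R n τ) :=
  symAway_ext fun a => by simp [stdPerm_mul]

variable {R n} in
/-- The action of `𝔾ₘ` on the points of `Spec Sym(λ)[N⁻¹]`: the elements of `λ` are multiplied
by `μ`. -/
def confRingScale {C : Type u} [CommRing C] [Algebra R C] (μ : Cˣ) (q : ConfRing R n →ₐ[R] C) :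
    ConfRing R n →ₐ[R] C :=
  confRingLift ((μ : C) • (q.toLinearMap ∘ₗ gen R n (N R n))) (fun i j h => by
    simpa using μ.isUnit.mul ((isUnit_gen_diff i j h).map q))

variable {R n} in
@[simp]
theorem confRingScale_gen {C : Type u} [CommRing C] [Algebra R C] (μ : Cˣ)
    (q : ConfRing R n →ₐ[R] C) (a : stdRep R n) :
    confRingScale μ q (gen R n (N R n) a) = μ * q (gen R n (N R n) a) := by
  simp [confRingScale]

variable {R n} in
theorem confRingScale_one {C : Type u} [CommRing C] [Algebra R C] (q : ConfRing R n →ₐ[R] C) :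
    confRingScale (1 : Cˣ) q = q :=
  symAway_ext fun a => by simp

variable {R n} in
theorem confRingScale_mul {C : Type u} [CommRing C] [Algebra R C] (μ ν : Cˣ)
    (q : ConfRing R n →ₐ[R] C) : confRingScale (μ * ν) q = confRingScale μ (confRingScale ν q) :=
  symAway_ext fun a => by simp [mul_assoc]

variable {R n} in
theorem confRingScale_map {C D : Type u} [CommRing C] [Algebra R C] [CommRing D] [Algebra R D]
    (f : C →ₐ[R] D) (μ : Cˣ) (q : ConfRing R n →ₐ[R] C) :
    f.comp (confRingScale μ q) = confRingScale (Units.map (f : C →* D) μ) (f.comp q) :=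
  symAway_ext fun a => by simp

variable {R n} in
theorem confRingScale_perm {C : Type u} [CommRing C] [Algebra R C] (σ : Equiv.Perm (Fin n))
    (μ : Cˣ) (q : ConfRing R n →ₐ[R] C) :
    (confRingScale μ q).comp (confRingPerm R n σ) =
      confRingScale μ (q.comp (confRingPerm R n σ)) :=
  symAway_ext fun a => by simp

variable {R n} in
/-- `𝔾ₘ` acts on the points of `Spec Sym(λ)[N⁻¹]`. -/
abbrev confRingScaleAction (C : Type u) [CommRing C] [Algebra R C] :
    MulAction Cˣ (ConfRing R n →ₐ[R] C) where
  smul μ q := confRingScale μ q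
  one_smul q := confRingScale_one q
  mul_smul μ ν q := confRingScale_mul μ ν q

/-- `Spec Sym(λ)[N⁻¹]` with its action of `𝔾ₘ`. -/
def confRingSpace : GSpace (Gm R) where
  pts C := ConfRing R n →ₐ[R] C
  map f q := f.hom.comp q
  map_id _ := rfl
  map_comp _ _ _ := rfl
  act C := confRingScaleAction C
  map_smul f μ q := confRingScale_map f.hom μ q

/-- `Σₙ` acts on `Spec Sym(λ)[N⁻¹]` through its action on the ring. -/
def confRingRelabel (σ : Equiv.Perm (Fin n)) : (confRingSpace R n).End where
  app C q := AlgHom.comp q (confRingPerm R n σ)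
  app_map _ _ := rfl
  app_smul _ μ q := confRingScale_perm σ μ q

theorem confRingRelabel_one : confRingRelabel R n 1 = GSpace.End.one _ :=
  GSpace.End.ext' fun _ (q : ConfRing R n →ₐ[R] _) =>
    (congrArg q.comp (confRingPerm_one R n)).trans q.comp_id

theorem confRingRelabel_mul (σ τ : Equiv.Perm (Fin n)) :
    confRingRelabel R n (σ * τ) = (confRingRelabel R n σ).comp (confRingRelabel R n τ) :=
  GSpace.End.ext' fun _ (q : ConfRing R n →ₐ[R] _) =>
    (congrArg q.comp (confRingPerm_mul R n σ τ)).trans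
      (AlgHom.comp_assoc q (confRingPerm R n σ) (confRingPerm R n τ)).symm

/-- The action of `Σₙ` on the stack `Spec Sym(λ)[N⁻¹] // 𝔾ₘ`. -/
def confRingAct : RightAction (Equiv.Perm (Fin n)) (quotientStack (confRingSpace R n)) where
  act σ := quotientStackMap (confRingRelabel R n σ)
  act_one := (congrArg quotientStackMap (confRingRelabel_one R n)).trans (quotientStackMap_one _)
  act_mul σ τ := (congrArg quotientStackMap (confRingRelabel_mul R n σ τ)).trans
    (quotientStackMap_comp _ _)

/-- The part of degree `d` of `Sym(λ)[N⁻¹]`, where the elements of `λ` have degree `-2`: it is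
spanned by the fractions `a / Nᵏ` with `a` in the `r`-th symmetric power of `λ` and
`d = -2 r - k |N|`, `|N| = -2 n (n - 1)`. -/
def degreePart (d : ℤ) : Submodule R (ConfRing R n) :=
  Submodule.span R {s | ∃ (r k : ℕ) (a : Sym R n),
    a ∈ (LinearMap.range (symι R n)) ^ r ∧
    s * algebraMap (Sym R n) (ConfRing R n) (N R n) ^ k = algebraMap (Sym R n) (ConfRing R n) a ∧
    d = -2 * (r : ℤ) + 2 * (k : ℤ) * ((n : ℤ) * ((n : ℤ) - 1))}

end Configurations

/-! ### Deformations -/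

section Deformations

variable (p : ℕ) [Fact p.Prime] (k : Type u) [Field k]

/-- The residue field `k` as an algebra over `W(k)`. -/
def residueField : CommAlgCat.{u} (WittVector p k) :=
  letI : Algebra (WittVector p k) k := (WittVector.constantCoeff (p := p) (R := k)).toAlgebra
  CommAlgCat.of (WittVector p k) k

/-- The reduced configuration `𝔽_p = {0, 1, …, p - 1}` in the line over `k`. -/
def primePoints (i : Fin p) : residueField p k := ((i : ℕ) : k)

/-- A complete local `W(k)`-algebra with finitely generated maximal ideal and a specified map to the
residue field `k`. -/
structure CompleteLocal where
  /-- the ring -/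
  ring : CommAlgCat.{u} (WittVector p k)
  [isLocal : IsLocalRing ring]
  fg : (IsLocalRing.maximalIdeal ring).FG
  complete : IsAdicComplete (IsLocalRing.maximalIdeal ring) ring
  /-- the map to the residue field -/
  res : ring ⟶ residueField p k

attribute [instance] CompleteLocal.isLocal

variable {p k}

/-- Maps of complete local algebras are compatible with the maps to the residue field
(so that they are local). -/
structure CompleteLocal.Hom (A B : CompleteLocal p k) where
  /-- the map of algebras -/
  hom : A.ring ⟶ B.ring
  comp_res : hom ≫ B.res = A.res

@[ext]
theorem CompleteLocal.Hom.ext' {A B : CompleteLocal p k} {f g : CompleteLocal.Hom A B}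
    (h : f.hom = g.hom) : f = g := by
  cases f; cases g; cases h; rfl

instance CompleteLocal.category : Category.{u} (CompleteLocal p k) where
  Hom := CompleteLocal.Hom
  id A := ⟨𝟙 _, Category.id_comp _⟩
  comp f g := ⟨f.hom ≫ g.hom, by rw [Category.assoc, g.comp_res, f.comp_res]⟩
  id_comp f := CompleteLocal.Hom.ext' (Category.id_comp _)
  comp_id f := CompleteLocal.Hom.ext' (Category.comp_id _)
  assoc f g h := CompleteLocal.Hom.ext' (Category.assoc _ _ _)

/-- For a subgroup `Γ` of `Σ_p`, the completion of the stack `Conf(𝔸¹, p) // (𝔾ₐ ⋊ 𝔾ₘ)` at the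
`Γ`-translates of the configuration `𝔽_p`: the objects of the stack over `Spec A` whose
restriction to `Spec k` is isomorphic to a configuration `(γ(0), …, γ(p - 1))` with `γ ∈ Γ`.
An isomorphism of a configuration with the restriction of an object to `Spec k` is the same as a
`k`-point of the restricted torsor that is sent to this configuration.

For the trivial group this is the deformation problem `Def_(𝔸¹; p)`. -/
structure Deformation (Γ : Subgroup (Equiv.Perm (Fin p))) where
  /-- the base of the deformation is `Spec base` -/
  base : CompleteLocal p k
  /-- the object of the stack -/
  fiber : QuotientStack.Fiber (confSpace (WittVector p k) p) base.ring
  reduces : ∃ e : fiber.E ⟶ residueField p k, fiber.proj ≫ e = base.res ∧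
    ∃ γ ∈ Γ, ∀ i, (fiber.toX e).1 i = primePoints p k (γ i)

/-- Morphisms of deformations are the morphisms of the stack. -/
structure Deformation.Hom {Γ : Subgroup (Equiv.Perm (Fin p))}
    (P P' : Deformation (k := k) Γ) where
  /-- the map of the bases -/
  base : P.base ⟶ P'.base
  /-- the map of the torsors -/
  fiber : QuotientStack.FiberHom (CompleteLocal.Hom.hom base) P.fiber P'.fiber

theorem Deformation.Hom.ext' {Γ : Subgroup (Equiv.Perm (Fin p))}
    {P P' : Deformation (k := k) Γ} {a b : Deformation.Hom P P'} (h : a.base = b.base)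
    (h' : a.fiber.hom = b.fiber.hom) : a = b := by
  obtain ⟨f, ⟨x, _, _, _⟩⟩ := a
  obtain ⟨g, ⟨y, _, _, _⟩⟩ := b
  cases h; cases h'; rfl

instance Deformation.category (Γ : Subgroup (Equiv.Perm (Fin p))) :
    Category.{u} (Deformation (k := k) Γ) where
  Hom := Deformation.Hom
  id P := ⟨𝟙 _, QuotientStack.FiberHom.id _⟩
  comp a b := ⟨a.base ≫ b.base, a.fiber.comp b.fiber⟩
  id_comp a := Hom.ext' (Category.id_comp _) (Category.id_comp _)
  comp_id a := Hom.ext' (Category.comp_id _) (Category.comp_id _)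
  assoc a b c := Hom.ext' (Category.assoc _ _ _) (Category.assoc _ _ _)

variable (k)

/-- The deformations, as a category over the complete local algebras. -/
def deformations (Γ : Subgroup (Equiv.Perm (Fin p))) :
    BasedCategory.{u, u + 1} (CompleteLocal p k) where
  obj := Deformation (k := k) Γ
  p :=
    { obj := fun P => P.base
      map := fun a => Deformation.Hom.base a }

variable {k} in
/-- Relabelling of a deformation. -/
def Deformation.relabel {Γ : Subgroup (Equiv.Perm (Fin p))} (σ : Γ) (P : Deformation (k := k) Γ) :
    Deformation (k := k) Γ where
  base := P.base
  fiber := P.fiber.push (confRelabel _ _ σ.1)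
  reduces := by
    obtain ⟨e, he, γ, hγ, h⟩ := P.reduces
    exact ⟨e, he, γ * σ.1, Γ.mul_mem hγ σ.2, fun i => h (σ.1 i)⟩

/-- The action of `Γ` on the deformations by relabelling. -/
def deformationsAct (Γ : Subgroup (Equiv.Perm (Fin p))) : RightAction Γ (deformations k Γ) where
  act σ :=
    { obj := fun (P : Deformation (k := k) Γ) => (P.relabel σ : Deformation (k := k) Γ)
      map := fun {P P' : Deformation (k := k) Γ} (a : Deformation.Hom P P') =>
        (⟨a.base, a.fiber.push _⟩ : Deformation.Hom (P.relabel σ) (P'.relabel σ))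
      map_id := fun _ => rfl
      map_comp := fun _ _ => rfl
      w := rfl }
  act_one := rfl
  act_mul _ _ := rfl

/-! ### The completed ring -/

/-- The ideal `I = (p, y_i - y_j)` of `Sym(λ)[f⁻¹]`; note that `y_{i+j} = σʲ(y_i)` for the
rotation `σ`. -/
def primeIdeal (f : Sym (WittVector p k) p) : Ideal (SymAway (WittVector p k) p f) :=
  Ideal.span ({(p : SymAway (WittVector p k) p f)} ∪
    {s | ∃ i j : Fin p, s = gen (WittVector p k) p f (y (WittVector p k) p i) -
      gen (WittVector p k) p f (y (WittVector p k) p j)})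

/-- The intersection of the `Γ`-translates of the ideal `I` of `Sym(λ)[N⁻¹]`. -/
def translatesIdeal (Γ : Subgroup (Equiv.Perm (Fin p))) : Ideal (ConfRing (WittVector p k) p) :=
  ⨅ γ : Γ, (primeIdeal k (N (WittVector p k) p)).comap (confRingPerm (WittVector p k) p γ.1)

theorem translatesIdeal_le_comap (Γ : Subgroup (Equiv.Perm (Fin p))) (σ : Γ) :
    translatesIdeal k Γ ≤ (translatesIdeal k Γ).comap (confRingPerm (WittVector p k) p σ.1) := by
  intro s hs
  rw [Ideal.mem_comap, translatesIdeal, Ideal.mem_iInf]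
  intro γ
  rw [translatesIdeal, Ideal.mem_iInf] at hs
  have h := hs (γ * σ)
  rw [Ideal.mem_comap, Subgroup.coe_mul, confRingPerm_mul] at h
  exact h

/-- The completed ring: the completion of `Sym(λ)[N⁻¹]` at the intersection of the `Γ`-translates of
the ideal `I`. -/
abbrev CompletedRing (Γ : Subgroup (Equiv.Perm (Fin p))) : Type u :=
  AdicCompletion (translatesIdeal k Γ) (ConfRing (WittVector p k) p)

/-- The map from `λ` to the completed ring. -/
def completedGen (Γ : Subgroup (Equiv.Perm (Fin p))) (a : stdRep (WittVector p k) p) :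
    CompletedRing k Γ :=
  AdicCompletion.of _ _ (gen (WittVector p k) p (N (WittVector p k) p) a)

theorem factor_evalₐ (Γ : Subgroup (Equiv.Perm (Fin p))) {m r : ℕ} (hle : m ≤ r)
    (z : CompletedRing k Γ) :
    Ideal.Quotient.factor (Ideal.pow_le_pow_right hle)
        (AdicCompletion.evalₐ (translatesIdeal k Γ) r z) =
      AdicCompletion.evalₐ (translatesIdeal k Γ) m z := by
  obtain ⟨s, rfl⟩ := AdicCompletion.mk_surjective (translatesIdeal k Γ) _ z
  rw [AdicCompletion.evalₐ_mk, AdicCompletion.evalₐ_mk, Ideal.Quotient.factor_mk]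
  exact AdicCompletion.Ideal.mk_eq_mk (I := translatesIdeal k Γ) hle s

/-- The action of an element of `Γ` modulo the `r`-th power of the ideal. -/
def truncatedPerm {Γ : Subgroup (Equiv.Perm (Fin p))} (σ : Γ) (r : ℕ) :
    (ConfRing (WittVector p k) p ⧸ translatesIdeal k Γ ^ r) →ₐ[WittVector p k]
      (ConfRing (WittVector p k) p ⧸ translatesIdeal k Γ ^ r) :=
  Ideal.quotientMapₐ (translatesIdeal k Γ ^ r) (confRingPerm (WittVector p k) p σ.1)
    ((Ideal.pow_right_mono (translatesIdeal_le_comap k Γ σ) r).trans (Ideal.le_comap_pow _ r))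

theorem truncatedPerm_mk {Γ : Subgroup (Equiv.Perm (Fin p))} (σ : Γ) (r : ℕ)
    (s : ConfRing (WittVector p k) p) :
    truncatedPerm k σ r (Ideal.Quotient.mk _ s) =
      Ideal.Quotient.mk _ (confRingPerm (WittVector p k) p σ.1 s) := rfl

theorem factor_truncatedPerm {Γ : Subgroup (Equiv.Perm (Fin p))} (σ : Γ) {m r : ℕ} (hle : m ≤ r) :
    (Ideal.Quotient.factorₐ (WittVector p k) (Ideal.pow_le_pow_right hle)).comp
        ((truncatedPerm k σ r).comp
          ((AdicCompletion.evalₐ (translatesIdeal k Γ) r).restrictScalars (WittVector p k))) =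
      (truncatedPerm k σ m).comp
        ((AdicCompletion.evalₐ (translatesIdeal k Γ) m).restrictScalars (WittVector p k)) := by
  refine AlgHom.ext fun z => ?_
  change Ideal.Quotient.factor (Ideal.pow_le_pow_right hle)
      (truncatedPerm k σ r (AdicCompletion.evalₐ (translatesIdeal k Γ) r z)) =
    truncatedPerm k σ m (AdicCompletion.evalₐ (translatesIdeal k Γ) m z)
  rw [← factor_evalₐ k Γ hle z]
  obtain ⟨s, hs⟩ := Ideal.Quotient.mk_surjective
    (AdicCompletion.evalₐ (translatesIdeal k Γ) r z)
  rw [← hs, truncatedPerm_mk, Ideal.Quotient.factor_mk, Ideal.Quotient.factor_mk,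
    truncatedPerm_mk]

/-- The action of `Γ` on the completed ring. -/
def completedPerm {Γ : Subgroup (Equiv.Perm (Fin p))} (σ : Γ) :
    CompletedRing k Γ →ₐ[WittVector p k] CompletedRing k Γ :=
  AdicCompletion.liftAlgHom _
    (fun r => (truncatedPerm k σ r).comp
      ((AdicCompletion.evalₐ (translatesIdeal k Γ) r).restrictScalars (WittVector p k)))
    (fun hle => factor_truncatedPerm k σ hle)

theorem evalₐ_completedPerm {Γ : Subgroup (Equiv.Perm (Fin p))} (σ : Γ) (r : ℕ)
    (z : CompletedRing k Γ) :
    AdicCompletion.evalₐ (translatesIdeal k Γ) r (completedPerm k σ z) =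
      truncatedPerm k σ r (AdicCompletion.evalₐ (translatesIdeal k Γ) r z) :=
  AdicCompletion.evalₐ_liftAlgHom _ _ (fun hle => factor_truncatedPerm k σ hle) _ _

theorem completedPerm_gen {Γ : Subgroup (Equiv.Perm (Fin p))} (σ : Γ)
    (a : stdRep (WittVector p k) p) :
    completedPerm k σ (completedGen k Γ a) = completedGen k Γ (stdPerm _ _ σ.1 a) := by
  refine AdicCompletion.ext_evalₐ fun r => ?_
  rw [evalₐ_completedPerm, completedGen, completedGen, AdicCompletion.evalₐ_of,
    AdicCompletion.evalₐ_of, truncatedPerm_mk, confRingPerm_gen]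

theorem completedPerm_one (Γ : Subgroup (Equiv.Perm (Fin p))) :
    completedPerm k (1 : Γ) = AlgHom.id _ _ := by
  refine AlgHom.ext fun z => AdicCompletion.ext_evalₐ fun r => ?_
  rw [evalₐ_completedPerm]
  obtain ⟨s, hs⟩ := Ideal.Quotient.mk_surjective (AdicCompletion.evalₐ (translatesIdeal k Γ) r z)
  rw [← hs, truncatedPerm_mk, Subgroup.coe_one, confRingPerm_one]
  exact hs

theorem completedPerm_mul {Γ : Subgroup (Equiv.Perm (Fin p))} (σ τ : Γ) :
    completedPerm k (σ * τ) = (completedPerm k σ).comp (completedPerm k τ) := by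
  refine AlgHom.ext fun z => AdicCompletion.ext_evalₐ fun r => ?_
  rw [AlgHom.comp_apply, evalₐ_completedPerm, evalₐ_completedPerm, evalₐ_completedPerm]
  obtain ⟨s, hs⟩ := Ideal.Quotient.mk_surjective (AdicCompletion.evalₐ (translatesIdeal k Γ) r z)
  rw [← hs, truncatedPerm_mk, truncatedPerm_mk, truncatedPerm_mk, Subgroup.coe_mul,
    confRingPerm_mul, AlgHom.comp_apply]

/-! ### The formal quotient of the completed ring by `𝔾ₘ` -/

/-- An object of the quotient of the formal spectrum of the completed ring by `𝔾ₘ`, over a complete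
local algebra `A`: a continuous homomorphism from the completed ring to `A`
(every `𝔾ₘ`-torsor over a local ring is trivial). -/
structure RepObj (Γ : Subgroup (Equiv.Perm (Fin p))) where
  /-- the complete local algebra -/
  base : CompleteLocal p k
  /-- the homomorphism -/
  f : CompletedRing k Γ →ₐ[WittVector p k] base.ring
  continuous : ∀ m : ℕ, ∃ r : ℕ, ∀ z, AdicCompletion.evalₐ (translatesIdeal k Γ) r z = 0 →
    f z ∈ IsLocalRing.maximalIdeal base.ring ^ m

variable {k}

/-- A morphism of the quotient by `𝔾ₘ`: a map `h` of the complete local algebras and a unit `μ` that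
carries `h ∘ f` to `f'`, where `μ` multiplies the elements of `λ` by `μ` (a continuous
homomorphism is determined by its values on `λ`). -/
structure RepObj.Hom {Γ : Subgroup (Equiv.Perm (Fin p))} (P P' : RepObj k Γ) where
  /-- the map of the complete local algebras -/
  base : P.base ⟶ P'.base
  /-- the element of `𝔾ₘ` -/
  μ : (P'.base.ring)ˣ
  scale : ∀ a, P'.f (completedGen k Γ a) =
    (μ : P'.base.ring) * (CompleteLocal.Hom.hom base).hom (P.f (completedGen k Γ a))

theorem RepObj.Hom.ext' {Γ : Subgroup (Equiv.Perm (Fin p))} {P P' : RepObj k Γ}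
    {a b : RepObj.Hom P P'} (h : a.base = b.base) (h' : a.μ = b.μ) : a = b := by
  cases a; cases b; cases h; cases h'; rfl

/-- The identity. -/
def RepObj.Hom.id {Γ : Subgroup (Equiv.Perm (Fin p))} (P : RepObj k Γ) : RepObj.Hom P P where
  base := 𝟙 _
  μ := 1
  scale _ := by
    rw [Units.val_one, one_mul]
    rfl

/-- Composition. -/
def RepObj.Hom.comp {Γ : Subgroup (Equiv.Perm (Fin p))} {P P' P'' : RepObj k Γ}
    (a : RepObj.Hom P P') (b : RepObj.Hom P' P'') : RepObj.Hom P P'' where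
  base := a.base ≫ b.base
  μ := b.μ * Units.map (CompleteLocal.Hom.hom b.base).hom.toRingHom.toMonoidHom a.μ
  scale v := by
    rw [b.scale, a.scale, map_mul, Units.val_mul, mul_assoc]
    rfl

instance RepObj.category (Γ : Subgroup (Equiv.Perm (Fin p))) : Category.{u} (RepObj k Γ) where
  Hom := RepObj.Hom
  id P := RepObj.Hom.id P
  comp a b := a.comp b
  id_comp a := RepObj.Hom.ext' (Category.id_comp _) (by
    change a.μ * Units.map _ 1 = a.μ
    rw [map_one, mul_one])
  comp_id a := RepObj.Hom.ext' (Category.comp_id _) (by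
    change 1 * Units.map _ a.μ = a.μ
    rw [one_mul]
    exact Units.ext rfl)
  assoc a b c := RepObj.Hom.ext' (Category.assoc _ _ _) (by
    apply Units.ext
    change (c.μ : _) * (CompleteLocal.Hom.hom c.base).hom
        ((b.μ : _) * (CompleteLocal.Hom.hom b.base).hom (a.μ : _)) =
      ((c.μ : _) * (CompleteLocal.Hom.hom c.base).hom (b.μ : _)) *
        (CompleteLocal.Hom.hom c.base).hom ((CompleteLocal.Hom.hom b.base).hom (a.μ : _))
    rw [map_mul, mul_assoc])

variable (k)

/-- The quotient of the formal spectrum of the completed ring by `𝔾ₘ`, as a category over the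
complete local algebras. -/
def representable (Γ : Subgroup (Equiv.Perm (Fin p))) :
    BasedCategory.{u, u + 1} (CompleteLocal p k) where
  obj := RepObj k Γ
  p :=
    { obj := fun P => P.base
      map := fun a => RepObj.Hom.base a }

/-- A continuous endomorphism of the completed ring that preserves `λ`. -/
structure CompletedEnd (Γ : Subgroup (Equiv.Perm (Fin p))) where
  /-- the endomorphism of the ring -/
  hom : CompletedRing k Γ →ₐ[WittVector p k] CompletedRing k Γ
  /-- the endomorphism of `λ` -/
  lin : stdRep (WittVector p k) p → stdRep (WittVector p k) p
  hom_gen : ∀ a, hom (completedGen k Γ a) = completedGen k Γ (lin a)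
  continuous : ∀ r z, AdicCompletion.evalₐ (translatesIdeal k Γ) r z = 0 →
    AdicCompletion.evalₐ (translatesIdeal k Γ) r (hom z) = 0

variable {k}

/-- The identity. -/
def CompletedEnd.one (Γ : Subgroup (Equiv.Perm (Fin p))) : CompletedEnd k Γ where
  hom := AlgHom.id _ _
  lin a := a
  hom_gen _ := rfl
  continuous _ _ h := h

/-- Composition: first `ψ`, then `φ`. -/
def CompletedEnd.comp {Γ : Subgroup (Equiv.Perm (Fin p))} (φ ψ : CompletedEnd k Γ) :
    CompletedEnd k Γ where
  hom := φ.hom.comp ψ.hom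
  lin a := φ.lin (ψ.lin a)
  hom_gen a := by rw [AlgHom.comp_apply, ψ.hom_gen, φ.hom_gen]
  continuous r z h := φ.continuous r _ (ψ.continuous r z h)

theorem CompletedEnd.ext' {Γ : Subgroup (Equiv.Perm (Fin p))} {φ ψ : CompletedEnd k Γ}
    (h : φ.hom = ψ.hom) (h' : φ.lin = ψ.lin) : φ = ψ := by
  cases φ; cases ψ; cases h; cases h'; rfl

/-- Pullback of an object along an endomorphism of the completed ring. -/
def RepObj.pull {Γ : Subgroup (Equiv.Perm (Fin p))} (φ : CompletedEnd k Γ) (P : RepObj k Γ) :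
    RepObj k Γ where
  base := P.base
  f := P.f.comp φ.hom
  continuous m := by
    obtain ⟨r, hr⟩ := P.continuous m
    exact ⟨r, fun z hz => hr _ (φ.continuous r z hz)⟩

/-- Pullback of a morphism along an endomorphism of the completed ring. -/
def RepObj.Hom.pull {Γ : Subgroup (Equiv.Perm (Fin p))} (φ : CompletedEnd k Γ) {P P' : RepObj k Γ}
    (a : RepObj.Hom P P') : RepObj.Hom (P.pull φ) (P'.pull φ) where
  base := a.base
  μ := a.μ
  scale v := by
    change P'.f (φ.hom (completedGen k Γ v)) =
      (a.μ : P'.base.ring) *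
        (CompleteLocal.Hom.hom a.base).hom (P.f (φ.hom (completedGen k Γ v)))
    rw [φ.hom_gen]
    exact a.scale _

/-- Pullback along an endomorphism of the completed ring. -/
def repMap {Γ : Subgroup (Equiv.Perm (Fin p))} (φ : CompletedEnd k Γ) :
    BasedFunctor (representable k Γ) (representable k Γ) where
  obj := fun (P : RepObj k Γ) => (P.pull φ : RepObj k Γ)
  map := fun {P P' : RepObj k Γ} (a : RepObj.Hom P P') =>
    (a.pull φ : RepObj.Hom (P.pull φ) (P'.pull φ))
  map_id _ := rfl
  map_comp _ _ := rfl
  w := rfl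

theorem repMap_one (Γ : Subgroup (Equiv.Perm (Fin p))) :
    repMap (CompletedEnd.one (k := k) Γ) = BasedFunctor.id _ := rfl

theorem repMap_comp {Γ : Subgroup (Equiv.Perm (Fin p))} (φ ψ : CompletedEnd k Γ) :
    repMap (φ.comp ψ) = BasedFunctor.comp (repMap φ) (repMap ψ) := rfl

variable (k)

/-- The endomorphism of the completed ring attached to an element of `Γ`. -/
def permEnd {Γ : Subgroup (Equiv.Perm (Fin p))} (σ : Γ) : CompletedEnd k Γ where
  hom := completedPerm k σ
  lin := stdPerm _ _ σ.1
  hom_gen := completedPerm_gen k σ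
  continuous r z h := by rw [evalₐ_completedPerm, h, map_zero]

/-- The action of `Γ` on the quotient, by means of its action on the completed ring. -/
def repAct (Γ : Subgroup (Equiv.Perm (Fin p))) : RightAction Γ (representable k Γ) where
  act σ := repMap (permEnd k σ)
  act_one := (congrArg repMap (CompletedEnd.ext' (completedPerm_one k Γ) rfl :
    permEnd k 1 = CompletedEnd.one Γ)).trans (repMap_one Γ)
  act_mul σ τ := (congrArg repMap (CompletedEnd.ext' (completedPerm_mul k σ τ)
    (congrArg DFunLike.coe (stdPerm_mul _ _ σ.1 τ.1)) :
      permEnd k (σ * τ) = (permEnd k σ).comp (permEnd k τ))).trans (repMap_comp _ _)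

end Deformations

end ConfModuli

end

/-!
A configuration `x` determines the linear form `e_i - e_j ↦ x_i - x_j` on `λ`, a point of `Spec
Sym(λ)[N⁻¹]` on which an affine transformation acts through its linear part. Conversely a point of
`Spec Sym(λ)[N⁻¹]` and one coordinate `x_i` determine the configuration. Hence `Conf(𝔸¹, n)` is
the product of the line with `Spec Sym(λ)[N⁻¹]`, and dividing by the translations removes the
line.

For torsors this is made precise without a descent argument. If `P = Spec E` is a `𝔾ₐ ⋊ 𝔾ₘ`-torsor
with an equivariant map to `Conf(𝔸¹, n)`, its `i`-th coordinate is a global function whose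
values the translations shift simply transitively, so that `E(C) ≅ E'(C) × C`, where `E'` is the ring of
translation-invariant functions (`invariants`, `point_ext`, `liftPoint`). It carries the residual
`𝔾ₘ`-torsor `quotFiber`. Morphisms of `𝔾ₘ`-torsors extend uniquely (`extendFiberHom`), and every
`𝔾ₘ`-torsor over `Spec Sym(λ)[N⁻¹]` arises from its product with the line (`extendFiber`). The
ring `E'` is defined by the action alone, and therefore relabelling does not change it: the
coherence isomorphisms are identities on the underlying torsors (`relabelHom`).

For the completed statement, two coordinates with invertible difference can be normalized to `0`
and `1` in a unique way; by faithfully flat descent for homomorphisms, the normalized point of the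
torsor is a section (`exists_section`). All torsors in question are thus trivial, a morphism is an
affine transformation between chosen sections (`transition`), and it is determined by its linear
part (`hom_eq_of_linPart_eq`, `exists_hom_of_scale`). This gives a fully faithful functor to the
formal quotient, once the point of `Spec Sym(λ)[N⁻¹]` attached to a section extends to the
completed ring. It does, because modulo `I` the form on `λ` satisfies `e_i - e_j ↦ (j - i) y_0`
(`map_diff_of_map_y`): the points over `k` that kill a translate of `I` are the homotheties of the
translate of `𝔽_p` (`exists_unit_of_primeIdeal_le`, `map_translatesIdeal_eq_zero`). For essential
surjectivity, the kernel of the residue map is prime, so it contains a translate of `I` as soon as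
it contains their intersection.

Since `j - i` is a unit modulo `p` for `i ≠ j`, the same formula shows that `N` is invertible
modulo the powers of `I` as soon as the `y_i` are; this compares the two localizations. An affine
permutation multiplies `y_0` by a scalar modulo `I` and hence preserves `I`. The grading is read
off from the coaction `universalScale` of `𝔾ₘ` with values in Laurent polynomials.
-/

noncomputable section

namespace ConfModuli

/-! ### The grading of `Sym(λ)[N⁻¹]` -/

section Grading

variable {R : Type u} [CommRing R] {n : ℕ}

theorem N_mem_range_pow :
    N R n ∈ LinearMap.range (symι R n) ^ (n * (n - 1)) := by
  have hc : ((Finset.univ : Finset (Fin n × Fin n)).filter fun q => q.1 ≠ q.2).card =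
      n * (n - 1) := by
    have h := Finset.offDiag_card (Finset.univ : Finset (Fin n))
    rw [Finset.card_univ, Fintype.card_fin] at h
    rw [Nat.mul_sub, mul_one, ← h]
    congr 1
    ext q
    simp
  rw [N, ← hc]
  generalize (Finset.univ : Finset (Fin n × Fin n)).filter (fun q => q.1 ≠ q.2) = t
  induction t using Finset.cons_induction with
  | empty =>
    rw [Finset.prod_empty, Finset.card_empty, pow_zero]
    exact Submodule.one_le.1 le_rfl
  | cons q t hq ht =>
    rw [Finset.prod_cons, Finset.card_cons, pow_succ']
    exact Submodule.mul_mem_mul (LinearMap.mem_range_self _ _) ht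

theorem algebraMap_N_isUnit : IsUnit (algebraMap (Sym R n) (ConfRing R n) (N R n)) :=
  IsLocalization.Away.algebraMap_isUnit _

theorem confRingScale_algebraMap {C : Type u} [CommRing C] [Algebra R C]
    (q : ConfRing R n →ₐ[R] C) (μ : Cˣ) {r : ℕ} {a : Sym R n}
    (ha : a ∈ LinearMap.range (symι R n) ^ r) :
    confRingScale μ q (algebraMap _ _ a) = (μ : C) ^ r * q (algebraMap _ _ a) := by
  induction ha using Submodule.pow_induction_on_left' with
  | algebraMap r =>
    rw [← IsScalarTower.algebraMap_apply, AlgHom.commutes, AlgHom.commutes, pow_zero, one_mul]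
  | add x y i _ _ hx hy => rw [map_add, map_add, map_add, hx, hy, mul_add]
  | mem_mul m hm i x _ hx =>
    obtain ⟨v, rfl⟩ := hm
    have h : confRingScale μ q (algebraMap _ _ (symι R n v)) =
        μ * q (algebraMap _ _ (symι R n v)) := confRingScale_gen μ q v
    rw [map_mul, map_mul, map_mul, hx, h, Nat.succ_eq_add_one]
    ring

theorem natCast_card_N (hn : 1 ≤ n) : ((n * (n - 1) : ℕ) : ℤ) = (n : ℤ) * ((n : ℤ) - 1) := by
  rw [Nat.cast_mul, Nat.cast_sub hn, Nat.cast_one]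

/-- The action of `𝔾ₘ` reads off the degree: fractions `a / Nᵏ` are compared after multiplication by
the unit `Nᵏ`. -/
theorem confRingScale_degreePart (hn : 1 ≤ n) {C : Type u} [CommRing C] [Algebra R C]
    (q : ConfRing R n →ₐ[R] C) (μ : Cˣ) (m : ℤ) {s : ConfRing R n}
    (hs : s ∈ degreePart R n (-2 * m)) :
    confRingScale μ q s = ((μ ^ m : Cˣ) : C) * q s := by
  induction hs using Submodule.span_induction with
  | zero => simp
  | add x y _ _ hx hy => rw [map_add, map_add, hx, hy, mul_add]
  | smul c x _ hx => rw [map_smul, map_smul, hx, mul_smul_comm]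
  | mem s hs =>
    obtain ⟨r, k, a, ha, hsa, hd⟩ := hs
    rw [← natCast_card_N hn] at hd
    set d := n * (n - 1) with hd0
    have hr : (r : ℤ) = m + (d * k : ℕ) := by push_cast; linarith
    have hu : IsUnit (((μ : C) ^ (d * k)) * q (algebraMap _ _ (N R n)) ^ k) :=
      (μ.isUnit.pow _).mul ((algebraMap_N_isUnit.map q).pow k)
    refine hu.mul_right_cancel ?_
    have e1 := congrArg (confRingScale μ q) hsa
    rw [map_mul, map_pow, confRingScale_algebraMap q μ N_mem_range_pow,
      confRingScale_algebraMap q μ ha, ← hsa, map_mul, map_pow] at e1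
    have e2 : ((μ ^ m : Cˣ) : C) * (μ : C) ^ (d * k) = (μ : C) ^ r := by
      rw [← Units.val_pow_eq_pow_val, ← Units.val_pow_eq_pow_val, ← Units.val_mul,
        ← zpow_natCast μ (d * k), ← zpow_add, ← hr, zpow_natCast]
    calc _ = confRingScale μ q s *
          ((μ : C) ^ d * q (algebraMap _ _ (N R n))) ^ k := by rw [mul_pow, pow_mul]
      _ = _ := e1
      _ = _ := by rw [← e2]; ring

theorem degreePart_eq_bot_of_odd {d : ℤ} (hd : ¬ ∃ m : ℤ, d = -2 * m) :
    degreePart R n d = ⊥ := by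
  rw [degreePart, Submodule.span_eq_bot]
  rintro s ⟨r, k, a, -, -, h⟩
  exact (hd ⟨r - k * (n * (n - 1)), by rw [h]; ring⟩).elim

theorem gen_mem_degreePart (a : stdRep R n) :
    gen R n (N R n) a ∈ degreePart R n (-2) :=
  Submodule.subset_span ⟨1, 0, symι R n a, by simp, by
    rw [pow_zero, mul_one]; rfl, by simp⟩

instance degreePart_gradedMonoid : SetLike.GradedMonoid (degreePart R n) where
  one_mem := Submodule.subset_span ⟨0, 0, 1, by
    rw [pow_zero]; exact Submodule.one_le.1 le_rfl, by simp, by simp⟩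
  mul_mem i j s t hs ht := by
    have h : degreePart R n i * degreePart R n j ≤ degreePart R n (i + j) := by
      rw [degreePart, degreePart, Submodule.span_mul_span, Submodule.span_le]
      rintro _ ⟨s, ⟨r, k, a, ha, hs, hi⟩, t, ⟨r', k', b, hb, ht, hj⟩, rfl⟩
      refine Submodule.subset_span ⟨r + r', k + k', a * b, ?_, ?_, ?_⟩
      · rw [pow_add]
        exact Submodule.mul_mem_mul ha hb
      · rw [map_mul, ← hs, ← ht]
        ring
      · rw [hi, hj]
        push_cast
        ring
    exact h (Submodule.mul_mem_mul hs ht)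

theorem iSup_range_symι_pow : ⨆ r : ℕ, LinearMap.range (symι R n) ^ r = ⊤ := by
  refine eq_top_iff.2 fun s _ => ?_
  have hs : ∀ (r : ℕ) (a : Sym R n), a ∈ LinearMap.range (symι R n) ^ r →
      a ∈ ⨆ r : ℕ, LinearMap.range (symι R n) ^ r := fun r a ha => Submodule.mem_iSup_of_mem r ha
  refine SymmetricAlgebra.induction (R := R) (M := stdRep R n) (motive := fun a : Sym R n =>
    a ∈ ⨆ r : ℕ, LinearMap.range (symι R n) ^ r) (fun c => hs 0 _ ?_) (fun v => hs 1 _ ?_)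
    (fun a b ha hb => ?_) (fun a b ha hb => add_mem ha hb) s
  · rw [pow_zero]
    exact Submodule.algebraMap_mem c
  · rw [pow_one]
    exact LinearMap.mem_range_self _ v
  · have h := Submodule.mul_mem_mul ha hb
    rw [Submodule.iSup_mul] at h
    have hle : ⨆ i, LinearMap.range (symι R n) ^ i * ⨆ r : ℕ, LinearMap.range (symι R n) ^ r ≤
        ⨆ r : ℕ, LinearMap.range (symι R n) ^ r := ?_
    · exact hle h
    refine iSup_le fun i => ?_
    rw [Submodule.mul_iSup]
    refine iSup_le fun j => ?_
    rw [← pow_add]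
    exact le_iSup (fun r : ℕ => LinearMap.range (symι R n) ^ r) (i + j)

theorem iSup_degreePart : ⨆ d, degreePart R n d = ⊤ := by
  refine eq_top_iff.2 fun s _ => ?_
  obtain ⟨⟨a, ⟨_, k, rfl⟩⟩, hs⟩ := IsLocalization.surj (Submonoid.powers (N R n)) s
  obtain ⟨t, ht⟩ : ∃ t : ConfRing R n, t * algebraMap _ _ (N R n) ^ k = 1 :=
    ⟨_, (algebraMap_N_isUnit.pow k).val_inv_mul⟩
  have hst : s = t * algebraMap _ _ a := by
    rw [← hs, map_pow, mul_left_comm, ht, mul_one]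
  clear hs
  rw [hst]
  have ha : a ∈ ⨆ r : ℕ, LinearMap.range (symι R n) ^ r := by rw [iSup_range_symι_pow]; trivial
  clear hst
  induction ha using Submodule.iSup_induction' with
  | zero => simp
  | add x y _ _ hx hy => rw [map_add, mul_add]; exact Submodule.add_mem _ hx hy
  | mem r a ha =>
    refine Submodule.mem_iSup_of_mem _ (Submodule.subset_span ⟨r, k, a, ha, ?_, rfl⟩)
    rw [mul_right_comm, ht, one_mul]

open LaurentPolynomial in
/-- The powers of the coordinate `T` of the torus, as units. -/
theorem laurent_unit_zpow {S : Type*} [CommRing S] (k : ℤ) :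
    ((isUnit_T 1).unit ^ k : S[T;T⁻¹]ˣ) = (isUnit_T k).unit := by
  induction k using Int.induction_on with
  | zero => exact Units.ext T_zero.symm
  | succ i hi =>
    rw [zpow_add, hi, zpow_one]
    exact Units.ext (T_add _ _).symm
  | pred i hi =>
    rw [zpow_sub, hi, zpow_one, mul_inv_eq_iff_eq_mul]
    exact Units.ext ((congrArg T (sub_add_cancel _ _).symm).trans (T_add _ _))

/-- Scaling by the universal unit `T` is the coaction of `𝔾ₘ`; it turns the element `s` of degree
`-2 m` into `s T ^ m`. -/
def universalScale (R : Type u) [CommRing R] (n : ℕ) :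
    ConfRing R n →ₐ[R] LaurentPolynomial (ConfRing R n) :=
  confRingScale (LaurentPolynomial.isUnit_T 1).unit
    (IsScalarTower.toAlgHom R (ConfRing R n) (LaurentPolynomial (ConfRing R n)))

theorem universalScale_degreePart (hn : 1 ≤ n) (m : ℤ) {s : ConfRing R n}
    (hs : s ∈ degreePart R n (-2 * m)) :
    universalScale R n s = LaurentPolynomial.C s * LaurentPolynomial.T m := by
  rw [universalScale, confRingScale_degreePart hn _ _ m hs, mul_comm]
  congr 1
  rw [laurent_unit_zpow]
  rfl

/-- The component of degree `-2 m` of an element is recovered as the coefficient of `T ^ m` in the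
coaction, which shows that the sum of the graded parts is direct. -/
theorem degreePart_isInternal (hn : 1 ≤ n) : DirectSum.IsInternal (degreePart R n) := by
  have hcoeff : ∀ (m : ℤ) (x : DirectSum ℤ fun d => degreePart R n d),
      (universalScale R n (DirectSum.coeAddMonoidHom (degreePart R n) x)).coeff m =
        (x (-2 * m) : ConfRing R n) := by
    intro m x
    induction x using DirectSum.induction_on with
    | zero => simp
    | add x y hx hy =>
      rw [map_add, map_add, DirectSum.add_apply, Submodule.coe_add, ← hx, ← hy]
      rfl
    | of d s =>
      rw [DirectSum.coeAddMonoidHom_of]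
      by_cases hd : ∃ m' : ℤ, d = -2 * m'
      · obtain ⟨m', rfl⟩ := hd
        rw [universalScale_degreePart hn m' s.2, ← LaurentPolynomial.single_eq_C_mul_T]
        by_cases hm : m' = m
        · subst hm
          rw [DirectSum.of_eq_same]
          exact Finsupp.single_eq_same
        · rw [DirectSum.of_eq_of_ne _ _ _ (by omega)]
          exact Finsupp.single_eq_of_ne (Ne.symm hm)
      · have hs : s = 0 := Subtype.ext
          ((Submodule.mem_bot R).1 ((degreePart_eq_bot_of_odd hd).le s.2))
        rw [hs, map_zero]
        simp
  constructor
  · rw [injective_iff_map_eq_zero]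
    intro x hx
    refine DFinsupp.ext fun d => Subtype.ext ?_
    by_cases hd : ∃ m : ℤ, d = -2 * m
    · obtain ⟨m, rfl⟩ := hd
      have h := hcoeff m x
      rw [hx, map_zero] at h
      exact h.symm
    · exact (Submodule.mem_bot R).1 ((degreePart_eq_bot_of_odd hd).le (x d).2)
  · intro s
    have hs : s ∈ ⨆ d, degreePart R n d := by rw [iSup_degreePart]; trivial
    induction hs using Submodule.iSup_induction' with
    | zero => exact ⟨0, map_zero _⟩
    | add x y _ _ hx hy =>
      obtain ⟨a, rfl⟩ := hx
      obtain ⟨b, rfl⟩ := hy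
      exact ⟨a + b, map_add _ _ _⟩
    | mem d s hs => exact ⟨DirectSum.of _ d ⟨s, hs⟩, DirectSum.coeAddMonoidHom_of _ _ _⟩

end Grading

/-! ### Linear forms on `λ` -/

section Forms

variable {R : Type u} [CommRing R] {n : ℕ}

theorem diff_add_diff (i j l : Fin n) : diff R n i j + diff R n j l = diff R n i l :=
  Subtype.ext (sub_add_sub_cancel _ _ _)

theorem diff_self (i : Fin n) : diff R n i i = 0 := Subtype.ext (sub_self _)

/-- A linear form with the same value `c` at all `y_i` is determined by `c`: `e_i - e_j` is the sum
of `j - i` consecutive `y_l`. -/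
theorem map_diff_of_map_y {C : Type*} [CommRing C] [Algebra R C] (l : stdRep R n →ₗ[R] C) (c : C)
    (h : ∀ i, l (y R n i) = c) (i j : Fin n) :
    l (diff R n i j) = (((j : ℕ) : C) - ((i : ℕ) : C)) * c := by
  obtain _ | m := n
  · exact i.elim0
  have h0 : ∀ (a : ℕ) (ha : a < m + 1), l (diff R (m + 1) 0 ⟨a, ha⟩) = (a : C) * c := by
    intro a
    induction a with
    | zero =>
      intro ha
      have : diff R (m + 1) 0 ⟨0, ha⟩ = 0 := diff_self _
      rw [this, map_zero, Nat.cast_zero, zero_mul]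
    | succ a iha =>
      intro ha
      have hy := h ⟨a, by omega⟩
      rw [y, finRotate_of_lt (by omega)] at hy
      rw [← diff_add_diff 0 ⟨a, by omega⟩, map_add, iha, hy]
      push_cast
      ring
  have e := congrArg l (diff_add_diff (R := R) 0 i j)
  rw [map_add, h0 i.1 i.2, h0 j.1 j.2] at e
  linear_combination e

/-- Modulo `n` the rotation adds `1`, also at the last index. -/
theorem natCast_finRotate {C : Type*} [CommRing C] (hn : (n : C) = 0) (i : Fin n) :
    (((finRotate n i : Fin n) : ℕ) : C) = (i : ℕ) + 1 := by
  obtain _ | m := n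
  · exact i.elim0
  rcases eq_or_ne i (Fin.last m) with rfl | hi
  · rw [finRotate_last, Fin.val_zero, Fin.val_last, Nat.cast_zero, ← Nat.cast_add_one, hn]
  · rw [coe_finRotate_of_ne_last hi, Nat.cast_add_one]

theorem natCast_eq_of_zmod {p : ℕ} {C : Type*} [CommRing C] (hp : (p : C) = 0) {a b : ℕ}
    (h : (a : ZMod p) = b) : (a : C) = b := by
  have h' := (Nat.modEq_iff_dvd.1 ((ZMod.natCast_eq_natCast_iff a b p).1 h))
  obtain ⟨t, ht⟩ := h'
  have e : ((b : ℤ) : C) - ((a : ℤ) : C) = (p : ℤ) * t := by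
    rw [← Int.cast_sub, ht, Int.cast_mul]
  rw [Int.cast_natCast, Int.cast_natCast, Int.cast_natCast, hp, zero_mul] at e
  exact (sub_eq_zero.1 e).symm

/-- Distinct indices have a difference prime to `p`, which is invertible in characteristic `p`. -/
theorem isUnit_natCast_sub {p : ℕ} [Fact p.Prime] {C : Type*} [CommRing C] (hp : (p : C) = 0)
    {i j : Fin p} (h : i ≠ j) : IsUnit (((j : ℕ) : C) - ((i : ℕ) : C)) := by
  have hc : IsCoprime ((j : ℤ) - (i : ℤ)) (p : ℤ) := by
    rw [isCoprime_comm]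
    refine (Nat.prime_iff_prime_int.1 (Fact.out : p.Prime)).coprime_iff_not_dvd.2 fun hd => h ?_
    have := Int.eq_zero_of_abs_lt_dvd hd (by
      rw [abs_lt]
      have := i.2
      have := j.2
      omega)
    exact Fin.ext (by omega)
  obtain ⟨u, v, huv⟩ := hc
  have e := congrArg (Int.cast (R := C)) huv
  push_cast at e
  rw [hp, mul_zero, add_zero] at e
  exact IsUnit.of_mul_eq_one _ ((mul_comm _ _).trans e)

end Forms

/-! ### The ideal `I` -/

section PrimeIdeal

variable {p : ℕ} [Fact p.Prime] (k : Type u) [Field k]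

/-- The linear form `λ → Sym(λ)[f⁻¹] / I`. -/
def residualGen (f : Sym (WittVector p k) p) :
    stdRep (WittVector p k) p →ₗ[WittVector p k]
      (SymAway (WittVector p k) p f ⧸ primeIdeal k f) :=
  (Ideal.Quotient.mkₐ (WittVector p k) (primeIdeal k f)).toLinearMap ∘ₗ gen (WittVector p k) p f

theorem natCast_prime_mem_primeIdeal (f : Sym (WittVector p k) p) :
    (p : SymAway (WittVector p k) p f) ∈ primeIdeal k f :=
  Ideal.subset_span (Or.inl rfl)

theorem natCast_prime_residual (f : Sym (WittVector p k) p) :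
    (p : SymAway (WittVector p k) p f ⧸ primeIdeal k f) = 0 := by
  rw [← map_natCast (Ideal.Quotient.mk (primeIdeal k f)), Ideal.Quotient.eq_zero_iff_mem]
  exact natCast_prime_mem_primeIdeal k f

theorem residualGen_y (f : Sym (WittVector p k) p) (i j : Fin p) :
    residualGen k f (y _ p i) = residualGen k f (y _ p j) :=
  (Ideal.Quotient.mk_eq_mk_iff_sub_mem _ _).2 (Ideal.subset_span (Or.inr ⟨i, j, rfl⟩))

/-- The zero of `Fin p`. -/
abbrev zeroIdx (p : ℕ) [Fact p.Prime] : Fin p := ⟨0, (Fact.out : p.Prime).pos⟩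

theorem residualGen_diff (f : Sym (WittVector p k) p) (i j : Fin p) :
    residualGen k f (diff _ p i j) =
      (((j : ℕ) : SymAway (WittVector p k) p f ⧸ primeIdeal k f) - ((i : ℕ) : _)) *
        residualGen k f (y _ p (zeroIdx p)) :=
  map_diff_of_map_y (residualGen k f) _ (fun i => residualGen_y k f i _) i j

/-- A homomorphism sends `I` into an ideal as soon as that ideal contains `p` and the images of the
`y_i` agree modulo it. -/
theorem primeIdeal_le_comap {f : Sym (WittVector p k) p} {C : Type*} [CommRing C]
    (φ : SymAway (WittVector p k) p f →+* C) (J : Ideal C) (hp : (p : C) ∈ J)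
    (hy : ∀ i j, φ (gen _ p f (y _ p i)) - φ (gen _ p f (y _ p j)) ∈ J) :
    primeIdeal k f ≤ J.comap φ := by
  rw [primeIdeal, Ideal.span_le]
  rintro s (rfl | ⟨i, j, rfl⟩)
  · change φ _ ∈ J
    rwa [map_natCast]
  · change φ _ ∈ J
    rw [map_sub]
    exact hy i j

/-- An affine permutation `i ↦ a i + b` sends each `y_i` to `a y_0` modulo `I`. -/
theorem primeIdeal_le_comap_perm (τ : Equiv.Perm (Fin p))
    (h : ∃ a b : ZMod p, ∀ i : Fin p, ((τ i : ℕ) : ZMod p) = a * ((i : ℕ) : ZMod p) + b) :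
    primeIdeal k (N (WittVector p k) p) ≤
      (primeIdeal k (N (WittVector p k) p)).comap (confRingPerm (WittVector p k) p τ) := by
  obtain ⟨a, b, h⟩ := h
  set f := N (WittVector p k) p with hf
  have hp := natCast_prime_residual k f
  have hcast : ∀ i : Fin p, ((τ i : ℕ) : SymAway (WittVector p k) p f ⧸ primeIdeal k f) =
      (a.val : SymAway (WittVector p k) p f ⧸ primeIdeal k f) * (i : ℕ) + (b.val : ℕ) := by
    intro i
    rw [← Nat.cast_mul, ← Nat.cast_add]
    refine natCast_eq_of_zmod hp ?_
    rw [h i, Nat.cast_add, Nat.cast_mul, ZMod.natCast_zmod_val, ZMod.natCast_zmod_val]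
  have hτ : ∀ i, residualGen k f (stdPerm _ p τ (y _ p i)) =
      (a.val : SymAway (WittVector p k) p f ⧸ primeIdeal k f) *
        residualGen k f (y _ p (zeroIdx p)) := by
    intro i
    have e : stdPerm (WittVector p k) p τ (y _ p i) = diff _ p (τ i) (τ (finRotate p i)) :=
      stdPerm_diff _ p τ i _
    rw [e, residualGen_diff, hcast, hcast, natCast_finRotate hp]
    ring
  refine primeIdeal_le_comap k (confRingPerm (WittVector p k) p τ).toRingHom (primeIdeal k f)
    (natCast_prime_mem_primeIdeal k f) fun i j => ?_
  have e : ∀ i, (confRingPerm (WittVector p k) p τ).toRingHom (gen _ p f (y _ p i)) =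
      gen _ p f (stdPerm _ p τ (y _ p i)) := fun i => confRingPerm_gen _ _ _ _
  rw [e, e]
  exact (Ideal.Quotient.mk_eq_mk_iff_sub_mem _ _).1 ((hτ i).trans (hτ j).symm)

theorem translatesIdeal_eq_primeIdeal (Γ : Subgroup (Equiv.Perm (Fin p)))
    (h : ∀ τ ∈ Γ, ∃ a b : ZMod p, ∀ i : Fin p,
      ((τ i : ℕ) : ZMod p) = a * ((i : ℕ) : ZMod p) + b) :
    translatesIdeal k Γ = primeIdeal k (N (WittVector p k) p) := by
  refine le_antisymm ((iInf_le _ (1 : Γ)).trans ?_)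
    (le_iInf fun γ => primeIdeal_le_comap_perm k γ.1 (h γ.1 γ.2))
  intro s hs
  rwa [Ideal.mem_comap, Subgroup.coe_one, confRingPerm_one] at hs

end PrimeIdeal

/-! ### Inverting only the cyclic translates -/

section Cyclic

/-- Compatible isomorphisms modulo all powers give an isomorphism of the completions. -/
theorem exists_adicCompletion_equiv {S T : Type u} [CommRing S] [CommRing T] (I : Ideal S)
    (J : Ideal T) (ψ : S →+* T) (e : ∀ r : ℕ, (S ⧸ I ^ r) ≃+* (T ⧸ J ^ r))
    (he : ∀ r s, e r (Ideal.Quotient.mk _ s) = Ideal.Quotient.mk _ (ψ s)) :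
    ∃ E : AdicCompletion I S ≃+* AdicCompletion J T,
      ∀ r z, AdicCompletion.evalₐ J r (E z) = e r (AdicCompletion.evalₐ I r z) := by
  have hI : ∀ {m r : ℕ} (hle : m ≤ r) (z : AdicCompletion I S),
      Ideal.Quotient.factorPow I hle (AdicCompletion.evalₐ I r z) =
        AdicCompletion.evalₐ I m z := by
    intro m r hle z
    obtain ⟨s, rfl⟩ := AdicCompletion.mk_surjective I _ z
    rw [AdicCompletion.evalₐ_mk, AdicCompletion.evalₐ_mk]
    exact AdicCompletion.Ideal.mk_eq_mk (I := I) hle s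
  have hJ : ∀ {m r : ℕ} (hle : m ≤ r) (z : AdicCompletion J T),
      Ideal.Quotient.factorPow J hle (AdicCompletion.evalₐ J r z) =
        AdicCompletion.evalₐ J m z := by
    intro m r hle z
    obtain ⟨s, rfl⟩ := AdicCompletion.mk_surjective J _ z
    rw [AdicCompletion.evalₐ_mk, AdicCompletion.evalₐ_mk]
    exact AdicCompletion.Ideal.mk_eq_mk (I := J) hle s
  have hfac : ∀ {m r : ℕ} (hle : m ≤ r) (x : S ⧸ I ^ r),
      Ideal.Quotient.factorPow J hle (e r x) = e m (Ideal.Quotient.factorPow I hle x) := by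
    intro m r hle x
    obtain ⟨s, rfl⟩ := Ideal.Quotient.mk_surjective x
    rw [he]
    exact (he m s).symm
  have hfac' : ∀ {m r : ℕ} (hle : m ≤ r) (x : T ⧸ J ^ r),
      Ideal.Quotient.factorPow I hle ((e r).symm x) =
        (e m).symm (Ideal.Quotient.factorPow J hle x) := by
    intro m r hle x
    rw [RingEquiv.eq_symm_apply, ← hfac, RingEquiv.apply_symm_apply]
  let F := AdicCompletion.liftRingHom J
    (fun r => (e r).toRingHom.comp (AdicCompletion.evalₐ I r).toRingHom)
    (fun {m r} hle => RingHom.ext fun z => (hfac hle _).trans (congrArg (e m) (hI hle z)))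
  let G := AdicCompletion.liftRingHom I
    (fun r => (e r).symm.toRingHom.comp (AdicCompletion.evalₐ J r).toRingHom)
    (fun {m r} hle => RingHom.ext fun z => (hfac' hle _).trans (congrArg (e m).symm (hJ hle z)))
  have hF : ∀ r z, AdicCompletion.evalₐ J r (F z) = e r (AdicCompletion.evalₐ I r z) :=
    fun r z => AdicCompletion.evalₐ_liftRingHom _ _ _ r z
  have hG : ∀ r z, AdicCompletion.evalₐ I r (G z) = (e r).symm (AdicCompletion.evalₐ J r z) :=
    fun r z => AdicCompletion.evalₐ_liftRingHom _ _ _ r z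
  refine ⟨RingEquiv.ofRingHom F G (RingHom.ext fun z => AdicCompletion.ext_evalₐ fun r => ?_)
    (RingHom.ext fun z => AdicCompletion.ext_evalₐ fun r => ?_), hF⟩
  · rw [RingHom.comp_apply, hF, hG, RingEquiv.apply_symm_apply]
    rfl
  · rw [RingHom.comp_apply, hG, hF, RingEquiv.symm_apply_apply]
    rfl

/-- Units lift along the nilpotent thickenings `S / Iʳ → S / I`. -/
theorem isUnit_quotient_pow {S : Type*} [CommRing S] {I : Ideal S} {a : S}
    (ha : IsUnit (Ideal.Quotient.mk I a)) (r : ℕ) : IsUnit (Ideal.Quotient.mk (I ^ r) a) := by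
  obtain ⟨b, hb⟩ := ha.exists_right_inv
  obtain ⟨b, rfl⟩ := Ideal.Quotient.mk_surjective b
  rw [← map_mul, ← map_one (Ideal.Quotient.mk I), Ideal.Quotient.mk_eq_mk_iff_sub_mem] at hb
  have hn : IsNilpotent (Ideal.Quotient.mk (I ^ r) (a * b - 1)) := ⟨r, by
    rw [← map_pow, Ideal.Quotient.eq_zero_iff_mem]
    exact Ideal.pow_mem_pow hb r⟩
  have hu := hn.isUnit_one_add
  rw [← map_one (Ideal.Quotient.mk (I ^ r)), ← map_add, add_sub_cancel, map_mul] at hu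
  exact isUnit_of_mul_isUnit_left hu

variable (p : ℕ) [Fact p.Prime] (k : Type u) [Field k]

theorem isUnit_gen_y_cyclic (i : Fin p) :
    IsUnit (gen (WittVector p k) p (cyclicN (WittVector p k) p) (y _ p i)) := by
  have h : IsUnit (algebraMap (Sym (WittVector p k) p)
      (SymAway (WittVector p k) p (cyclicN (WittVector p k) p)) (cyclicN (WittVector p k) p)) :=
    IsLocalization.Away.algebraMap_isUnit _
  have e : algebraMap (Sym (WittVector p k) p)
      (SymAway (WittVector p k) p (cyclicN (WittVector p k) p)) (cyclicN (WittVector p k) p) =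
      ∏ i, gen (WittVector p k) p _ (y _ p i) := map_prod _ _ _
  rw [e, IsUnit.prod_iff] at h
  exact h i (Finset.mem_univ i)

/-- Modulo `I` the differences are multiples of the unit `y_0` by units of `𝔽_p`. -/
theorem isUnit_N_cyclic (r : ℕ) :
    IsUnit (Ideal.Quotient.mk (primeIdeal k (cyclicN (WittVector p k) p) ^ r)
      (algebraMap _ _ (N (WittVector p k) p))) := by
  refine isUnit_quotient_pow ?_ r
  have e : Ideal.Quotient.mk (primeIdeal k (cyclicN (WittVector p k) p))
      (algebraMap _ _ (N (WittVector p k) p)) =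
      ∏ q ∈ (Finset.univ : Finset (Fin p × Fin p)) with q.1 ≠ q.2,
        residualGen k (cyclicN (WittVector p k) p) (diff _ p q.1 q.2) := by
    rw [N, map_prod, map_prod]
    rfl
  rw [e, IsUnit.prod_iff]
  intro q hq
  rw [residualGen_diff]
  exact (isUnit_natCast_sub (natCast_prime_residual k _) (Finset.mem_filter.1 hq).2).mul
    ((isUnit_gen_y_cyclic p k _).map (Ideal.Quotient.mk _))

theorem isUnit_algebraMap_cyclicN :
    IsUnit (algebraMap (Sym (WittVector p k) p) (ConfRing (WittVector p k) p)
      (cyclicN (WittVector p k) p)) := by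
  rw [cyclicN, map_prod, IsUnit.prod_iff]
  intro i _
  refine isUnit_gen_diff i (finRotate p i) fun h => ?_
  have hp : 1 < p := (Fact.out : p.Prime).one_lt
  have h1 := natCast_finRotate (C := ZMod p) (by simp) i
  rw [← h] at h1
  have : Fact (1 < p) := ⟨hp⟩
  exact one_ne_zero (left_eq_add.1 h1)

/-- The canonical map from the ring with only the cyclic translates inverted. -/
def cyclicToConf : SymAway (WittVector p k) p (cyclicN (WittVector p k) p) →+*
    ConfRing (WittVector p k) p :=
  IsLocalization.Away.lift (cyclicN (WittVector p k) p) (isUnit_algebraMap_cyclicN p k)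

theorem cyclicToConf_algebraMap (a : Sym (WittVector p k) p) :
    cyclicToConf p k (algebraMap _ _ a) = algebraMap (Sym (WittVector p k) p) _ a :=
  IsLocalization.Away.lift_eq _ _ _

/-- Modulo powers of `I` the map from `Sym(λ)` to the smaller localization factors through
`Sym(λ)[N⁻¹]`. -/
def confToCyclic (r : ℕ) : ConfRing (WittVector p k) p →+*
    (SymAway (WittVector p k) p (cyclicN (WittVector p k) p) ⧸
      primeIdeal k (cyclicN (WittVector p k) p) ^ r) :=
  IsLocalization.Away.lift (g := (Ideal.Quotient.mk _).comp (algebraMap _ _))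
    (N (WittVector p k) p) (isUnit_N_cyclic p k r)

theorem confToCyclic_algebraMap (r : ℕ) (a : Sym (WittVector p k) p) :
    confToCyclic p k r (algebraMap _ _ a) =
      Ideal.Quotient.mk _ (algebraMap (Sym (WittVector p k) p) _ a) :=
  IsLocalization.Away.lift_eq _ _ _

theorem primeIdeal_pow_le_comap_cyclicToConf (r : ℕ) :
    primeIdeal k (cyclicN (WittVector p k) p) ^ r ≤
      (primeIdeal k (N (WittVector p k) p) ^ r).comap (cyclicToConf p k) := by
  refine (Ideal.pow_right_mono (primeIdeal_le_comap k (cyclicToConf p k) _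
    (natCast_prime_mem_primeIdeal k _) fun i j => ?_) r).trans (Ideal.le_comap_pow _ r)
  have e : ∀ i, cyclicToConf p k (gen _ p _ (y _ p i)) = gen _ p _ (y _ p i) :=
    fun i => cyclicToConf_algebraMap p k _
  rw [e, e]
  exact Ideal.subset_span (Or.inr ⟨i, j, rfl⟩)

theorem confToCyclic_eq_zero (r : ℕ) (s : ConfRing (WittVector p k) p)
    (hs : s ∈ primeIdeal k (N (WittVector p k) p) ^ r) : confToCyclic p k r s = 0 := by
  have h : primeIdeal k (N (WittVector p k) p) ≤
      ((primeIdeal k (cyclicN (WittVector p k) p)).map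
        (Ideal.Quotient.mk (primeIdeal k (cyclicN (WittVector p k) p) ^ r))).comap
          (confToCyclic p k r) := by
    refine primeIdeal_le_comap k (confToCyclic p k r) _ ?_ fun i j => ?_
    · rw [← map_natCast (Ideal.Quotient.mk _)]
      exact Ideal.mem_map_of_mem _ (natCast_prime_mem_primeIdeal k _)
    · have e : ∀ i, confToCyclic p k r (gen _ p _ (y _ p i)) =
          Ideal.Quotient.mk _ (gen _ p _ (y _ p i)) := fun i => confToCyclic_algebraMap p k r _
      rw [e, e, ← map_sub]
      exact Ideal.mem_map_of_mem _ (Ideal.subset_span (Or.inr ⟨i, j, rfl⟩))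
  have h' := Ideal.le_comap_pow _ r (Ideal.pow_right_mono h r hs)
  rw [Ideal.mem_comap, ← Ideal.map_pow, Ideal.map_quotient_self] at h'
  exact h'

/-- The two localizations agree modulo powers of `I`. -/
def cyclicQuotientEquiv (r : ℕ) :
    (SymAway (WittVector p k) p (cyclicN (WittVector p k) p) ⧸
      primeIdeal k (cyclicN (WittVector p k) p) ^ r) ≃+*
    (ConfRing (WittVector p k) p ⧸ primeIdeal k (N (WittVector p k) p) ^ r) :=
  RingEquiv.ofRingHom
    (Ideal.quotientMap _ (cyclicToConf p k) (primeIdeal_pow_le_comap_cyclicToConf p k r))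
    (Ideal.Quotient.lift _ (confToCyclic p k r) (confToCyclic_eq_zero p k r))
    (Ideal.Quotient.ringHom_ext (IsLocalization.ringHom_ext
      (Submonoid.powers (N (WittVector p k) p))
      (RingHom.ext fun a => (congrArg (Ideal.quotientMap _ (cyclicToConf p k)
        (primeIdeal_pow_le_comap_cyclicToConf p k r)) (confToCyclic_algebraMap p k r a)).trans
          (congrArg (Ideal.Quotient.mk _) (cyclicToConf_algebraMap p k a)))))
    (Ideal.Quotient.ringHom_ext (IsLocalization.ringHom_ext
      (Submonoid.powers (cyclicN (WittVector p k) p))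
      (RingHom.ext fun a => (congrArg (confToCyclic p k r) (cyclicToConf_algebraMap p k a)).trans
        (confToCyclic_algebraMap p k r a))))

theorem exists_cyclic_completion_equiv :
    ∃ e : AdicCompletion
          (primeIdeal k (cyclicN (WittVector p k) p))
          (SymAway (WittVector p k) p (cyclicN (WittVector p k) p)) ≃+*
        AdicCompletion
          (primeIdeal k (N (WittVector p k) p))
          (ConfRing (WittVector p k) p),
      (∀ a : Sym (WittVector p k) p,
        e (AdicCompletion.of _ _ (algebraMap _ _ a)) =
          AdicCompletion.of _ _ (algebraMap _ _ a)) ∧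
      ∀ (r : ℕ) z, AdicCompletion.evalₐ _ r z = 0 ↔ AdicCompletion.evalₐ _ r (e z) = 0 := by
  obtain ⟨E, hE⟩ := exists_adicCompletion_equiv (primeIdeal k (cyclicN (WittVector p k) p))
    (primeIdeal k (N (WittVector p k) p)) (cyclicToConf p k) (cyclicQuotientEquiv p k)
    (fun r s => rfl)
  refine ⟨E, fun a => AdicCompletion.ext_evalₐ fun r => ?_, fun r z => ?_⟩
  · rw [hE, AdicCompletion.evalₐ_of, AdicCompletion.evalₐ_of]
    exact congrArg (Ideal.Quotient.mk _) (cyclicToConf_algebraMap p k a)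
  · rw [hE]
    exact (map_eq_zero_iff _ (cyclicQuotientEquiv p k r).injective).symm

end Cyclic

/-! ### Configurations up to translation -/

section Affine

variable {R : Type u} [CommRing R] {n : ℕ}

/-- The affine transformation `t ↦ μ t + b`, as a point of `𝔾ₐ ⋊ 𝔾ₘ`. -/
def aff {C : CommAlgCat.{u} R} (b : C) (μ : Cˣ) : (Aff R).obj C :=
  (⟨Multiplicative.ofAdd b, μ⟩ : AffPts C)

/-- The linear part of an affine transformation. -/
def linPart {C : CommAlgCat.{u} R} (g : (Aff R).obj C) : Cˣ :=
  SemidirectProduct.right (show AffPts C from g)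

/-- The constant term of an affine transformation. -/
def constPart {C : CommAlgCat.{u} R} (g : (Aff R).obj C) : C :=
  (SemidirectProduct.left (show AffPts C from g)).toAdd

theorem aff_parts {C : CommAlgCat.{u} R} (g : (Aff R).obj C) :
    aff (constPart g) (linPart g) = g := rfl

@[simp]
theorem linPart_aff {C : CommAlgCat.{u} R} (b : C) (μ : Cˣ) : linPart (aff b μ) = μ := rfl

@[simp]
theorem constPart_aff {C : CommAlgCat.{u} R} (b : C) (μ : Cˣ) : constPart (aff b μ) = b := rfl

theorem aff_mul {C : CommAlgCat.{u} R} (b b' : C) (μ μ' : Cˣ) :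
    aff b μ * aff b' μ' = aff (b + (μ : C) * b') (μ * μ') := rfl

theorem aff_zero_one {C : CommAlgCat.{u} R} : aff (0 : C) 1 = 1 := rfl

theorem map_aff {C D : CommAlgCat.{u} R} (f : C ⟶ D) (b : C) (μ : Cˣ) :
    (Aff R).map f (aff b μ) = aff (f.hom b) (Units.map (f.hom : C →* D) μ) := rfl

theorem conf_smul_apply {C : CommAlgCat.{u} R} (g : (Aff R).obj C) (x : (confSpace R n).pts C)
    (i : Fin n) : (g • x).1 i = linPart g * x.1 i + constPart g := rfl

/-- The linear form on `λ` given by a configuration: `e_i - e_j` has the value `x_i - x_j`. -/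
def confForm {C : Type*} [CommRing C] [Algebra R C] (x : Fin n → C) : stdRep R n →ₗ[R] C where
  toFun a := ∑ i, a.1 i • x i
  map_add' a b := by
    rw [← Finset.sum_add_distrib]
    exact Finset.sum_congr rfl fun i _ => add_smul _ _ _
  map_smul' c a := by
    rw [RingHom.id_apply, Finset.smul_sum]
    exact Finset.sum_congr rfl fun i _ => mul_smul _ _ _

theorem confForm_apply {C : Type*} [CommRing C] [Algebra R C] (x : Fin n → C) (a : stdRep R n) :
    confForm x a = ∑ i, a.1 i • x i := rfl

@[simp]
theorem confForm_diff {C : Type*} [CommRing C] [Algebra R C] (x : Fin n → C) (i j : Fin n) :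
    confForm x (diff R n i j) = x i - x j := by
  rw [confForm_apply]
  change ∑ l, ((Pi.single i (1 : R) - Pi.single j 1 : Fin n → R) l) • x l = _
  simp [sub_smul, Finset.sum_sub_distrib, Pi.single_apply]

/-- Translations do not change the linear form of a configuration. -/
theorem confForm_affine {C : Type*} [CommRing C] [Algebra R C] (x : Fin n → C) (b c : C) :
    confForm (R := R) (fun i => c * x i + b) = c • confForm x := by
  refine LinearMap.ext fun a => ?_
  have h : ∑ i, a.1 i • b = (0 : C) := by
    rw [← Finset.sum_smul, (a.2 : ∑ i, a.1 i = 0), zero_smul]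
  rw [LinearMap.smul_apply, confForm_apply, confForm_apply, Finset.smul_sum]
  simp_rw [smul_add]
  rw [Finset.sum_add_distrib, h, add_zero]
  exact Finset.sum_congr rfl fun i _ => (mul_smul_comm _ _ _).symm

theorem confForm_perm {C : Type*} [CommRing C] [Algebra R C] (x : Fin n → C)
    (σ : Equiv.Perm (Fin n)) (a : stdRep R n) :
    confForm (R := R) (fun i => x (σ i)) a = confForm x (stdPerm R n σ a) := by
  rw [confForm_apply, confForm_apply,
    ← Equiv.sum_comp σ fun i => (stdPerm R n σ a).1 i • x i]
  refine Finset.sum_congr rfl fun i _ => ?_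
  change _ = a.1 (σ⁻¹ (σ i)) • x (σ i)
  rw [show σ⁻¹ (σ i) = i from σ.symm_apply_apply i]

/-- A point of `Spec Sym(λ)[N⁻¹]`, as a homomorphism of algebras. -/
def evalPt {C : CommAlgCat.{u} R} (q : (confRingSpace R n).pts C) : ConfRing R n →ₐ[R] C := q

/-- A unit, as a point of `𝔾ₘ`. -/
def gm {C : CommAlgCat.{u} R} (μ : Cˣ) : (Gm R).obj C := μ

/-- A point of `𝔾ₘ`, as a unit. -/
def gmUnit {C : CommAlgCat.{u} R} (μ : (Gm R).obj C) : Cˣ := μ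

theorem gm_one {C : CommAlgCat.{u} R} : gm (1 : Cˣ) = 1 := rfl

theorem gmUnit_gm {C : CommAlgCat.{u} R} (μ : Cˣ) : gmUnit (gm μ) = μ := rfl

theorem isUnit_confForm_diff {C : CommAlgCat.{u} R} (x : (confSpace R n).pts C) (i j : Fin n)
    (h : i ≠ j) : IsUnit (confForm (R := R) x.1 (diff R n i j)) := by
  rw [confForm_diff]
  exact x.2 i j h

/-- The point of `Spec Sym(λ)[N⁻¹]` given by a configuration. -/
def confPoint {C : CommAlgCat.{u} R} (x : (confSpace R n).pts C) : (confRingSpace R n).pts C :=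
  confRingLift (confForm x.1) (isUnit_confForm_diff x)

theorem confPoint_gen {C : CommAlgCat.{u} R} (x : (confSpace R n).pts C) (a : stdRep R n) :
    evalPt (confPoint x) (gen R n (N R n) a) = confForm x.1 a :=
  confRingLift_gen _ (isUnit_confForm_diff x) _

theorem pts_ext {C : CommAlgCat.{u} R} {q q' : (confRingSpace R n).pts C}
    (h : ∀ a, evalPt q (gen R n (N R n) a) =
      evalPt q' (gen R n (N R n) a)) : q = q' :=
  symAway_ext h

theorem pts_smul_gen {C : CommAlgCat.{u} R} (μ : (Gm R).obj C) (q : (confRingSpace R n).pts C)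
    (a : stdRep R n) :
    evalPt (μ • q) (gen R n (N R n) a) =
      ((gmUnit μ : Cˣ) : C) * evalPt q (gen R n (N R n) a) :=
  confRingScale_gen _ _ _

theorem confPoint_map {C D : CommAlgCat.{u} R} (f : C ⟶ D) (x : (confSpace R n).pts C) :
    confPoint ((confSpace R n).map f x) = (confRingSpace R n).map f (confPoint x) :=
  pts_ext fun a => by
    rw [confPoint_gen]
    change _ = f.hom (evalPt (confPoint x) (gen R n (N R n) a))
    rw [confPoint_gen, confForm_apply, confForm_apply, map_sum]
    exact Finset.sum_congr rfl fun i _ => (map_smul f.hom _ _).symm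

theorem confPoint_smul {C : CommAlgCat.{u} R} (g : (Aff R).obj C) (x : (confSpace R n).pts C) :
    confPoint (g • x) = gm (linPart g) • confPoint x :=
  pts_ext fun a => by
    rw [confPoint_gen, pts_smul_gen, confPoint_gen]
    exact LinearMap.congr_fun (confForm_affine x.1 (constPart g) (linPart g : C)) a

theorem confPoint_relabel {C : CommAlgCat.{u} R} (σ : Equiv.Perm (Fin n))
    (x : (confSpace R n).pts C) :
    confPoint ((confRelabel R n σ).app C x) = (confRingRelabel R n σ).app C (confPoint x) :=
  pts_ext fun a => by
    rw [confPoint_gen]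
    change _ = evalPt (confPoint x) (confRingPerm R n σ (gen R n (N R n) a))
    rw [confRingPerm_gen, confPoint_gen]
    exact confForm_perm x.1 σ a

/-- A configuration is determined by one of its points and the differences. -/
theorem conf_ext {C : CommAlgCat.{u} R} (i₀ : Fin n) {x x' : (confSpace R n).pts C}
    (h₀ : x.1 i₀ = x'.1 i₀) (h : confPoint x = confPoint x') : x = x' := by
  refine Subtype.ext (funext fun i => ?_)
  have e := confPoint_gen x (diff R n i i₀)
  rw [h, confPoint_gen, confForm_diff, confForm_diff, h₀] at e
  exact (sub_left_inj.1 e).symm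

end Affine

/-! ### The quotient of a torsor by the translations -/

section Invariants

variable {R : Type u} [CommRing R] {n : ℕ} {A : CommAlgCat.{u} R}
  (P : QuotientStack.Fiber (confSpace R n) A)

open QuotientStack

/-- The `i`-th point of the configuration attached to a point of the torsor. -/
def coord (i : Fin n) {C : CommAlgCat.{u} R} (q : P.E ⟶ C) : C := (P.toX q).1 i

theorem coord_comp (i : Fin n) {C D : CommAlgCat.{u} R} (q : P.E ⟶ C) (f : C ⟶ D) :
    coord P i (q ≫ f) = f.hom (coord P i q) := by
  rw [coord, P.toX_comp]
  rfl

theorem coord_smul (i : Fin n) {C : CommAlgCat.{u} R} (g : (Aff R).obj C) (q : P.E ⟶ C) :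
    coord P i (g • q) = linPart g * coord P i q + constPart g := by
  rw [coord, P.toX_smul]
  rfl

/-- The coordinate ring of the quotient of the torsor by the translations: the functions that take
the same value at a point and at its translates. It depends on the action only, not on the map to
the space of configurations. -/
def invariants : Subalgebra R P.E where
  carrier := {s | ∀ (C : CommAlgCat.{u} R) (q : P.E ⟶ C) (b : C), (aff b 1 • q).hom s = q.hom s}
  mul_mem' hs ht C q b := by rw [map_mul, map_mul, hs, ht]
  add_mem' hs ht C q b := by rw [map_add, map_add, hs, ht]
  algebraMap_mem' r C q b := by rw [AlgHom.commutes, AlgHom.commutes]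

/-- The quotient of the torsor by the translations. -/
def quot : CommAlgCat.{u} R := CommAlgCat.of R (invariants P)

/-- The projection from the torsor to its quotient. -/
def incl : quot P ⟶ P.E := CommAlgCat.ofHom (invariants P).val

theorem incl_translate {C : CommAlgCat.{u} R} (q : P.E ⟶ C) (b : C) :
    incl P ≫ (aff b 1 • q) = incl P ≫ q :=
  CommAlgCat.hom_ext (AlgHom.ext fun s => s.2 C q b)

theorem incl_cancel {C : CommAlgCat.{u} R} {f g : C ⟶ quot P}
    (h : f ≫ incl P = g ≫ incl P) : f = g :=
  CommAlgCat.hom_ext (AlgHom.ext fun s => Subtype.ext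
    (DFunLike.congr_fun (congrArg CommAlgCat.Hom.hom h) s))

/-- The universal point of the torsor, translated so that its `i`-th coordinate vanishes. -/
def normalize (i : Fin n) : P.E ⟶ P.E := aff (-(coord P i (𝟙 P.E))) 1 • 𝟙 P.E

theorem normalize_comp (i : Fin n) {C : CommAlgCat.{u} R} (q : P.E ⟶ C) :
    normalize P i ≫ q = aff (-(coord P i q)) 1 • q := by
  rw [normalize, P.smul_comp, map_aff, map_neg, ← coord_comp, Category.id_comp, map_one]

theorem normalize_mem (i : Fin n) (s : P.E) : (normalize P i).hom s ∈ invariants P := by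
  intro C q b
  have h : normalize P i ≫ (aff b 1 • q) = normalize P i ≫ q := by
    rw [normalize_comp, normalize_comp, coord_smul, ← mul_smul, aff_mul]
    simp
  exact DFunLike.congr_fun (congrArg CommAlgCat.Hom.hom h) s

/-- The section of the projection to the quotient whose image is the vanishing locus of the `i`-th
coordinate. -/
def retr (i : Fin n) : P.E ⟶ quot P :=
  CommAlgCat.ofHom ((normalize P i).hom.codRestrict (invariants P) (normalize_mem P i))

theorem retr_incl (i : Fin n) : retr P i ≫ incl P = normalize P i := rfl

theorem incl_normalize (i : Fin n) : incl P ≫ normalize P i = incl P := by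
  rw [normalize, incl_translate, Category.comp_id]

theorem incl_retr (i : Fin n) : incl P ≫ retr P i = 𝟙 _ :=
  incl_cancel P (by rw [Category.assoc, retr_incl, incl_normalize, Category.id_comp])

theorem coord_retr (i : Fin n) : coord P i (retr P i) = 0 := by
  have h : (incl P).hom (coord P i (retr P i)) = (incl P).hom 0 := by
    rw [← coord_comp, retr_incl, normalize, coord_smul, map_zero]
    simp
  exact Subtype.ext h

/-- The torsor is the product of its quotient by the translations with the line: a point is given
by a point of the quotient and its `i`-th coordinate. -/
def liftPoint (i : Fin n) {C : CommAlgCat.{u} R} (q : quot P ⟶ C) (x : C) : P.E ⟶ C :=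
  aff x 1 • (retr P i ≫ q)

theorem incl_liftPoint (i : Fin n) {C : CommAlgCat.{u} R} (q : quot P ⟶ C) (x : C) :
    incl P ≫ liftPoint P i q x = q := by
  rw [liftPoint, incl_translate, ← Category.assoc, incl_retr, Category.id_comp]

theorem coord_liftPoint (i : Fin n) {C : CommAlgCat.{u} R} (q : quot P ⟶ C) (x : C) :
    coord P i (liftPoint P i q x) = x := by
  rw [liftPoint, coord_smul, coord_comp, coord_retr, map_zero, mul_zero, zero_add, constPart_aff]

theorem liftPoint_incl (i : Fin n) {C : CommAlgCat.{u} R} (q : P.E ⟶ C) :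
    liftPoint P i (incl P ≫ q) (coord P i q) = q := by
  rw [liftPoint, ← Category.assoc, retr_incl, normalize_comp, ← mul_smul, aff_mul]
  simp [aff_zero_one]

theorem point_ext (i : Fin n) {C : CommAlgCat.{u} R} {q q' : P.E ⟶ C}
    (h : incl P ≫ q = incl P ≫ q') (h' : coord P i q = coord P i q') : q = q' := by
  rw [← liftPoint_incl P i q, h, h', liftPoint_incl]

theorem liftPoint_comp (i : Fin n) {C D : CommAlgCat.{u} R} (q : quot P ⟶ C) (x : C) (f : C ⟶ D) :
    liftPoint P i q x ≫ f = liftPoint P i (q ≫ f) (f.hom x) :=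
  point_ext P i (by rw [incl_liftPoint, ← Category.assoc, incl_liftPoint])
    (by rw [coord_comp, coord_liftPoint, coord_liftPoint])

/-- The residual action of `𝔾ₘ` on the quotient by the translations. -/
def quotSMul (i : Fin n) {C : CommAlgCat.{u} R} (μ : Cˣ) (q : quot P ⟶ C) : quot P ⟶ C :=
  incl P ≫ (aff 0 μ • (retr P i ≫ q))

theorem incl_smul (i : Fin n) {C : CommAlgCat.{u} R} (g : (Aff R).obj C) (q : P.E ⟶ C) :
    incl P ≫ (g • q) = quotSMul P i (linPart g) (incl P ≫ q) := by
  have h : g • q = aff (constPart g + (linPart g : C) * coord P i q) 1 •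
      (aff 0 (linPart g) • (retr P i ≫ incl P ≫ q)) := by
    conv_lhs => rw [← liftPoint_incl P i q, ← aff_parts g]
    rw [liftPoint, ← mul_smul, ← mul_smul, aff_mul, aff_mul]
    simp
  rw [h, incl_translate, quotSMul]

theorem quotSMul_one (i : Fin n) {C : CommAlgCat.{u} R} (q : quot P ⟶ C) :
    quotSMul P i 1 q = q := by
  rw [quotSMul, aff_zero_one, one_smul, ← Category.assoc, incl_retr, Category.id_comp]

theorem quotSMul_mul (i : Fin n) {C : CommAlgCat.{u} R} (μ ν : Cˣ) (q : quot P ⟶ C) :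
    quotSMul P i (μ * ν) q = quotSMul P i μ (quotSMul P i ν q) := by
  have h : aff (0 : C) (μ * ν) = aff 0 μ * aff 0 ν := by rw [aff_mul]; simp
  rw [quotSMul, h, mul_smul, incl_smul P i, linPart_aff]
  rfl

/-- The `𝔾ₘ`-action on the quotient. -/
abbrev quotAction (i : Fin n) (C : CommAlgCat.{u} R) :
    MulAction ((Gm R).obj C) (quot P ⟶ C) where
  smul μ q := quotSMul P i (gmUnit μ) q
  one_smul q := quotSMul_one P i q
  mul_smul μ ν q := quotSMul_mul P i (gmUnit μ) (gmUnit ν) q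

/-- A retract of a faithfully flat algebra is faithfully flat. -/
theorem retract_faithfullyFlat {A B E : Type*} [CommRing A] [CommRing B] [CommRing E]
    (f : A →+* B) (i : B →+* E) (r : E →+* B) (hri : r.comp i = RingHom.id B)
    (h : (i.comp f).FaithfullyFlat) : f.FaithfullyFlat := by
  rw [RingHom.FaithfullyFlat.iff_flat_and_comap_surjective] at h ⊢
  constructor
  · let := f.toAlgebra
    let := (i.comp f).toAlgebra
    have hflat : Module.Flat A E := h.1
    exact Module.Flat.of_retract
      { toFun := i, map_add' := map_add i, map_smul' := fun a b => map_mul i (f a) b }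
      { toFun := r, map_add' := map_add r, map_smul' := fun a b =>
          (map_mul r (i (f a)) b).trans (congrArg (· * r b) (RingHom.congr_fun hri (f a))) }
      (LinearMap.ext fun b => RingHom.congr_fun hri b)
  · intro x
    obtain ⟨z, hz⟩ := h.2 x
    exact ⟨PrimeSpectrum.comap i z, hz⟩

theorem proj_retr_incl (i : Fin n) : (P.proj ≫ retr P i) ≫ incl P = P.proj := by
  rw [Category.assoc, retr_incl, normalize, P.proj_smul, Category.comp_id]

/-- The `𝔾ₘ`-torsor of a `𝔾ₐ ⋊ 𝔾ₘ`-torsor, with its map to `Spec Sym(λ)[N⁻¹]`. -/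
abbrev quotFiber (i : Fin n) : QuotientStack.Fiber (confRingSpace R n) A where
  E := quot P
  proj := P.proj ≫ retr P i
  faithfullyFlat := retract_faithfullyFlat _ (incl P).hom.toRingHom (retr P i).hom.toRingHom
    (congrArg (fun f => (CommAlgCat.Hom.hom f).toRingHom) (incl_retr P i)) (by
      have h := P.faithfullyFlat
      rw [← proj_retr_incl P i] at h
      exact h)
  act := quotAction P i
  smul_comp f μ q := by
    change quotSMul P i _ q ≫ f = quotSMul P i _ (q ≫ f)
    rw [quotSMul, Category.assoc, P.smul_comp, map_aff, map_zero, Category.assoc]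
    rfl
  proj_smul μ q := by
    change (P.proj ≫ retr P i) ≫ quotSMul P i _ q = _
    rw [quotSMul, ← Category.assoc, proj_retr_incl, P.proj_smul, Category.assoc]
  simplyTransitive {C} q q' h := by
    obtain ⟨g, hg, hu⟩ := P.simplyTransitive (retr P i ≫ q) (retr P i ≫ q')
      (by rw [← Category.assoc, h, Category.assoc])
    refine ⟨gm (linPart g), ?_, fun μ hμ => ?_⟩
    · change quotSMul P i (linPart g) q = q'
      have e := incl_smul P i g (retr P i ≫ q)
      rw [hg, ← Category.assoc, ← Category.assoc, incl_retr, Category.id_comp,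
        Category.id_comp] at e
      exact e.symm
    · have hμ' : quotSMul P i (gmUnit μ) q = q' := hμ
      have e : aff (0 : C) (gmUnit μ) • (retr P i ≫ q) = retr P i ≫ q' := by
        refine point_ext P i ?_ ?_
        · rw [← Category.assoc, incl_retr, Category.id_comp, ← hμ']
          rfl
        · rw [coord_smul, coord_comp, coord_comp, coord_retr]
          simp
      exact congrArg linPart (hu _ e)
  toX q := confPoint (P.toX (retr P i ≫ q))
  toX_comp q f := by rw [← Category.assoc, P.toX_comp, confPoint_map]
  toX_smul {C} μ q := by
    change confPoint (P.toX (retr P i ≫ quotSMul P i (gmUnit μ) q)) = _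
    rw [quotSMul, ← Category.assoc, retr_incl, normalize_comp, P.toX_smul, P.toX_smul,
      confPoint_smul, confPoint_smul, linPart_aff, linPart_aff]
    exact one_smul _ _

theorem quotFiber_toX_incl (i : Fin n) {C : CommAlgCat.{u} R} (q : P.E ⟶ C) :
    (quotFiber P i).toX (incl P ≫ q) = confPoint (P.toX q) := by
  change confPoint (P.toX (retr P i ≫ incl P ≫ q)) = _
  rw [← Category.assoc, retr_incl, normalize_comp, P.toX_smul, confPoint_smul, linPart_aff]
  exact one_smul _ _

end Invariants

/-! ### The equivalence of the quotient stacks -/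

section Global

open QuotientStack

variable {R : Type u} [CommRing R] {n : ℕ}

/-- A morphism over the identity of the base whose underlying map of torsors is invertible is an
isomorphism. -/
def isoOfFiberHom {G : CommAlgCat.{u} R ⥤ GrpCat.{u}} {X : GSpace G} {A : CommAlgCat.{u} R}
    {P P' : Fiber X A} (a : FiberHom (𝟙 A) P P') (b : P'.E ⟶ P.E) (hab : a.hom ≫ b = 𝟙 _)
    (hba : b ≫ a.hom = 𝟙 _) : (⟨A, P⟩ : QuotientStack X) ≅ ⟨A, P'⟩ where
  hom := ⟨𝟙 A, a⟩
  inv := ⟨𝟙 A,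
    { hom := b
      proj_hom := by
        have h := a.proj_hom
        rw [Category.id_comp] at h
        rw [← h, Category.assoc, hab, Category.id_comp, Category.comp_id]
      hom_smul := fun g q => by
        have h := a.hom_smul g (b ≫ q)
        rw [← Category.assoc, hab, Category.id_comp] at h
        rw [← h, ← Category.assoc, hba, Category.id_comp]
      toX_hom := fun q => by
        rw [← a.toX_hom, ← Category.assoc, hab, Category.id_comp] }⟩
  hom_inv_id := Hom.ext' (Category.comp_id _) hab
  inv_hom_id := Hom.ext' (Category.comp_id _) hba

section Morphisms

variable {A A' : CommAlgCat.{u} R} {f : A ⟶ A'} {P : Fiber (confSpace R n) A}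
  {P' : Fiber (confSpace R n) A'}

theorem FiberHom.coord_hom (a : FiberHom f P P') (i : Fin n) {C : CommAlgCat.{u} R}
    (q : P'.E ⟶ C) : coord P i (a.hom ≫ q) = coord P' i q := by
  rw [coord, a.toX_hom]
  rfl

theorem FiberHom.normalize_hom (a : FiberHom f P P') (i : Fin n) :
    normalize P i ≫ a.hom = a.hom ≫ normalize P' i := by
  rw [normalize_comp, normalize, a.hom_smul, Category.comp_id, ← FiberHom.coord_hom a,
    Category.comp_id]

/-- The map of the quotients by the translations induced by a morphism of torsors. -/
def quotHom (a : FiberHom f P P') (i : Fin n) : quot P ⟶ quot P' :=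
  incl P ≫ a.hom ≫ retr P' i

theorem quotHom_incl (a : FiberHom f P P') (i : Fin n) :
    quotHom a i ≫ incl P' = incl P ≫ a.hom := by
  rw [quotHom, Category.assoc, Category.assoc, retr_incl, ← FiberHom.normalize_hom,
    ← Category.assoc, incl_normalize]

/-- The morphism of `𝔾ₘ`-torsors induced by a morphism of `𝔾ₐ ⋊ 𝔾ₘ`-torsors. -/
def quotFiberHom (a : FiberHom f P P') (i : Fin n) :
    FiberHom f (quotFiber P i) (quotFiber P' i) where
  hom := quotHom a i
  proj_hom := by
    refine incl_cancel P' ?_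
    change ((P.proj ≫ retr P i) ≫ quotHom a i) ≫ incl P' = (f ≫ P'.proj ≫ retr P' i) ≫ incl P'
    rw [Category.assoc, quotHom_incl, ← Category.assoc, proj_retr_incl, a.proj_hom,
      Category.assoc, proj_retr_incl]
  hom_smul {C} μ q := by
    change quotHom a i ≫ quotSMul P' i (gmUnit μ) q = quotSMul P i (gmUnit μ) (quotHom a i ≫ q)
    rw [quotSMul, ← Category.assoc, quotHom_incl, Category.assoc, a.hom_smul, incl_smul P i,
      linPart_aff, ← Category.assoc, ← Category.assoc, ← quotHom_incl a i, Category.assoc,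
      Category.assoc, ← Category.assoc (incl P'), incl_retr, Category.id_comp]
  toX_hom q := by
    have h : quotHom a i ≫ q = incl P ≫ a.hom ≫ retr P' i ≫ q := by
      rw [quotHom, Category.assoc, Category.assoc]
    change (quotFiber P i).toX (quotHom a i ≫ q) = confPoint (P'.toX (retr P' i ≫ q))
    rw [h, quotFiber_toX_incl, a.toX_hom]

/-- Every morphism of the `𝔾ₘ`-torsors extends, with the same `i`-th coordinate. -/
def extendFiberHom (i : Fin n) (φ : FiberHom f (quotFiber P i) (quotFiber P' i)) :
    FiberHom f P P' where
  hom := liftPoint P i (φ.hom ≫ incl P') (coord P' i (𝟙 _))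
  proj_hom := by
    have h : (P.proj ≫ retr P i) ≫ φ.hom = f ≫ P'.proj ≫ retr P' i := φ.proj_hom
    rw [liftPoint, P.proj_smul, ← Category.assoc, ← Category.assoc, h, Category.assoc,
      proj_retr_incl]
  hom_smul {C} g q := by
    have hq : ∀ q : P'.E ⟶ C, liftPoint P i (φ.hom ≫ incl P') (coord P' i (𝟙 _)) ≫ q =
        liftPoint P i (φ.hom ≫ incl P' ≫ q) (coord P' i q) := fun q => by
      rw [liftPoint_comp, Category.assoc, ← coord_comp, Category.id_comp]
    have hφ : φ.hom ≫ quotSMul P' i (linPart g) (incl P' ≫ q) =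
        quotSMul P i (linPart g) (φ.hom ≫ incl P' ≫ q) :=
      φ.hom_smul (gm (linPart g)) (incl P' ≫ q)
    rw [hq, hq]
    refine point_ext P i ?_ ?_
    · rw [incl_liftPoint, incl_smul P i, incl_liftPoint, incl_smul P' i, hφ]
    · rw [coord_liftPoint, coord_smul, coord_smul, coord_liftPoint]
  toX_hom {C} q := by
    rw [liftPoint_comp, Category.assoc, ← coord_comp, Category.id_comp]
    refine conf_ext i (coord_liftPoint P i _ _) ?_
    rw [← quotFiber_toX_incl P i, incl_liftPoint, ← quotFiber_toX_incl P' i]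
    exact φ.toX_hom _

theorem quotHom_extendFiberHom (i : Fin n) (φ : FiberHom f (quotFiber P i) (quotFiber P' i)) :
    quotHom (extendFiberHom i φ) i = φ.hom :=
  incl_cancel P' ((quotHom_incl _ _).trans (incl_liftPoint P i _ _))

theorem quotHom_injective (i : Fin n) {a b : FiberHom f P P'} (h : quotHom a i = quotHom b i) :
    a.hom = b.hom := by
  refine point_ext P i ?_ ?_
  · rw [← quotHom_incl a i, h, quotHom_incl]
  · rw [← Category.comp_id a.hom, FiberHom.coord_hom, ← Category.comp_id b.hom,
      FiberHom.coord_hom]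

end Morphisms

/-! ### Torsors with a given quotient -/

section Extend

variable {A : CommAlgCat.{u} R} (Q : Fiber (confRingSpace R n) A)

/-- The product of a `𝔾ₘ`-torsor with the line. -/
def lineOver : CommAlgCat.{u} R := CommAlgCat.of R (Polynomial Q.E)

/-- The projection from the product with the line. -/
def lineProj : Q.E ⟶ lineOver Q := CommAlgCat.ofHom Polynomial.CAlgHom

/-- The point of the product with given components. -/
def linePoint {C : CommAlgCat.{u} R} (q : Q.E ⟶ C) (x : C) : lineOver Q ⟶ C :=
  CommAlgCat.ofHom (Polynomial.eval₂AlgHom q.hom x fun _ => Commute.all _ _)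

/-- The second component of a point of the product. -/
def lineCoord {C : CommAlgCat.{u} R} (q : lineOver Q ⟶ C) : C :=
  q.hom (Polynomial.X : Polynomial Q.E)

theorem lineProj_linePoint {C : CommAlgCat.{u} R} (q : Q.E ⟶ C) (x : C) :
    lineProj Q ≫ linePoint Q q x = q :=
  CommAlgCat.hom_ext (AlgHom.ext fun _ => Polynomial.eval₂_C q.hom.toRingHom x)

theorem lineCoord_linePoint {C : CommAlgCat.{u} R} (q : Q.E ⟶ C) (x : C) :
    lineCoord Q (linePoint Q q x) = x :=
  Polynomial.eval₂_X q.hom.toRingHom x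

theorem line_ext {C : CommAlgCat.{u} R} {q q' : lineOver Q ⟶ C}
    (h : lineProj Q ≫ q = lineProj Q ≫ q') (h' : lineCoord Q q = lineCoord Q q') : q = q' := by
  refine CommAlgCat.hom_ext (Polynomial.algHom_ext' ?_ h')
  exact congrArg CommAlgCat.Hom.hom h

theorem lineCoord_comp {C D : CommAlgCat.{u} R} (q : lineOver Q ⟶ C) (f : C ⟶ D) :
    lineCoord Q (q ≫ f) = f.hom (lineCoord Q q) := rfl

/-- The affine group acts through its linear part on the torsor and by affine transformations on
the line. -/
instance lineAction (C : CommAlgCat.{u} R) : MulAction ((Aff R).obj C) (lineOver Q ⟶ C) where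
  smul g q := linePoint Q (gm (linPart g) • (lineProj Q ≫ q))
    (linPart g * lineCoord Q q + constPart g)
  one_smul q := by
    refine line_ext Q ((lineProj_linePoint Q _ _).trans ?_) ((lineCoord_linePoint Q _ _).trans ?_)
    · exact one_smul _ _
    · change ((1 : Cˣ) : C) * lineCoord Q q + 0 = _
      simp
  mul_smul g h q := by
    refine line_ext Q ((lineProj_linePoint Q _ _).trans ?_) ((lineCoord_linePoint Q _ _).trans ?_)
    · refine (mul_smul (gm (linPart g)) (gm (linPart h)) _).trans ?_
      refine Eq.trans ?_ (lineProj_linePoint Q _ _).symm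
      exact congrArg (gm (linPart g) • ·) (lineProj_linePoint Q _ _).symm
    · refine Eq.trans ?_ (lineCoord_linePoint Q _ _).symm
      refine Eq.trans ?_ (congrArg (fun t => (linPart g : C) * t + constPart g)
        (lineCoord_linePoint Q _ _).symm)
      change ((linPart g * linPart h : Cˣ) : C) * lineCoord Q q +
        (constPart g + (linPart g : C) * constPart h) = _
      push_cast
      ring

/-- The configuration with `i`-th point `x` and differences given by a point of
`Spec Sym(λ)[N⁻¹]`. -/
def pointsFrom (i : Fin n) {C : CommAlgCat.{u} R} (q : (confRingSpace R n).pts C) (x : C) :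
    (confSpace R n).pts C :=
  ⟨fun j => x + evalPt q (gen R n (N R n) (diff R n j i)), fun j l h => by
    have e := congrArg (fun a => evalPt q (gen R n (N R n) a)) (diff_add_diff (R := R) j l i)
    simp only [map_add] at e
    have h' := (isUnit_gen_diff (R := R) j l h).map (evalPt q)
    have e' : (x + evalPt q (gen R n (N R n) (diff R n j i))) -
        (x + evalPt q (gen R n (N R n) (diff R n l i))) =
        evalPt q (gen R n (N R n) (diff R n j l)) := by
      rw [← e]
      ring
    exact e' ▸ h'⟩

theorem pointsFrom_apply_self (i : Fin n) {C : CommAlgCat.{u} R} (q : (confRingSpace R n).pts C)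
    (x : C) : (pointsFrom i q x).1 i = x := by
  change x + evalPt q (gen R n (N R n) (diff R n i i)) = x
  rw [diff_self, map_zero, map_zero, add_zero]

theorem sum_smul_diff (i : Fin n) (a : stdRep R n) : ∑ j, a.1 j • diff R n j i = a := by
  refine Subtype.ext (funext fun l => ?_)
  have h : ∑ j, a.1 j = 0 := a.2
  rw [AddSubmonoidClass.coe_finsetSum, Finset.sum_apply]
  change ∑ j, a.1 j * ((Pi.single j (1 : R) - Pi.single i 1 : Fin n → R) l) = a.1 l
  simp [mul_sub, Finset.sum_sub_distrib, h, Pi.single_apply]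

theorem confPoint_pointsFrom (i : Fin n) {C : CommAlgCat.{u} R} (q : (confRingSpace R n).pts C)
    (x : C) : confPoint (pointsFrom i q x) = q :=
  pts_ext fun a => by
    have h : ∀ b, confForm (pointsFrom i q x).1 b =
        (evalPt q).toLinearMap (gen R n (N R n) b) := by
      intro b
      rw [← sum_smul_diff i b, map_sum, map_sum, map_sum]
      refine Finset.sum_congr rfl fun j _ => ?_
      rw [map_smul, map_smul, map_smul, confForm_diff, pointsFrom_apply_self]
      exact congrArg _ (add_sub_cancel_left _ _)
    rw [confPoint_gen]
    exact h a

/-- The `𝔾ₐ ⋊ 𝔾ₘ`-torsor with a given quotient by the translations: the product with the line. -/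
abbrev extendFiber (i : Fin n) : Fiber (confSpace R n) A where
  E := lineOver Q
  proj := Q.proj ≫ lineProj Q
  faithfullyFlat := by
    have h : (lineProj Q).hom.toRingHom.FaithfullyFlat := by
      rw [RingHom.FaithfullyFlat.iff_flat_and_comap_surjective]
      refine ⟨?_, fun z => ⟨PrimeSpectrum.comap (linePoint Q (𝟙 _) 0).hom.toRingHom z, ?_⟩⟩
      · have h' : (algebraMap Q.E (Polynomial Q.E)).Flat := by
          rw [RingHom.flat_algebraMap_iff]
          infer_instance
        exact h'
      · rw [← PrimeSpectrum.comap_comp_apply]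
        have h' : (linePoint Q (𝟙 _) 0).hom.toRingHom.comp (lineProj Q).hom.toRingHom =
            RingHom.id _ :=
          congrArg (fun f => (CommAlgCat.Hom.hom f).toRingHom) (lineProj_linePoint Q (𝟙 _) 0)
        rw [h']
        rfl
    exact RingHom.FaithfullyFlat.stableUnderComposition _ _ Q.faithfullyFlat h
  act := lineAction Q
  smul_comp {C D} f g q := by
    refine line_ext Q ?_ ?_
    · refine Eq.trans ?_ (lineProj_linePoint Q _ _).symm
      refine (Category.assoc _ _ _).symm.trans ?_
      refine (congrArg (· ≫ f) (lineProj_linePoint Q _ _)).trans ?_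
      exact Q.smul_comp f (gm (linPart g)) _
    · refine Eq.trans ?_ (lineCoord_linePoint Q _ _).symm
      refine (congrArg f.hom (lineCoord_linePoint Q (gm (linPart g) • (lineProj Q ≫ q))
        (linPart g * lineCoord Q q + constPart g))).trans ?_
      rw [map_add, map_mul]
      rfl
  proj_smul {C} g q := by
    refine (Category.assoc _ _ _).trans ?_
    refine (congrArg (Q.proj ≫ ·) (lineProj_linePoint Q _ _)).trans ?_
    rw [Q.proj_smul, Category.assoc]
  simplyTransitive {C} q q' h := by
    rw [Category.assoc, Category.assoc] at h
    obtain ⟨μ, hμ, hu⟩ := Q.simplyTransitive _ _ h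
    refine ⟨aff (lineCoord Q q' - gmUnit μ * lineCoord Q q) (gmUnit μ), ?_, fun g hg => ?_⟩
    · refine line_ext Q ((lineProj_linePoint Q _ _).trans hμ)
        ((lineCoord_linePoint Q _ _).trans ?_)
      rw [linPart_aff, constPart_aff]
      ring
    · have h1 : linPart g = gmUnit μ := hu (gm (linPart g))
        ((lineProj_linePoint Q _ _).symm.trans (congrArg (lineProj Q ≫ ·) hg))
      have h2 : linPart g * lineCoord Q q + constPart g = lineCoord Q q' :=
        (lineCoord_linePoint Q _ _).symm.trans (congrArg (lineCoord Q) hg)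
      rw [← aff_parts g, h1, ← h2, h1]
      congr 1
      ring
  toX q := pointsFrom i (Q.toX (lineProj Q ≫ q)) (lineCoord Q q)
  toX_comp q f := by
    refine conf_ext i ?_ ?_
    · rw [pointsFrom_apply_self]
      refine Eq.trans ?_ (congrArg f.hom (pointsFrom_apply_self i _ _)).symm
      rfl
    · rw [confPoint_pointsFrom, confPoint_map, confPoint_pointsFrom, ← Category.assoc, Q.toX_comp]
  toX_smul {C} g q := by
    refine conf_ext i ?_ ?_
    · rw [pointsFrom_apply_self, conf_smul_apply, pointsFrom_apply_self]
      exact lineCoord_linePoint Q _ _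
    · rw [confPoint_pointsFrom, confPoint_smul, confPoint_pointsFrom, ← Q.toX_smul]
      exact congrArg Q.toX (lineProj_linePoint Q _ _)

theorem lineProj_smul (i : Fin n) {C : CommAlgCat.{u} R} (g : (Aff R).obj C)
    (q : (extendFiber Q i).E ⟶ C) :
    lineProj Q ≫ (g • q) = gm (linPart g) • (lineProj Q ≫ q) :=
  lineProj_linePoint Q _ _

theorem coord_extendFiber (i : Fin n) {C : CommAlgCat.{u} R} (q : (extendFiber Q i).E ⟶ C) :
    coord (extendFiber Q i) i q = lineCoord Q q :=
  pointsFrom_apply_self i _ _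

theorem normalize_extendFiber (i : Fin n) :
    normalize (extendFiber Q i) i = linePoint Q (𝟙 _) 0 ≫ lineProj Q := by
  refine line_ext Q ?_ ?_
  · rw [normalize, lineProj_smul, linPart_aff, gm_one, one_smul, ← Category.assoc,
      lineProj_linePoint, Category.id_comp]
    exact Category.comp_id _
  · have h := coord_smul (extendFiber Q i) i (aff (-(coord (extendFiber Q i) i (𝟙 _))) 1) (𝟙 _)
    rw [coord_extendFiber, constPart_aff, linPart_aff, Units.val_one, one_mul,
      add_neg_cancel] at h
    rw [lineCoord_comp, lineCoord_linePoint, map_zero]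
    exact h

/-- The given torsor is the quotient of the extended one. -/
def extendQuotHom (i : Fin n) : FiberHom (𝟙 A) Q (quotFiber (extendFiber Q i) i) where
  hom := lineProj Q ≫ retr (extendFiber Q i) i
  proj_hom := ((Category.id_comp _).trans (Category.assoc _ _ _)).symm
  hom_smul {C} μ q := by
    change (lineProj Q ≫ retr (extendFiber Q i) i) ≫
      quotSMul (extendFiber Q i) i (gmUnit μ) q = _
    rw [quotSMul, Category.assoc, ← Category.assoc (retr _ _), retr_incl, normalize_comp,
      lineProj_smul, lineProj_smul, linPart_aff, linPart_aff, gm_one, one_smul, Category.assoc]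
    rfl
  toX_hom {C} q := by
    change _ = confPoint (pointsFrom i (Q.toX (lineProj Q ≫ retr (extendFiber Q i) i ≫ q)) _)
    rw [confPoint_pointsFrom, Category.assoc]

theorem exists_iso_quotFiber (i : Fin n) :
    Nonempty ((⟨A, Q⟩ : QuotientStack (confRingSpace R n)) ≅
      ⟨A, quotFiber (extendFiber Q i) i⟩) := by
  refine ⟨isoOfFiberHom (extendQuotHom Q i)
    (incl (extendFiber Q i) ≫ linePoint Q (𝟙 _) 0) ?_ ?_⟩
  · change (lineProj Q ≫ retr (extendFiber Q i) i) ≫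
      incl (extendFiber Q i) ≫ linePoint Q (𝟙 _) 0 = 𝟙 _
    rw [Category.assoc, ← Category.assoc (retr _ _), retr_incl, normalize_extendFiber,
      Category.assoc, lineProj_linePoint, Category.comp_id, lineProj_linePoint]
  · change (incl (extendFiber Q i) ≫ linePoint Q (𝟙 _) 0) ≫
      lineProj Q ≫ retr (extendFiber Q i) i = 𝟙 _
    rw [Category.assoc, ← Category.assoc (linePoint _ _ _), ← normalize_extendFiber,
      ← retr_incl, Category.assoc, incl_retr, Category.comp_id, incl_retr]

end Extend

end Global

/-! ### Equivariance of the global equivalence -/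

section GlobalEquivalence

open QuotientStack

variable {R : Type u} [CommRing R] {n : ℕ}

/-- The `𝔾ₘ`-torsor attached to an object of the quotient stack. -/
abbrev quotObj (i : Fin n) (P : QuotientStack (confSpace R n)) :
    QuotientStack (confRingSpace R n) :=
  ⟨P.base, quotFiber P.fiber i⟩

/-- The morphism of `𝔾ₘ`-torsors attached to a morphism of the quotient stack. -/
def quotMap (i : Fin n) {P P' : QuotientStack (confSpace R n)} (a : QuotientStack.Hom P P') :
    QuotientStack.Hom (quotObj i P) (quotObj i P') :=
  ⟨a.base, quotFiberHom a.fiber i⟩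

theorem quotMap_injective (i : Fin n) {P P' : QuotientStack (confSpace R n)}
    {a b : QuotientStack.Hom P P'} (h : quotMap i a = quotMap i b) : a = b := by
  obtain ⟨f, a⟩ := a
  obtain ⟨f', b⟩ := b
  obtain rfl : f = f' := congrArg QuotientStack.Hom.base h
  exact Hom.ext' rfl (quotHom_injective i (congrArg (fun c => c.fiber.hom) h))

theorem quotMap_surjective (i : Fin n) {P P' : QuotientStack (confSpace R n)}
    (φ : QuotientStack.Hom (quotObj i P) (quotObj i P')) : ∃ a, quotMap i a = φ :=
  ⟨⟨φ.base, extendFiberHom i φ.fiber⟩, Hom.ext' rfl (quotHom_extendFiberHom i _)⟩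

/-- Division by the translations, as a functor between the quotient stacks. -/
def quotFunctor (R : Type u) [CommRing R] {n : ℕ} (i : Fin n) :
    BasedFunctor (quotientStack (confSpace R n)) (quotientStack (confRingSpace R n)) where
  obj := fun (P : QuotientStack (confSpace R n)) =>
    (quotObj i P : QuotientStack (confRingSpace R n))
  map := fun {P P' : QuotientStack (confSpace R n)} (a : QuotientStack.Hom P P') =>
    (quotMap i a : QuotientStack.Hom (quotObj i P) (quotObj i P'))
  map_id P := Hom.ext' rfl (by
    change incl P.fiber ≫ 𝟙 _ ≫ retr P.fiber i = 𝟙 _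
    rw [Category.id_comp, incl_retr])
  map_comp {P P' P''} a b := Hom.ext' rfl (by
    refine incl_cancel P''.fiber ?_
    change quotHom (a.fiber.comp b.fiber) i ≫ _ = (quotHom a.fiber i ≫ quotHom b.fiber i) ≫ _
    rw [quotHom_incl, Category.assoc, quotHom_incl, ← Category.assoc, quotHom_incl,
      Category.assoc]
    rfl)
  w := rfl

theorem quotFunctor_isEquivalence (i : Fin n) :
    (quotFunctor R i).toFunctor.IsEquivalence where
  faithful := ⟨fun h => quotMap_injective i h⟩
  full := ⟨fun φ => quotMap_surjective i φ⟩
  essSurj := ⟨fun Q => by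
    obtain ⟨e⟩ := exists_iso_quotFiber (QuotientStack.fiber Q) i
    exact ⟨⟨QuotientStack.base Q, extendFiber (QuotientStack.fiber Q) i⟩, ⟨e.symm⟩⟩⟩

/-- The residual action does not depend on the map to the space of configurations. -/
theorem quotSMul_push {A : CommAlgCat.{u} R} (P : Fiber (confSpace R n) A)
    (φ : (confSpace R n).End) (i : Fin n) {C : CommAlgCat.{u} R} (μ : Cˣ) (q : quot P ⟶ C) :
    quotSMul (P.push φ) i μ q = quotSMul P i μ q := by
  have h := incl_smul (P.push φ) i (aff 0 μ) (retr P i ≫ q)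
  have e : incl P ≫ retr P i ≫ q = q := by rw [← Category.assoc, incl_retr, Category.id_comp]
  refine Eq.trans ?_ h.symm
  exact congrArg (quotSMul (P.push φ) i μ) e.symm

/-- Relabelling commutes with division by the translations. -/
def relabelHom {A : CommAlgCat.{u} R} (P : Fiber (confSpace R n) A) (σ : Equiv.Perm (Fin n))
    (i : Fin n) : FiberHom (𝟙 A) (quotFiber (P.push (confRelabel R n σ)) i)
      ((quotFiber P i).push (confRingRelabel R n σ)) where
  hom := 𝟙 (quot P)
  proj_hom := by
    refine incl_cancel P ?_
    refine Eq.trans ?_ (congrArg (· ≫ incl P) (Category.id_comp (P.proj ≫ retr P i))).symm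
    rw [proj_retr_incl]
    refine Eq.trans ?_ (proj_retr_incl (P.push (confRelabel R n σ)) i)
    exact congrArg (· ≫ incl P) (Category.comp_id _)
  hom_smul {C} μ q := by
    refine (Category.id_comp _).trans ?_
    refine (quotSMul_push P (confRelabel R n σ) i (gmUnit μ) q).symm.trans ?_
    exact congrArg (quotSMul (P.push (confRelabel R n σ)) i (gmUnit μ)) (Category.id_comp q).symm
  toX_hom {C} q := by
    have h := quotFiber_toX_incl (P.push (confRelabel R n σ)) i (retr P i ≫ q)
    have e : ∀ q : quot P ⟶ C, incl P ≫ retr P i ≫ q = 𝟙 (quot P) ≫ q := fun q => by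
      rw [← Category.assoc, incl_retr]
    refine (congrArg (quotFiber (P.push (confRelabel R n σ)) i).toX (e q)).symm.trans (h.trans ?_)
    exact confPoint_relabel σ (P.toX (retr P i ≫ q))

/-- The transport along an equality of objects is a transport of the bases, expressed through an
intermediate object `A`. For `A` definitionally equal to both bases it is the identity. -/
theorem eqToHom_base {G : CommAlgCat.{u} R ⥤ GrpCat.{u}} {X : GSpace G} {P P' : QuotientStack X}
    (h : P = P') {A : CommAlgCat.{u} R} (e : P.base = A) (e' : P'.base = A) :
    QuotientStack.Hom.base (eqToHom h) = eqToHom e ≫ eqToHom e'.symm := by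
  cases h
  rw [eqToHom_trans]
  rfl

/-- The transport along an equality of objects is a transport of the torsors; see
`eqToHom_base`. -/
theorem eqToHom_fiber {G : CommAlgCat.{u} R ⥤ GrpCat.{u}} {X : GSpace G} {P P' : QuotientStack X}
    (h : P = P') {E : CommAlgCat.{u} R} (e : P.fiber.E = E) (e' : P'.fiber.E = E) :
    (QuotientStack.Hom.fiber (eqToHom h)).hom = eqToHom e ≫ eqToHom e'.symm := by
  cases h
  rw [eqToHom_trans]
  rfl

/-- Relabelling commutes with division by the translations, as an isomorphism of the quotient
stack. -/
def relabelIso (i : Fin n) (σ : Equiv.Perm (Fin n)) (P : QuotientStack (confSpace R n)) :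
    (⟨P.base, quotFiber (P.fiber.push (confRelabel R n σ)) i⟩ : QuotientStack (confRingSpace R n)) ≅
      ⟨P.base, (quotFiber P.fiber i).push (confRingRelabel R n σ)⟩ :=
  isoOfFiberHom (relabelHom P.fiber σ i) (𝟙 (quot P.fiber)) (Category.comp_id _)
    (Category.comp_id _)

/-- Division by the translations commutes with relabelling. -/
def quotFunctorComm (i : Fin n) (σ : Equiv.Perm (Fin n)) :
    BasedFunctor.comp ((confAct R n).act σ) (quotFunctor R i) ≅
      BasedFunctor.comp (quotFunctor R i) ((confRingAct R n).act σ) :=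
  BasedNatIso.mkNatIso
    (NatIso.ofComponents (fun P => relabelIso i σ P)
      (fun {P P'} a => Hom.ext' ((Category.comp_id _).trans (Category.id_comp _).symm) (by
        refine incl_cancel (QuotientStack.fiber P') ?_
        refine (congrArg (· ≫ incl (QuotientStack.fiber P')) (Category.comp_id _)).trans ?_
        refine Eq.trans ?_ (congrArg (· ≫ incl (QuotientStack.fiber P'))
          (Category.id_comp (quotHom (QuotientStack.Hom.fiber a) i))).symm
        refine Eq.trans ?_ (quotHom_incl (QuotientStack.Hom.fiber a) i).symm
        exact quotHom_incl ((QuotientStack.Hom.fiber a).push (confRelabel R n σ)) i)))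
    (fun P => IsHomLift.map (quotientStack (confRingSpace R n)).p (relabelIso i σ P).hom)

/-- Coherence of the relabelling isomorphisms: they are identities on the underlying torsors. -/
theorem relabelIso_mul (i : Fin n) (g h : Equiv.Perm (Fin n)) {A : CommAlgCat.{u} R}
    (P : Fiber (confSpace R n) A)
    (a : QuotientStack.Hom (quotObj i ⟨A, P.push (confRelabel R n (g * h))⟩)
      (quotObj i ⟨A, (P.push (confRelabel R n g)).push (confRelabel R n h)⟩))
    (d : QuotientStack.Hom
      (⟨A, ((quotFiber P i).push (confRingRelabel R n g)).push (confRingRelabel R n h)⟩ :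
        QuotientStack (confRingSpace R n))
      ⟨A, (quotFiber P i).push (confRingRelabel R n (g * h))⟩)
    (ha : a.base = 𝟙 A) (ha' : a.fiber.hom = 𝟙 (quot P)) (hd : d.base = 𝟙 A)
    (hd' : d.fiber.hom = 𝟙 (quot P)) :
    (relabelIso i (g * h) ⟨A, P⟩).hom =
      a ≫ (relabelIso i h ⟨A, P.push (confRelabel R n g)⟩).hom ≫
        (quotientStackMap (confRingRelabel R n h)).map (relabelIso i g ⟨A, P⟩).hom ≫ d := by
  refine Hom.ext' ?_ ?_
  · change 𝟙 A = a.base ≫ 𝟙 A ≫ 𝟙 A ≫ d.base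
    rw [ha, hd]
    simp only [Category.comp_id]
  · change 𝟙 (quot P) = a.fiber.hom ≫ 𝟙 (quot P) ≫ 𝟙 (quot P) ≫ d.fiber.hom
    have h1 : 𝟙 (quot P) ≫ 𝟙 (quot P) ≫ d.fiber.hom = 𝟙 (quot P) :=
      (Category.id_comp _).trans ((Category.id_comp _).trans hd')
    refine Eq.trans ?_ (congrArg (a.fiber.hom ≫ ·) h1).symm
    exact ((Category.comp_id _).trans ha').symm

theorem quotMap_eqToHom_base (i : Fin n) {P P' : QuotientStack (confSpace R n)}
    (h : P = P') {A : CommAlgCat.{u} R} (e : P.base = A) (e' : P'.base = A) :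
    (quotMap i (eqToHom h)).base = eqToHom e ≫ eqToHom e'.symm := by
  cases h
  rw [eqToHom_trans]
  rfl

theorem quotMap_eqToHom_fiber (i : Fin n) {P P' : QuotientStack (confSpace R n)}
    (h : P = P') {E : CommAlgCat.{u} R} (e : quot P.fiber = E) (e' : quot P'.fiber = E) :
    (quotMap i (eqToHom h)).fiber.hom = eqToHom e ≫ eqToHom e'.symm := by
  cases h
  rw [eqToHom_trans]
  exact (congrArg (incl P.fiber ≫ ·) (Category.id_comp _)).trans (incl_retr P.fiber i)

theorem quotFunctorComm_mul (i : Fin n) (g h : Equiv.Perm (Fin n))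
    (X : QuotientStack (confSpace R n))
    (e : (⟨X.base, X.fiber.push (confRelabel R n (g * h))⟩ : QuotientStack (confSpace R n)) =
      ⟨X.base, (X.fiber.push (confRelabel R n g)).push (confRelabel R n h)⟩)
    (e' : (⟨X.base, ((quotFiber X.fiber i).push (confRingRelabel R n g)).push
        (confRingRelabel R n h)⟩ : QuotientStack (confRingSpace R n)) =
      ⟨X.base, (quotFiber X.fiber i).push (confRingRelabel R n (g * h))⟩) :
    (relabelIso i (g * h) X).hom = quotMap i (eqToHom e) ≫
      (relabelIso i h ⟨X.base, X.fiber.push (confRelabel R n g)⟩).hom ≫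
        (quotientStackMap (confRingRelabel R n h)).map (relabelIso i g X).hom ≫ eqToHom e' :=
  relabelIso_mul i g h X.fiber _ _
    ((quotMap_eqToHom_base i e (A := X.base) rfl rfl).trans (Category.comp_id (𝟙 X.base)))
    ((quotMap_eqToHom_fiber i e (E := quot X.fiber) rfl rfl).trans
      (Category.comp_id (𝟙 (quot X.fiber))))
    ((eqToHom_base e' (A := X.base) rfl rfl).trans (Category.comp_id (𝟙 X.base)))
    ((eqToHom_fiber e' (E := quot X.fiber) rfl rfl).trans (Category.comp_id (𝟙 (quot X.fiber))))

theorem nonempty_globalEquivalence (hn : 1 ≤ n) :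
    Nonempty (EquivariantEquivalence (confAct R n) (confRingAct R n)) := by
  refine ⟨⟨quotFunctor R ⟨0, hn⟩, quotFunctor_isEquivalence _, quotFunctorComm _, ?_⟩⟩
  intro g h X
  exact quotFunctorComm_mul ⟨0, hn⟩ g h X _ _

end GlobalEquivalence

/-! ### Sections of the torsors -/

section Sections

open QuotientStack TensorProduct

variable {R : Type u} [CommRing R] {n : ℕ}

theorem affine_fix {C : Type*} [CommRing C] {a b s t : C} (h : IsUnit (s - t))
    (hs : a * s + b = s) (ht : a * t + b = t) : a = 1 ∧ b = 0 := by
  have ha : a = 1 := by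
    refine h.mul_right_cancel ?_
    linear_combination hs - ht
  subst ha
  exact ⟨rfl, by linear_combination hs⟩

/-- Affine transformations act freely on the configurations of at least two points. -/
theorem point_ext_of_toX {A : CommAlgCat.{u} R} (P : Fiber (confSpace R n) A) {i j : Fin n}
    (hij : i ≠ j) {C : CommAlgCat.{u} R} {q q' : P.E ⟶ C} (h : P.proj ≫ q = P.proj ≫ q')
    (hi : coord P i q = coord P i q') (hj : coord P j q = coord P j q') : q = q' := by
  obtain ⟨g, rfl, -⟩ := P.simplyTransitive q q' h
  rw [coord_smul] at hi hj
  obtain ⟨h1, h2⟩ := affine_fix ((P.toX q).2 i j hij) hi.symm hj.symm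
  have hg : g = 1 := by
    rw [← aff_parts g, h2, (Units.ext h1 : linPart g = 1)]
    rfl
  rw [hg, one_smul]

/-- Faithfully flat descent for homomorphisms: if `e` does not distinguish points over the same
point of the base, its image lies in the base. -/
theorem exists_factor_of_faithfullyFlat {A E : CommAlgCat.{u} R} (f : A ⟶ E)
    (hf : f.hom.toRingHom.FaithfullyFlat) {B : CommAlgCat.{u} R} (e : B ⟶ E)
    (he : ∀ {C : CommAlgCat.{u} R} (q q' : E ⟶ C), f ≫ q = f ≫ q' → e ≫ q = e ≫ q') :
    ∃ e₀ : B ⟶ A, e₀ ≫ f = e ∧ Function.Injective f.hom := by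
  let : Algebra A E := f.hom.toRingHom.toAlgebra
  have : IsScalarTower R A E := IsScalarTower.of_algebraMap_eq fun r => (f.hom.commutes r).symm
  have hff : Module.FaithfullyFlat A E := hf
  have hinj : Function.Injective f.hom := FaithfulSMul.algebraMap_injective A E
  have heff := (Algebra.IsEffective.of_faithfullyFlat (R := A)
    (S := E)).eqLocus_includeLeft_includeRight
  let q : E ⟶ CommAlgCat.of R (E ⊗[A] E) :=
    CommAlgCat.ofHom ((Algebra.TensorProduct.includeLeft (R := A) (S := A) (A := E)
      (B := E)).restrictScalars R)
  let q' : E ⟶ CommAlgCat.of R (E ⊗[A] E) :=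
    CommAlgCat.ofHom ((Algebra.TensorProduct.includeRight (R := A) (A := E)
      (B := E)).restrictScalars R)
  have hq : f ≫ q = f ≫ q' := CommAlgCat.hom_ext (AlgHom.ext fun a =>
    (Algebra.TensorProduct.algebraMap_apply' (R := A) (A := E) (B := E) a).symm ▸ rfl)
  have hr : ∀ b, e.hom b ∈ f.hom.range := by
    intro b
    have h : e.hom b ∈ Set.range (algebraMap A E) := by
      rw [← heff]
      exact DFunLike.congr_fun (congrArg CommAlgCat.Hom.hom (he q q' hq)) b
    exact h
  let φ := AlgEquiv.ofInjective f.hom hinj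
  refine ⟨CommAlgCat.ofHom ((φ.symm : _ →ₐ[R] A).comp (e.hom.codRestrict f.hom.range hr)),
    CommAlgCat.hom_ext (AlgHom.ext fun b => ?_), hinj⟩
  exact congrArg Subtype.val (φ.apply_symm_apply ⟨e.hom b, hr b⟩)

/-- A torsor with an equivariant map to the configurations of at least two points is trivial: the
points with two prescribed coordinates form a section. -/
theorem exists_section {A : CommAlgCat.{u} R} (P : Fiber (confSpace R n) A) {i j : Fin n}
    (hij : i ≠ j) : ∃ e : P.E ⟶ A, P.proj ≫ e = 𝟙 A := by
  obtain ⟨u, hu⟩ := (P.toX (𝟙 P.E)).2 j i hij.symm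
  let g : (Aff R).obj P.E := aff (-((u⁻¹ : (P.E)ˣ) : P.E) * coord P i (𝟙 _)) u⁻¹
  have hi : coord P i (g • 𝟙 P.E) = 0 := by
    rw [coord_smul, linPart_aff, constPart_aff]
    ring
  have hj : coord P j (g • 𝟙 P.E) = 1 := by
    rw [coord_smul, linPart_aff, constPart_aff]
    have h : (u : P.E) = coord P j (𝟙 _) - coord P i (𝟙 _) := hu
    have h1 := u.inv_mul
    rw [h] at h1
    linear_combination h1
  obtain ⟨e₀, he₀, hinj⟩ := exists_factor_of_faithfullyFlat P.proj P.faithfullyFlat (g • 𝟙 P.E)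
    (fun q q' h => by
      refine point_ext_of_toX P hij ?_ ?_ ?_
      · rw [← Category.assoc, ← Category.assoc, P.proj_smul, Category.comp_id, h]
      · rw [coord_comp, coord_comp, hi, map_zero, map_zero]
      · rw [coord_comp, coord_comp, hj, map_one, map_one])
  refine ⟨e₀, CommAlgCat.hom_ext (AlgHom.ext fun a => hinj ?_)⟩
  have h : (P.proj ≫ e₀) ≫ P.proj = 𝟙 A ≫ P.proj := by
    rw [Category.assoc, he₀, P.proj_smul, Category.comp_id, Category.id_comp]
  exact DFunLike.congr_fun (congrArg CommAlgCat.Hom.hom h) a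

section Transition

variable {A A' A'' : CommAlgCat.{u} R} {f : A ⟶ A'} {f' : A' ⟶ A''}
  {P : Fiber (confSpace R n) A} {P' : Fiber (confSpace R n) A'} {P'' : Fiber (confSpace R n) A''}

theorem exists_transition (a : FiberHom f P P') {e : P.E ⟶ A} (he : P.proj ≫ e = 𝟙 A)
    {e' : P'.E ⟶ A'} (he' : P'.proj ≫ e' = 𝟙 A') :
    ∃! g : (Aff R).obj A', g • (e ≫ f) = a.hom ≫ e' :=
  P.simplyTransitive _ _ (by
    rw [← Category.assoc, he, Category.id_comp, ← Category.assoc, a.proj_hom, Category.assoc, he',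
      Category.comp_id])

/-- The affine transformation that describes a morphism of torsors with chosen sections. -/
def transition (a : FiberHom f P P') {e : P.E ⟶ A} (he : P.proj ≫ e = 𝟙 A)
    {e' : P'.E ⟶ A'} (he' : P'.proj ≫ e' = 𝟙 A') : (Aff R).obj A' :=
  (exists_transition a he he').choose

theorem transition_smul (a : FiberHom f P P') {e : P.E ⟶ A} (he : P.proj ≫ e = 𝟙 A)
    {e' : P'.E ⟶ A'} (he' : P'.proj ≫ e' = 𝟙 A') :
    transition a he he' • (e ≫ f) = a.hom ≫ e' :=
  (exists_transition a he he').choose_spec.1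

theorem eq_transition (a : FiberHom f P P') {e : P.E ⟶ A} (he : P.proj ≫ e = 𝟙 A)
    {e' : P'.E ⟶ A'} (he' : P'.proj ≫ e' = 𝟙 A') {g : (Aff R).obj A'}
    (hg : g • (e ≫ f) = a.hom ≫ e') : transition a he he' = g :=
  ((exists_transition a he he').choose_spec.2 g hg).symm

theorem transition_id {e : P.E ⟶ A} (he : P.proj ≫ e = 𝟙 A) :
    transition (FiberHom.id P) he he = 1 :=
  eq_transition _ he he (by
    rw [one_smul, Category.comp_id]
    exact (Category.id_comp e).symm)

theorem transition_comp (a : FiberHom f P P') (b : FiberHom f' P' P'') {e : P.E ⟶ A}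
    (he : P.proj ≫ e = 𝟙 A) {e' : P'.E ⟶ A'} (he' : P'.proj ≫ e' = 𝟙 A') {e'' : P''.E ⟶ A''}
    (he'' : P''.proj ≫ e'' = 𝟙 A'') :
    transition (a.comp b) he he'' =
      transition b he' he'' * (Aff R).map f' (transition a he he') :=
  eq_transition _ he he'' (by
    rw [mul_smul, ← Category.assoc, ← P.smul_comp, transition_smul, Category.assoc, ← a.hom_smul,
      transition_smul, ← Category.assoc]
    rfl)

theorem toX_transition (a : FiberHom f P P') {e : P.E ⟶ A} (he : P.proj ≫ e = 𝟙 A)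
    {e' : P'.E ⟶ A'} (he' : P'.proj ≫ e' = 𝟙 A') :
    P'.toX e' = transition a he he' • (confSpace R n).map f (P.toX e) := by
  rw [← a.toX_hom, ← transition_smul a he he', P.toX_smul, P.toX_comp]

/-- A morphism is determined by the linear part of its transition: the translation part is read off
from the configurations. -/
theorem hom_eq_of_linPart_eq (i : Fin n) {a b : FiberHom f P P'} {e : P.E ⟶ A}
    (he : P.proj ≫ e = 𝟙 A) {e' : P'.E ⟶ A'} (he' : P'.proj ≫ e' = 𝟙 A')
    (h : linPart (transition a he he') = linPart (transition b he he')) : a.hom = b.hom := by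
  have hc : constPart (transition a he he') = constPart (transition b he he') := by
    have h1 : coord P i (transition a he he' • (e ≫ f)) =
        coord P i (transition b he he' • (e ≫ f)) := by
      rw [transition_smul, transition_smul, FiberHom.coord_hom, FiberHom.coord_hom]
    rw [coord_smul, coord_smul, h] at h1
    exact add_left_cancel h1
  have hab : transition a he he' = transition b he he' := by
    rw [← aff_parts (transition a he he'), h, hc, aff_parts]
  have hs : a.hom ≫ e' = b.hom ≫ e' := by
    rw [← transition_smul a he he', hab, transition_smul]
  obtain ⟨g, hg, -⟩ := P'.simplyTransitive (e' ≫ P'.proj) (𝟙 _) (by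
    rw [← Category.assoc, he', Category.id_comp, Category.comp_id])
  rw [← Category.comp_id a.hom, ← Category.comp_id b.hom, ← hg, a.hom_smul, b.hom_smul,
    ← Category.assoc, hs, Category.assoc]

/-- A scaling of the linear forms of the configurations at chosen sections comes from a morphism of
torsors. -/
theorem exists_hom_of_scale (i : Fin n) {e : P.E ⟶ A} (he : P.proj ≫ e = 𝟙 A)
    {e' : P'.E ⟶ A'} (he' : P'.proj ≫ e' = 𝟙 A') (μ : A'ˣ)
    (h : confPoint (P'.toX e') = gm μ • (confRingSpace R n).map f (confPoint (P.toX e))) :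
    ∃ a : FiberHom f P P', linPart (transition a he he') = μ := by
  obtain ⟨G, hG, -⟩ := P'.simplyTransitive (e' ≫ P'.proj) (𝟙 _) (by
    rw [← Category.assoc, he', Category.id_comp, Category.comp_id])
  let g₀ : (Aff R).obj A' := aff (coord P' i e' - μ * coord P i (e ≫ f)) μ
  let w : P.E ⟶ A' := g₀ • (e ≫ f)
  have hw : P.proj ≫ w = f := by
    rw [P.proj_smul, ← Category.assoc, he, Category.id_comp]
  have hX : P.toX w = P'.toX e' := by
    refine conf_ext i ?_ ?_
    · refine (coord_smul P i g₀ (e ≫ f)).trans ?_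
      rw [linPart_aff, constPart_aff, add_sub_cancel]
      rfl
    · rw [h, ← confPoint_map, ← P.toX_comp, P.toX_smul, confPoint_smul]
      rfl
  -- A point `q` of the second torsor is a translate of the section; `hom` sends it to the same
  -- translate of `w`.
  have key : ∀ {C : CommAlgCat.{u} R} (q : P'.E ⟶ C) (g : (Aff R).obj C),
      g • (e' ≫ P'.proj ≫ q) = q → (G • (w ≫ P'.proj)) ≫ q = g • (w ≫ P'.proj ≫ q) := by
    intro C q g hg
    obtain ⟨g', -, hu⟩ := P'.simplyTransitive (e' ≫ P'.proj ≫ q) q (by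
      rw [← Category.assoc, he', Category.id_comp])
    have h1 : (Aff R).map q G • (e' ≫ P'.proj ≫ q) = q := by
      rw [← Category.assoc, ← P'.smul_comp, hG, Category.id_comp]
    rw [P.smul_comp, Category.assoc, hu _ h1, ← hu _ hg]
  have hex : ∀ {C : CommAlgCat.{u} R} (q : P'.E ⟶ C), ∃ g : (Aff R).obj C,
      g • (e' ≫ P'.proj ≫ q) = q := fun q => ⟨(Aff R).map q G, by
    rw [← Category.assoc, ← P'.smul_comp, hG, Category.id_comp]⟩
  let a : FiberHom f P P' :=
    { hom := G • (w ≫ P'.proj)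
      proj_hom := by rw [P.proj_smul, ← Category.assoc, hw]
      hom_smul := fun {C} g q => by
        obtain ⟨g', hg'⟩ := hex q
        rw [key q g' hg', key (g • q) (g * g') (by rw [P'.proj_smul, mul_smul, hg']),
          P'.proj_smul, mul_smul]
      toX_hom := fun {C} q => by
        obtain ⟨g', hg'⟩ := hex q
        rw [key q g' hg', P.toX_smul, P.toX_comp, hX, ← P'.toX_comp, ← P'.toX_smul, hg'] }
  refine ⟨a, ?_⟩
  have ha : transition a he he' = g₀ := eq_transition a he he' (by
    refine Eq.trans ?_ (key e' 1 ?_).symm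
    · rw [one_smul, he', Category.comp_id]
    · rw [one_smul, he', Category.comp_id])
  rw [ha]
  rfl

end Transition

end Sections

/-! ### The trivial torsor -/

section Trivial

open QuotientStack LaurentPolynomial

variable {R : Type u} [CommRing R] (A : CommAlgCat.{u} R)

/-- The coordinate ring of the trivial `𝔾ₘ`-torsor over `Spec A`. -/
def torus : CommAlgCat.{u} R := CommAlgCat.of R (LaurentPolynomial A)

/-- The structure map of the trivial torsor. -/
def torusProj : A ⟶ torus A :=
  CommAlgCat.ofHom (IsScalarTower.toAlgHom R A (LaurentPolynomial A))

variable {A}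

/-- The point of the trivial torsor with given components. -/
def torusPoint {C : CommAlgCat.{u} R} (α : A ⟶ C) (μ : Cˣ) : torus A ⟶ C :=
  CommAlgCat.ofHom
    { eval₂ α.hom.toRingHom μ with
      commutes' := fun r => by
        change eval₂ α.hom.toRingHom μ (algebraMap R (LaurentPolynomial A) r) = algebraMap R C r
        rw [LaurentPolynomial.algebraMap_apply]
        refine (eval₂_C _ _ _).trans ?_
        exact α.hom.commutes r }

/-- The coordinate of the torus. -/
def torusCoord (A : CommAlgCat.{u} R) : (torus A)ˣ := (isUnit_T 1 : IsUnit (T 1 : A[T;T⁻¹])).unit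

/-- The second component of a point of the trivial torsor. -/
def torusUnit {C : CommAlgCat.{u} R} (q : torus A ⟶ C) : Cˣ :=
  Units.map (q.hom : torus A →* C) (torusCoord A)

theorem torusProj_torusPoint {C : CommAlgCat.{u} R} (α : A ⟶ C) (μ : Cˣ) :
    torusProj A ≫ torusPoint α μ = α :=
  CommAlgCat.hom_ext (AlgHom.ext fun a => eval₂_C α.hom.toRingHom μ a)

theorem torusUnit_torusPoint {C : CommAlgCat.{u} R} (α : A ⟶ C) (μ : Cˣ) :
    torusUnit (torusPoint α μ) = μ :=
  Units.ext ((eval₂_T α.hom.toRingHom μ 1).trans (congrArg Units.val (zpow_one μ)))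

theorem torusUnit_comp {C D : CommAlgCat.{u} R} (q : torus A ⟶ C) (f : C ⟶ D) :
    torusUnit (q ≫ f) = Units.map (f.hom : C →* D) (torusUnit q) := Units.ext rfl

theorem torus_ext {C : CommAlgCat.{u} R} {q q' : torus A ⟶ C}
    (h : torusProj A ≫ q = torusProj A ≫ q') (h' : torusUnit q = torusUnit q') : q = q' := by
  refine CommAlgCat.hom_ext (AlgHom.ext fun s => ?_)
  have hC : ∀ a : A, q.hom (LaurentPolynomial.C a) = q'.hom (LaurentPolynomial.C a) := fun a =>
    DFunLike.congr_fun (congrArg CommAlgCat.Hom.hom h) a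
  have hT : ∀ k : ℤ, q.hom (T k) = q'.hom (T k) := by
    intro k
    have e := congrArg (fun v : Cˣ => ((v ^ k : Cˣ) : C)) h'
    have e' : ∀ q : torus A ⟶ C, ((torusUnit q ^ k : Cˣ) : C) = q.hom (T k) := fun q => by
      rw [torusUnit, ← map_zpow]
      exact congrArg (fun v : A[T;T⁻¹]ˣ => q.hom (v : A[T;T⁻¹])) (laurent_unit_zpow k)
    rw [← e', ← e']
    exact e
  induction s using LaurentPolynomial.induction_on' with
  | add s t hs ht =>
    exact (map_add q.hom s t).trans ((congrArg₂ _ hs ht).trans (map_add q'.hom s t).symm)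
  | C_mul_T k a =>
    exact (map_mul q.hom _ _).trans ((congrArg₂ _ (hC a) (hT k)).trans (map_mul q'.hom _ _).symm)

theorem torusProj_faithfullyFlat (A : CommAlgCat.{u} R) :
    (torusProj A).hom.toRingHom.FaithfullyFlat := by
  rw [RingHom.FaithfullyFlat.iff_flat_and_comap_surjective]
  refine ⟨?_, fun z => ⟨PrimeSpectrum.comap (torusPoint (𝟙 A) 1).hom.toRingHom z, ?_⟩⟩
  · have h1 : (algebraMap A (Polynomial A)).Flat := by
      rw [RingHom.flat_algebraMap_iff]
      infer_instance
    have h2 : (algebraMap (Polynomial A) (LaurentPolynomial A)).Flat := by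
      rw [RingHom.flat_algebraMap_iff]
      exact IsLocalization.flat _ (Submonoid.powers (Polynomial.X : Polynomial A))
    have h3 := h1.comp h2
    have e : (algebraMap (Polynomial A) (LaurentPolynomial A)).comp (algebraMap A (Polynomial A)) =
        (torusProj A).hom.toRingHom := RingHom.ext fun a => Polynomial.toLaurent_C a
    rwa [e] at h3
  · rw [← PrimeSpectrum.comap_comp_apply]
    have h' : (torusPoint (𝟙 A) 1).hom.toRingHom.comp (torusProj A).hom.toRingHom =
        RingHom.id _ :=
      congrArg (fun f => (CommAlgCat.Hom.hom f).toRingHom) (torusProj_torusPoint (𝟙 A) 1)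
    rw [h']
    rfl

/-- `𝔾ₘ` acts on the second component of the trivial torsor. -/
instance torusAction (C : CommAlgCat.{u} R) : MulAction ((Gm R).obj C) (torus A ⟶ C) where
  smul μ q := torusPoint (torusProj A ≫ q) (gmUnit μ * torusUnit q)
  one_smul q := torus_ext (torusProj_torusPoint _ _)
    ((torusUnit_torusPoint _ _).trans (one_mul _))
  mul_smul μ ν q := by
    refine torus_ext ((torusProj_torusPoint _ _).trans ?_) ((torusUnit_torusPoint _ _).trans ?_)
    · refine Eq.trans ?_ (torusProj_torusPoint _ _).symm
      exact (torusProj_torusPoint _ _).symm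
    · refine Eq.trans ?_ (torusUnit_torusPoint _ _).symm
      refine Eq.trans ?_ (congrArg (gmUnit μ * ·) (torusUnit_torusPoint _ _).symm)
      exact mul_assoc (gmUnit μ) (gmUnit ν) (torusUnit q)

theorem torusProj_smul {C : CommAlgCat.{u} R} (μ : (Gm R).obj C) (q : torus A ⟶ C) :
    torusProj A ≫ (μ • q) = torusProj A ≫ q := torusProj_torusPoint _ _

theorem torusUnit_smul {C : CommAlgCat.{u} R} (μ : (Gm R).obj C) (q : torus A ⟶ C) :
    torusUnit (μ • q) = gmUnit μ * torusUnit q := torusUnit_torusPoint _ _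

/-- The trivial `𝔾ₘ`-torsor, with the equivariant map to a `𝔾ₘ`-space that sends the unit section to
a given point. -/
abbrev trivialFiber {X : GSpace (Gm R)} (x : X.pts A) : Fiber X A where
  E := torus A
  proj := torusProj A
  faithfullyFlat := torusProj_faithfullyFlat A
  act := torusAction
  smul_comp f μ q := by
    refine torus_ext ?_ ?_
    · rw [← Category.assoc, torusProj_smul, torusProj_smul, Category.assoc]
    · rw [torusUnit_comp, torusUnit_smul, torusUnit_smul, torusUnit_comp, map_mul]
      rfl
  proj_smul μ q := torusProj_smul μ q
  simplyTransitive {C} q q' h := by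
    refine ⟨gm (torusUnit q' * (torusUnit q)⁻¹), torus_ext ?_ ?_, fun μ hμ => ?_⟩
    · rw [torusProj_smul, h]
    · rw [torusUnit_smul, gmUnit_gm, inv_mul_cancel_right]
    · rw [← hμ, torusUnit_smul, mul_inv_cancel_right]
      rfl
  toX q := gm (torusUnit q) • X.map (torusProj A ≫ q) x
  toX_comp q f := by
    rw [X.map_smul, ← X.map_comp, Category.assoc, torusUnit_comp]
    rfl
  toX_smul μ q := by
    rw [torusUnit_smul, torusProj_smul, ← mul_smul]
    rfl

/-- Every point of `Spec Sym(λ)[N⁻¹]` is the class of an object of the quotient stack with a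
section. -/
theorem exists_fiber_confPoint_eq {n : ℕ} (i : Fin n) (x : (confRingSpace R n).pts A) :
    ∃ (P : Fiber (confSpace R n) A) (e : P.E ⟶ A), P.proj ≫ e = 𝟙 A ∧ confPoint (P.toX e) = x := by
  refine ⟨extendFiber (trivialFiber x) i, linePoint (trivialFiber x) (torusPoint (𝟙 A) 1) 0, ?_, ?_⟩
  · rw [Category.assoc, lineProj_linePoint]
    exact torusProj_torusPoint _ _
  · rw [confPoint_pointsFrom, lineProj_linePoint]
    change gm (torusUnit (torusPoint (𝟙 A) 1)) •
      (confRingSpace R n).map (torusProj A ≫ torusPoint (𝟙 A) 1) x = x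
    rw [torusUnit_torusPoint, torusProj_torusPoint, gm_one, one_smul]
    exact (confRingSpace R n).map_id x

end Trivial

/-! ### Reduction to the residue field -/

section Residue

open QuotientStack

variable {p : ℕ} [Fact p.Prime] {k : Type u} [Field k]

instance : IsDomain (residueField p k) := inferInstanceAs (IsDomain k)

/-- The map to the residue field is automatically local: its kernel is the maximal ideal, because
`W(k)` already surjects onto `k`. -/
theorem mem_maximalIdeal_iff (A : CompleteLocal p k) (x : A.ring) :
    x ∈ IsLocalRing.maximalIdeal A.ring ↔ A.res.hom x = 0 := by
  constructor
  · intro hx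
    by_contra h
    let r : k := A.res.hom x
    obtain ⟨v, hv⟩ : ∃ v : k, r * v = 1 := ⟨r⁻¹, mul_inv_cancel₀ h⟩
    -- an element of `W(k)` that lifts the inverse of the residue of `x`
    let w : WittVector p k := WittVector.mk p fun _ => v
    have hw : A.res.hom (algebraMap _ A.ring w) = v := (A.res.hom.commutes w).trans rfl
    have hu : IsUnit (1 - x * algebraMap _ A.ring w) :=
      IsLocalRing.isUnit_one_sub_self_of_mem_nonunits _
        ((IsLocalRing.mem_maximalIdeal _).1 (Ideal.mul_mem_right _ _ hx))
    have h0 : A.res.hom (1 - x * algebraMap _ A.ring w) = 0 := by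
      rw [map_sub, map_one, map_mul, hw]
      exact sub_eq_zero.2 hv.symm
    exact not_isUnit_zero (M₀ := residueField p k) (h0 ▸ hu.map A.res.hom)
  · intro hx hu
    exact not_isUnit_zero (M₀ := residueField p k) (hx ▸ IsUnit.map A.res.hom hu)

theorem natCast_residueField [CharP k p] : ((p : ℕ) : residueField p k) = 0 :=
  CharP.cast_eq_zero k p

section Points

variable {C : Type*} [CommRing C] [Algebra (WittVector p k) C]

theorem confRingPerm_inv_apply (γ : Equiv.Perm (Fin p)) (s : ConfRing (WittVector p k) p) :
    confRingPerm (WittVector p k) p γ (confRingPerm (WittVector p k) p γ⁻¹ s) = s := by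
  rw [← AlgHom.comp_apply, ← confRingPerm_mul, mul_inv_cancel, confRingPerm_one]
  rfl

/-- A point of `Spec Sym(λ)[N⁻¹]` that kills a translate of `I` comes from the translate of the
configuration `𝔽_p`, up to a homothety. -/
theorem exists_unit_of_primeIdeal_le (q : ConfRing (WittVector p k) p →ₐ[WittVector p k] C)
    (γ : Equiv.Perm (Fin p))
    (h : ∀ s, confRingPerm (WittVector p k) p γ s ∈ primeIdeal k (N (WittVector p k) p) →
      q s = 0) :
    ∃ c : Cˣ, ∀ i j, q (gen _ p _ (diff _ p i j)) =
      c * (((γ i : ℕ) : C) - ((γ j : ℕ) : C)) := by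
  let q₀ := q.comp (confRingPerm (WittVector p k) p γ⁻¹)
  have h₀ : ∀ s ∈ primeIdeal k (N (WittVector p k) p), q₀ s = 0 := fun s hs =>
    h _ ((confRingPerm_inv_apply γ s).symm ▸ hs)
  let l : stdRep (WittVector p k) p →ₗ[WittVector p k] C := q₀.toLinearMap ∘ₗ gen _ p _
  have hy : ∀ i, l (y _ p i) = l (y _ p (zeroIdx p)) := fun i => by
    have e := h₀ _ (Ideal.subset_span (Or.inr ⟨i, zeroIdx p, rfl⟩))
    rw [map_sub] at e
    exact sub_eq_zero.1 e
  have hne : zeroIdx p ≠ finRotate p (zeroIdx p) := by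
    have hp := (Fact.out : p.Prime).two_le
    obtain ⟨m, rfl⟩ : ∃ m, p = m + 2 := ⟨p - 2, by omega⟩
    intro e
    have e' := congrArg Fin.val e
    rw [finRotate_of_lt (by omega)] at e'
    simp at e'
  obtain ⟨c, hc⟩ := (isUnit_gen_diff (R := WittVector p k) _ _ hne).map q₀
  refine ⟨-c, fun i j => ?_⟩
  have e := map_diff_of_map_y l _ hy (γ i) (γ j)
  have e' : l (diff _ p (γ i) (γ j)) = q (gen _ p _ (diff _ p i j)) := by
    change q (confRingPerm (WittVector p k) p γ⁻¹ (gen _ p _ _)) = _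
    have hγ : ∀ i, γ⁻¹ (γ i) = i := γ.symm_apply_apply
    rw [confRingPerm_gen, stdPerm_diff, hγ, hγ]
  have hc' : l (y _ p (zeroIdx p)) = c := hc.symm
  rw [← e', e, hc', Units.val_neg]
  ring

/-- The points given by the translates of the configuration `𝔽_p` kill the intersection of the
translates of `I`. -/
theorem map_translatesIdeal_eq_zero (hp : (p : C) = 0)
    (q : ConfRing (WittVector p k) p →ₐ[WittVector p k] C)
    (Γ : Subgroup (Equiv.Perm (Fin p))) {γ : Equiv.Perm (Fin p)} (hγ : γ ∈ Γ) (c : C)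
    (h : ∀ i j, q (gen _ p _ (diff _ p i j)) = c * (((γ i : ℕ) : C) - ((γ j : ℕ) : C)))
    {s : ConfRing (WittVector p k) p} (hs : s ∈ translatesIdeal k Γ) : q s = 0 := by
  let q₀ := q.comp (confRingPerm (WittVector p k) p γ⁻¹)
  have hy : ∀ i, q₀ (gen _ p _ (y _ p i)) = -c := fun i => by
    change q (confRingPerm (WittVector p k) p γ⁻¹ (gen _ p _ _)) = _
    have hγ' : ∀ i, γ (γ⁻¹ i) = i := γ.apply_symm_apply
    rw [confRingPerm_gen, y, stdPerm_diff, h, hγ', hγ', natCast_finRotate hp]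
    ring
  have hI : primeIdeal k (N (WittVector p k) p) ≤ (⊥ : Ideal C).comap q₀.toRingHom := by
    refine primeIdeal_le_comap k q₀.toRingHom ⊥ hp fun i j => ?_
    change q₀ _ - q₀ _ = 0
    rw [hy, hy, sub_self]
  rw [translatesIdeal, Ideal.mem_iInf] at hs
  have e : q₀ (confRingPerm (WittVector p k) p γ s) = 0 := hI (hs ⟨γ, hγ⟩)
  change q (confRingPerm (WittVector p k) p γ⁻¹ (confRingPerm (WittVector p k) p γ s)) = 0 at e
  have e' := confRingPerm_inv_apply (k := k) γ⁻¹ s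
  rw [inv_inv] at e'
  rwa [e'] at e

end Points

/-- The reduction of a deformation of the configuration `𝔽_p`, at any section of the torsor, is an
affine image of a translate of `𝔽_p`. -/
theorem Deformation.evalPt_mem_maximalIdeal [CharP k p] {Γ : Subgroup (Equiv.Perm (Fin p))}
    (P : Deformation (k := k) Γ) {e : P.fiber.E ⟶ P.base.ring}
    (he : P.fiber.proj ≫ e = 𝟙 P.base.ring) {s : ConfRing (WittVector p k) p}
    (hs : s ∈ translatesIdeal k Γ) :
    evalPt (confPoint (P.fiber.toX e)) s ∈ IsLocalRing.maximalIdeal P.base.ring := by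
  obtain ⟨ek, hek, γ, hγ, h⟩ := P.reduces
  obtain ⟨g, hg, -⟩ := P.fiber.simplyTransitive ek (e ≫ P.base.res) (by
    rw [hek, ← Category.assoc, he, Category.id_comp])
  rw [mem_maximalIdeal_iff]
  have h1 : P.base.res.hom (evalPt (confPoint (P.fiber.toX e)) s) =
      evalPt (confPoint (P.fiber.toX (e ≫ P.base.res))) s := by
    rw [P.fiber.toX_comp, confPoint_map]
    rfl
  rw [h1]
  refine map_translatesIdeal_eq_zero natCast_residueField _ Γ hγ (linPart g : residueField p k)
    (fun i j => ?_) hs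
  have hx : ∀ i, (P.fiber.toX (e ≫ P.base.res)).1 i =
      linPart g * ((γ i : ℕ) : residueField p k) + constPart g := fun i => by
    rw [← hg, P.fiber.toX_smul, conf_smul_apply, h]
    rfl
  rw [confPoint_gen, confForm_diff, hx, hx]
  ring

/-! ### Points of the completed ring -/

section Lift

variable (A : CompleteLocal p k) {Γ : Subgroup (Equiv.Perm (Fin p))}
  (q : ConfRing (WittVector p k) p →ₐ[WittVector p k] A.ring)
  (h : ∀ s ∈ translatesIdeal k Γ, q s ∈ IsLocalRing.maximalIdeal A.ring)

/-- The map modulo powers that is induced by a point of `Spec Sym(λ)[N⁻¹]` whose reduction kills the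
ideal of definition. -/
def truncatedPoint (r : ℕ) :
    CompletedRing k Γ →ₐ[WittVector p k] (A.ring ⧸ IsLocalRing.maximalIdeal A.ring ^ r) :=
  (Ideal.quotientMapₐ (IsLocalRing.maximalIdeal A.ring ^ r) q
    ((Ideal.pow_right_mono h r).trans (Ideal.le_comap_pow _ r))).comp
      ((AdicCompletion.evalₐ (translatesIdeal k Γ) r).restrictScalars (WittVector p k))

theorem truncatedPoint_eq {r : ℕ} {z : CompletedRing k Γ} {s : ConfRing (WittVector p k) p}
    (hs : Ideal.Quotient.mk _ s = AdicCompletion.evalₐ (translatesIdeal k Γ) r z) :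
    truncatedPoint A q h r z = Ideal.Quotient.mk _ (q s) := by
  have hle : translatesIdeal k Γ ^ r ≤ (IsLocalRing.maximalIdeal A.ring ^ r).comap q :=
    (Ideal.pow_right_mono h r).trans (Ideal.le_comap_pow _ r)
  exact (congrArg (Ideal.quotientMapₐ (IsLocalRing.maximalIdeal A.ring ^ r) q hle) hs).symm

theorem factor_truncatedPoint {m r : ℕ} (hle : m ≤ r) :
    (Ideal.Quotient.factorₐ (WittVector p k) (Ideal.pow_le_pow_right hle)).comp
      (truncatedPoint A q h r) = truncatedPoint A q h m := by
  refine AlgHom.ext fun z => ?_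
  obtain ⟨s, hs⟩ := Ideal.Quotient.mk_surjective (AdicCompletion.evalₐ (translatesIdeal k Γ) r z)
  have hs' : Ideal.Quotient.mk _ s = AdicCompletion.evalₐ (translatesIdeal k Γ) m z := by
    rw [← factor_evalₐ k Γ hle z, ← hs]
    rfl
  rw [AlgHom.comp_apply, truncatedPoint_eq A q h hs, truncatedPoint_eq A q h hs']
  rfl

/-- The extension of a point of `Spec Sym(λ)[N⁻¹]` to the completed ring. -/
def completedLift : CompletedRing k Γ →ₐ[WittVector p k] A.ring :=
  haveI := A.complete
  IsAdicComplete.liftAlgHom (IsLocalRing.maximalIdeal A.ring) (truncatedPoint A q h)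
    (factor_truncatedPoint A q h)

theorem mk_completedLift (r : ℕ) (z : CompletedRing k Γ) :
    Ideal.Quotient.mk (IsLocalRing.maximalIdeal A.ring ^ r) (completedLift A q h z) =
      truncatedPoint A q h r z :=
  haveI := A.complete
  IsAdicComplete.mk_liftAlgHom _ _ (factor_truncatedPoint A q h) r z

theorem completedLift_of (s : ConfRing (WittVector p k) p) :
    completedLift A q h (AdicCompletion.of _ _ s) = q s := by
  have := A.complete
  refine (IsHausdorff.eq_iff_smodEq (I := IsLocalRing.maximalIdeal A.ring)).2 fun r => ?_
  rw [smul_eq_mul, Ideal.mul_top]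
  exact (mk_completedLift A q h r _).trans
    (truncatedPoint_eq A q h (AdicCompletion.evalₐ_of _ r s).symm)

/-- The object of the quotient of the formal spectrum of the completed ring by `𝔾ₘ` that is given by
a point of `Spec Sym(λ)[N⁻¹]`. -/
abbrev repObj : RepObj k Γ where
  base := A
  f := completedLift A q h
  continuous m := ⟨m, fun z hz => by
    rw [← Ideal.Quotient.eq_zero_iff_mem, mk_completedLift,
      truncatedPoint_eq A q h (s := 0) ((map_zero _).trans hz.symm), map_zero, map_zero]⟩

end Lift

/-- The point of `Spec Sym(λ)[N⁻¹]` given by a point of the formal spectrum of the completed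
ring. -/
def RepObj.point {Γ : Subgroup (Equiv.Perm (Fin p))} (Q : RepObj k Γ) :
    ConfRing (WittVector p k) p →ₐ[WittVector p k] Q.base.ring :=
  { Q.f.toRingHom.comp (algebraMap (ConfRing (WittVector p k) p) (CompletedRing k Γ)) with
    commutes' := fun w => Q.f.commutes w }

theorem RepObj.point_gen {Γ : Subgroup (Equiv.Perm (Fin p))} (Q : RepObj k Γ)
    (a : stdRep (WittVector p k) p) :
    Q.point (gen _ p _ a) = Q.f (completedGen k Γ a) := rfl

/-- A power of the ideal of definition goes to the maximal ideal by continuity, hence so does the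
ideal itself. -/
theorem RepObj.point_mem {Γ : Subgroup (Equiv.Perm (Fin p))} (Q : RepObj k Γ)
    {s : ConfRing (WittVector p k) p} (hs : s ∈ translatesIdeal k Γ) :
    Q.point s ∈ IsLocalRing.maximalIdeal Q.base.ring := by
  obtain ⟨r, hr⟩ := Q.continuous 1
  have h := hr (algebraMap (ConfRing (WittVector p k) p) (CompletedRing k Γ) (s ^ r))
    ((AdicCompletion.evalₐ_of _ r _).trans
      (Ideal.Quotient.eq_zero_iff_mem.2 (Ideal.pow_mem_pow hs r)))
  rw [pow_one] at h
  have h' : Q.point s ^ r ∈ IsLocalRing.maximalIdeal Q.base.ring := by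
    rw [← map_pow]
    exact h
  exact Ideal.IsPrime.mem_of_pow_mem inferInstance r h'

/-- A prime ideal that contains the intersection of the translates of `I` contains one of them, so
that the reduction of a point of the formal spectrum is a translate of `𝔽_p` up to a homothety. -/
theorem RepObj.exists_residue_point {Γ : Subgroup (Equiv.Perm (Fin p))} (Q : RepObj k Γ) :
    ∃ γ ∈ Γ, ∃ c : (residueField p k)ˣ, ∀ i j,
      Q.base.res.hom (Q.point (gen _ p _ (diff _ p i j))) =
        c * (((γ i : ℕ) : residueField p k) - ((γ j : ℕ) : residueField p k)) := by
  let K := (IsLocalRing.maximalIdeal Q.base.ring).comap Q.point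
  have hK : K.IsPrime := Ideal.IsPrime.comap _
  have hle : translatesIdeal k Γ ≤ K := fun s hs => Q.point_mem hs
  obtain ⟨γ, hγ⟩ : ∃ γ : Γ, (primeIdeal k (N (WittVector p k) p)).comap
      (confRingPerm (WittVector p k) p γ.1) ≤ K := by
    have := Fintype.ofFinite Γ
    rw [translatesIdeal, ← Finset.inf_univ_eq_iInf, hK.inf_le'] at hle
    obtain ⟨γ, -, h⟩ := hle
    exact ⟨γ, h⟩
  obtain ⟨c, hc⟩ := exists_unit_of_primeIdeal_le (Q.base.res.hom.comp Q.point) γ.1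
    (fun s hs => (mem_maximalIdeal_iff _ _).1 (hγ hs))
  exact ⟨γ.1, γ.2, c, hc⟩

end Residue

/-! ### The equivalence for the completions -/

section CompletedEquivalence

open QuotientStack

variable {p : ℕ} [Fact p.Prime] {k : Type u} [Field k] {Γ : Subgroup (Equiv.Perm (Fin p))}

theorem exists_ne_zeroIdx (p : ℕ) [Fact p.Prime] : ∃ j, zeroIdx p ≠ j :=
  ⟨⟨1, (Fact.out : p.Prime).one_lt⟩, fun h => zero_ne_one (congrArg Fin.val h)⟩

/-- A section of a torsor with a map to the configurations of `p` points. Its choice depends on the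
torsor only, so that it is not affected by relabelling. -/
def sect {A : CommAlgCat.{u} (WittVector p k)} (P : Fiber (confSpace (WittVector p k) p) A) :
    P.E ⟶ A :=
  (exists_section P (exists_ne_zeroIdx p).choose_spec).choose

theorem proj_sect {A : CommAlgCat.{u} (WittVector p k)}
    (P : Fiber (confSpace (WittVector p k) p) A) : P.proj ≫ sect P = 𝟙 A :=
  (exists_section P (exists_ne_zeroIdx p).choose_spec).choose_spec

/-- Points over the same base that differ by a unit on `λ` are isomorphic. -/
def scaleIso (A : CompleteLocal p k) {f f' : CompletedRing k Γ →ₐ[WittVector p k] A.ring} {hf hf'}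
    (μ : (A.ring)ˣ) (h : ∀ a, f' (completedGen k Γ a) = μ * f (completedGen k Γ a)) :
    (⟨A, f, hf⟩ : RepObj k Γ) ≅ ⟨A, f', hf'⟩ where
  hom := (⟨𝟙 A, μ, h⟩ : RepObj.Hom (⟨A, f, hf⟩ : RepObj k Γ) ⟨A, f', hf'⟩)
  inv := (⟨𝟙 A, μ⁻¹, fun a => by
    refine Eq.trans ?_ (congrArg (fun t => ((μ⁻¹ : (A.ring)ˣ) : A.ring) * t) (h a)).symm
    exact (Units.inv_mul_cancel_left μ _).symm⟩ :
      RepObj.Hom (⟨A, f', hf'⟩ : RepObj k Γ) ⟨A, f, hf⟩)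
  hom_inv_id := RepObj.Hom.ext' (Category.comp_id _)
    (Units.ext (Units.inv_mul μ))
  inv_hom_id := RepObj.Hom.ext' (Category.comp_id _)
    (Units.ext (Units.mul_inv μ))

/-- Relabelling does not affect the transitions, since it changes neither the torsors nor their
sections. -/
theorem transition_push {P P' : Deformation (k := k) Γ} (a : Deformation.Hom P P')
    (φ : (confSpace (WittVector p k) p).End) :
    transition (a.fiber.push φ) (proj_sect (P.fiber.push φ)) (proj_sect (P'.fiber.push φ)) =
      transition a.fiber (proj_sect P.fiber) (proj_sect P'.fiber) :=
  eq_transition (a.fiber.push φ) (proj_sect (P.fiber.push φ)) (proj_sect (P'.fiber.push φ))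
    (transition_smul a.fiber (proj_sect P.fiber) (proj_sect P'.fiber))

/-- Relabelling of a morphism of deformations. -/
def Deformation.Hom.relabel {P P' : Deformation (k := k) Γ} (σ : Γ) (a : Deformation.Hom P P') :
    Deformation.Hom (P.relabel σ) (P'.relabel σ) :=
  ⟨a.base, a.fiber.push _⟩

/-- The transport along an equality of objects, as for the quotient stacks. -/
theorem RepObj.eqToHom_base {Q Q' : RepObj k Γ} (h : Q = Q') {A : CompleteLocal p k}
    (e : Q.base = A) (e' : Q'.base = A) :
    RepObj.Hom.base (eqToHom h) = eqToHom e ≫ eqToHom e'.symm := by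
  cases h
  rw [eqToHom_trans]
  rfl

theorem RepObj.eqToHom_μ {Q Q' : RepObj k Γ} (h : Q = Q') : RepObj.Hom.μ (eqToHom h) = 1 := by
  cases h
  rfl

variable [CharP k p]

/-- The point of the formal spectrum of the completed ring given by a deformation. -/
def deformationObj (P : Deformation (k := k) Γ) : RepObj k Γ :=
  repObj P.base (evalPt (confPoint (P.fiber.toX (sect P.fiber))))
    (fun _ hs => P.evalPt_mem_maximalIdeal (proj_sect P.fiber) hs)

theorem deformationObj_gen (P : Deformation (k := k) Γ) (a : stdRep (WittVector p k) p) :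
    (deformationObj P).f (completedGen k Γ a) =
      evalPt (confPoint (P.fiber.toX (sect P.fiber))) (gen _ p _ a) :=
  completedLift_of _ _ _ _

/-- The scalar of a morphism of deformations is the linear part of its transition. -/
def deformationMap {P P' : Deformation (k := k) Γ} (a : Deformation.Hom P P') :
    RepObj.Hom (deformationObj P) (deformationObj P') where
  base := a.base
  μ := linPart (transition a.fiber (proj_sect P.fiber) (proj_sect P'.fiber))
  scale v := by
    have h := toX_transition a.fiber (proj_sect P.fiber) (proj_sect P'.fiber)
    have h' := congrArg (fun x => evalPt (confPoint x) (gen _ p _ v)) h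
    simp only [confPoint_smul, confPoint_map, pts_smul_gen] at h'
    refine (deformationObj_gen P' v).trans (h'.trans ?_)
    exact congrArg (fun t => _ * (CompleteLocal.Hom.hom a.base).hom t)
      (deformationObj_gen P v).symm

theorem deformationMap_injective {P P' : Deformation (k := k) Γ} {a b : Deformation.Hom P P'}
    (h : deformationMap a = deformationMap b) : a = b := by
  obtain ⟨f, a⟩ := a
  obtain ⟨f', b⟩ := b
  obtain rfl : f = f' := congrArg RepObj.Hom.base h
  exact Deformation.Hom.ext' rfl (hom_eq_of_linPart_eq (zeroIdx p) (proj_sect P.fiber)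
    (proj_sect P'.fiber) (congrArg RepObj.Hom.μ h))

theorem deformationMap_surjective {P P' : Deformation (k := k) Γ}
    (φ : RepObj.Hom (deformationObj P) (deformationObj P')) : ∃ a, deformationMap a = φ := by
  obtain ⟨f, μ, scale⟩ := φ
  obtain ⟨a, ha⟩ := exists_hom_of_scale (f := CompleteLocal.Hom.hom f) (zeroIdx p)
    (proj_sect P.fiber) (proj_sect P'.fiber) μ (pts_ext fun v => by
      rw [pts_smul_gen]
      refine (deformationObj_gen P' v).symm.trans ((scale v).trans ?_)
      exact congrArg (fun t => _ * (CompleteLocal.Hom.hom f).hom t) (deformationObj_gen P v))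
  exact ⟨⟨f, a⟩, RepObj.Hom.ext' rfl ha⟩

variable (k Γ) in
/-- The functor from the deformations to the points of the formal quotient. -/
def deformationFunctor : BasedFunctor (deformations k Γ) (representable k Γ) where
  obj := fun (P : Deformation (k := k) Γ) => (deformationObj P : RepObj k Γ)
  map := fun {P P' : Deformation (k := k) Γ} (a : Deformation.Hom P P') =>
    (deformationMap a : RepObj.Hom (deformationObj P) (deformationObj P'))
  map_id := fun P => RepObj.Hom.ext' rfl
    (congrArg linPart (transition_id (proj_sect (Deformation.fiber P))))
  map_comp := fun {P P' P''} a b => RepObj.Hom.ext' rfl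
    (congrArg linPart (transition_comp (Deformation.Hom.fiber a) (Deformation.Hom.fiber b)
      (proj_sect (Deformation.fiber P)) (proj_sect (Deformation.fiber P'))
      (proj_sect (Deformation.fiber P''))))
  w := rfl

/-- Every point of the formal quotient comes from a deformation: the underlying point of
`Spec Sym(λ)[N⁻¹]` is the class of an object with a section, whose reduction is a translate of `𝔽_p`
up to an affine transformation. -/
theorem exists_iso_deformationObj (Q : RepObj k Γ) :
    ∃ P : Deformation (k := k) Γ, Nonempty (deformationObj P ≅ Q) := by
  obtain ⟨F, e, he, hx⟩ := exists_fiber_confPoint_eq (A := Q.base.ring) (zeroIdx p) Q.point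
  obtain ⟨γ, hγ, c, hc⟩ := Q.exists_residue_point
  let x := F.toX (e ≫ Q.base.res)
  have hxc : ∀ i j, x.1 i - x.1 j =
      c * (((γ i : ℕ) : residueField p k) - ((γ j : ℕ) : residueField p k)) := fun i j => by
    rw [← hc, ← confForm_diff (R := WittVector p k) x.1, ← confPoint_gen]
    have h : confPoint x = (confRingSpace (WittVector p k) p).map Q.base.res Q.point := by
      rw [← hx, ← confPoint_map, ← F.toX_comp]
    rw [h]
    rfl
  -- the homothety and the translation that move the reduction to `(γ(0), …, γ(p - 1))`
  let g : (Aff (WittVector p k)).obj (residueField p k) :=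
    aff (((γ (zeroIdx p) : ℕ) : residueField p k) -
      ((c⁻¹ : (residueField p k)ˣ) : residueField p k) * x.1 (zeroIdx p)) c⁻¹
  let P : Deformation (k := k) Γ :=
    { base := Q.base
      fiber := F
      reduces := ⟨g • (e ≫ Q.base.res), by
        rw [F.proj_smul, ← Category.assoc, he, Category.id_comp], γ, hγ, fun i => by
        rw [F.toX_smul, conf_smul_apply, linPart_aff, constPart_aff]
        have h := hxc i (zeroIdx p)
        have h' := c.inv_mul
        have : ((c⁻¹ : (residueField p k)ˣ) : residueField p k) * x.1 i +
            (((γ (zeroIdx p) : ℕ) : residueField p k) -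
              ((c⁻¹ : (residueField p k)ˣ) : residueField p k) * x.1 (zeroIdx p)) =
            ((γ i : ℕ) : residueField p k) := by
          linear_combination ((c⁻¹ : (residueField p k)ˣ) : residueField p k) * h +
            (((γ i : ℕ) : residueField p k) - ((γ (zeroIdx p) : ℕ) : residueField p k)) * h'
        exact this⟩ }
  obtain ⟨g', hg', -⟩ := F.simplyTransitive (sect F) e ((proj_sect F).trans he.symm)
  refine ⟨P, ⟨scaleIso Q.base (linPart g') fun a => ?_⟩⟩
  refine Eq.trans ?_ (congrArg (fun t => (linPart g' : Q.base.ring) * t)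
    (deformationObj_gen P a)).symm
  rw [← RepObj.point_gen]
  have h : Q.point = confPoint (g' • F.toX (sect F)) := by rw [← F.toX_smul, hg', hx]
  rw [confPoint_smul] at h
  refine (DFunLike.congr_fun h _).trans ?_
  exact pts_smul_gen _ _ _

theorem deformationFunctor_isEquivalence :
    (deformationFunctor k Γ).toFunctor.IsEquivalence where
  faithful := ⟨fun h => deformationMap_injective h⟩
  full := ⟨fun φ => deformationMap_surjective φ⟩
  essSurj := ⟨fun Q => exists_iso_deformationObj Q⟩

/-- Relabelling a deformation permutes the values on `λ`. -/
def relabelRepIso (σ : Γ) (P : Deformation (k := k) Γ) :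
    deformationObj (P.relabel σ) ≅ (deformationObj P).pull (permEnd k σ) :=
  scaleIso P.base 1 fun a => by
    refine Eq.trans ?_ (one_mul _).symm
    refine Eq.trans ?_ (deformationObj_gen (P.relabel σ) a).symm
    refine (congrArg (deformationObj P).f (completedPerm_gen k σ a)).trans ?_
    refine (deformationObj_gen P _).trans ?_
    refine (confPoint_gen (P.fiber.toX (sect P.fiber)) _).trans ?_
    refine (confForm_perm (P.fiber.toX (sect P.fiber)).1 σ.1 a).symm.trans ?_
    exact (confPoint_gen ((confRelabel _ _ σ.1).app _ (P.fiber.toX (sect P.fiber))) _).symm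

theorem relabelRepIso_naturality {P P' : Deformation (k := k) Γ} (σ : Γ)
    (a : Deformation.Hom P P') :
    (deformationMap (a.relabel σ)).comp (relabelRepIso σ P').hom =
      RepObj.Hom.comp (relabelRepIso σ P).hom ((deformationMap a).pull (permEnd k σ)) := by
  refine RepObj.Hom.ext' ?_ ?_
  · exact (Category.comp_id a.base).trans (Category.id_comp a.base).symm
  · have h1 : ((deformationMap (a.relabel σ)).comp (relabelRepIso σ P').hom).μ =
        (deformationMap (a.relabel σ)).μ := Units.ext (one_mul (M := P'.base.ring) _)
    have h : ∀ (x : (P.base.ring)ˣ) (y : (P'.base.ring)ˣ), x = 1 →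
        y * Units.map (CompleteLocal.Hom.hom a.base).hom.toRingHom.toMonoidHom x = y := by
      intro x y hx
      rw [hx, map_one, mul_one]
    have h2 : (RepObj.Hom.comp (relabelRepIso σ P).hom
        ((deformationMap a).pull (permEnd k σ))).μ = (deformationMap a).μ := h _ _ rfl
    exact h1.trans ((congrArg linPart (transition_push a _)).trans h2.symm)

/-- Passage to the formal quotient commutes with relabelling. -/
def deformationComm (σ : Γ) :
    BasedFunctor.comp ((deformationsAct k Γ).act σ) (deformationFunctor k Γ) ≅
      BasedFunctor.comp (deformationFunctor k Γ) ((repAct k Γ).act σ) :=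
  BasedNatIso.mkNatIso
    (NatIso.ofComponents (fun P => relabelRepIso σ P)
      (fun a => relabelRepIso_naturality σ a))
    (fun P => IsHomLift.map (representable k Γ).p (relabelRepIso σ P).hom)

theorem deformationMap_eqToHom_base {P P' : Deformation (k := k) Γ} (h : P = P')
    {A : CompleteLocal p k} (e : P.base = A) (e' : P'.base = A) :
    (deformationMap (eqToHom h)).base = eqToHom e ≫ eqToHom e'.symm := by
  cases h
  rw [eqToHom_trans]
  rfl

theorem deformationMap_eqToHom_μ {P P' : Deformation (k := k) Γ} (h : P = P') :
    (deformationMap (eqToHom h)).μ = 1 := by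
  cases h
  exact congrArg linPart (transition_id (proj_sect (Deformation.fiber P)))

/-- Coherence of the relabelling isomorphisms: they are given by the unit `1`. -/
theorem relabelRepIso_mul (g h : Γ) (P : Deformation (k := k) Γ)
    (a : RepObj.Hom (deformationObj (P.relabel (g * h)))
      (deformationObj ((P.relabel g).relabel h)))
    (d : RepObj.Hom (((deformationObj P).pull (permEnd k g)).pull (permEnd k h))
      ((deformationObj P).pull (permEnd k (g * h))))
    (ha : a.base = 𝟙 P.base) (ha' : a.μ = 1) (hd : d.base = 𝟙 P.base) (hd' : d.μ = 1) :
    (relabelRepIso (g * h) P).hom =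
      a ≫ (relabelRepIso h (P.relabel g)).hom ≫
        (repMap (permEnd k h)).map (relabelRepIso g P).hom ≫ d := by
  refine RepObj.Hom.ext' ?_ ?_
  · change 𝟙 P.base = a.base ≫ 𝟙 P.base ≫ 𝟙 P.base ≫ d.base
    have h1 : 𝟙 P.base ≫ 𝟙 P.base ≫ d.base = 𝟙 P.base :=
      (Category.id_comp _).trans ((Category.id_comp _).trans hd)
    refine Eq.trans ?_ (congrArg (a.base ≫ ·) h1).symm
    exact ((Category.comp_id _).trans ha).symm
  · have h1 : ∀ (b : P.base ⟶ P.base) (x y : (P.base.ring)ˣ), x = 1 → y = 1 →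
        y * Units.map (CompleteLocal.Hom.hom b).hom.toRingHom.toMonoidHom x = 1 := by
      intro b x y hx hy
      rw [hx, hy, map_one, mul_one]
    exact (h1 _ _ _ ha' (h1 _ _ _ rfl (h1 _ _ _ rfl hd'))).symm

theorem deformationComm_mul (g h : Γ) (P : Deformation (k := k) Γ)
    (e : P.relabel (g * h) = (P.relabel g).relabel h)
    (e' : ((deformationObj P).pull (permEnd k g)).pull (permEnd k h) =
      (deformationObj P).pull (permEnd k (g * h))) :
    (relabelRepIso (g * h) P).hom = deformationMap (eqToHom e) ≫
      (relabelRepIso h (P.relabel g)).hom ≫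
        (repMap (permEnd k h)).map (relabelRepIso g P).hom ≫ eqToHom e' :=
  relabelRepIso_mul g h P _ _
    ((deformationMap_eqToHom_base e (A := P.base) rfl rfl).trans (Category.comp_id (𝟙 P.base)))
    (deformationMap_eqToHom_μ e)
    ((RepObj.eqToHom_base e' (A := P.base) rfl rfl).trans (Category.comp_id (𝟙 P.base)))
    (RepObj.eqToHom_μ e')

variable (k Γ) in
theorem nonempty_completedEquivalence :
    Nonempty (EquivariantEquivalence (deformationsAct k Γ) (repAct k Γ)) := by
  refine ⟨⟨deformationFunctor k Γ, deformationFunctor_isEquivalence, deformationComm, ?_⟩⟩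
  intro g h P
  exact deformationComm_mul g h P _ _

end CompletedEquivalence

end ConfModuli

end

theorem theoremB2 (R : Type u) [CommRing R] (n : ℕ) (hn : 1 ≤ n)
    (p : ℕ) [Fact p.Prime] (k : Type u) [Field k] [CharP k p] :
    -- the grading of `Sym(λ)[N⁻¹]`: generators in degree `-2`, and the action of `𝔾ₘ` it encodes
    (DirectSum.IsInternal (ConfModuli.degreePart R n) ∧
      SetLike.GradedMonoid (ConfModuli.degreePart R n) ∧
      (∀ a : ConfModuli.stdRep R n,
        ConfModuli.gen R n (ConfModuli.N R n) a ∈ ConfModuli.degreePart R n (-2)) ∧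
      (∀ (C : Type u) [CommRing C] [Algebra R C] (q : ConfModuli.ConfRing R n →ₐ[R] C) (μ : Cˣ)
        (m : ℤ), ∀ s ∈ ConfModuli.degreePart R n (-2 * m),
          ConfModuli.confRingScale μ q s = ((μ ^ m : Cˣ) : C) * q s)) ∧
    -- the global statement
    Nonempty (ConfModuli.EquivariantEquivalence
      (ConfModuli.confAct R n) (ConfModuli.confRingAct R n)) ∧
    -- the completed statement
    (∀ Γ : Subgroup (Equiv.Perm (Fin p)),
      Nonempty (ConfModuli.EquivariantEquivalence
        (ConfModuli.deformationsAct k Γ) (ConfModuli.repAct k Γ))) ∧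
    -- for groups of affine permutations of `𝔽_p` the completion is the one at `I = (p, y_i - y_j)`
    (∀ Γ : Subgroup (Equiv.Perm (Fin p)),
      (∀ τ ∈ Γ, ∃ a b : ZMod p, ∀ i : Fin p, ((τ i : ℕ) : ZMod p) = a * ((i : ℕ) : ZMod p) + b) →
        ConfModuli.translatesIdeal k Γ =
          ConfModuli.primeIdeal k (ConfModuli.N (WittVector p k) p)) ∧
    -- at `I`, it makes no difference to invert only the cyclic translates of `y_0`
    (∃ e : AdicCompletion
          (ConfModuli.primeIdeal k (ConfModuli.cyclicN (WittVector p k) p))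
          (ConfModuli.SymAway (WittVector p k) p (ConfModuli.cyclicN (WittVector p k) p)) ≃+*
        AdicCompletion
          (ConfModuli.primeIdeal k (ConfModuli.N (WittVector p k) p))
          (ConfModuli.ConfRing (WittVector p k) p),
      (∀ a : ConfModuli.Sym (WittVector p k) p,
        e (AdicCompletion.of _ _ (algebraMap _ _ a)) =
          AdicCompletion.of _ _ (algebraMap _ _ a)) ∧
      ∀ (r : ℕ) z, AdicCompletion.evalₐ _ r z = 0 ↔ AdicCompletion.evalₐ _ r (e z) = 0) := by
  exact ⟨⟨ConfModuli.degreePart_isInternal hn, inferInstance, ConfModuli.gen_mem_degreePart,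
      fun _ _ _ q μ m _ hs => ConfModuli.confRingScale_degreePart hn q μ m hs⟩,
    ConfModuli.nonempty_globalEquivalence hn,
    fun Γ => ConfModuli.nonempty_completedEquivalence k Γ,
    ConfModuli.translatesIdeal_eq_primeIdeal k, ConfModuli.exists_cyclic_completion_equiv p k⟩
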